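/- **Machines.** Strings are elements of $\{0,1\}^*$; natural numbers are written as binary strings; $(x,y)$ denotes the string $1^{|x|}0xy$, and $(x,y,z)=(x,(y,z))$. A *deterministic-control quantum Turing machine* (dcq-TM) has a finite set $Q$ of control states containing two distinct states $q_s$ (start) and $q_h$ (halt), a two-way infinite classical tape over $\{0,1,\Box\}$, a two-way infinite tape of qubits, one head on each tape, and a transition function $$\delta: Q\times\{0,1,\Box\}\to \mathbb U\times\{L,N,R\}\times\{0,1,\Box\}\times\{L,N,R\}\times Q,\qquad \mathbb U=\{\mathrm{Id},H,S,\pi/8,\mathrm{SWAP},\mathrm{CNOT}\},$$ which prescribes the gate applied at the quantum head (two-qubit gates act on the cell under the head and its right neighbour, the former being the control of $\mathrm{CNOT}$), the move of the quantum head, the symbol written on the classical tape, the move of the classical head, and the new state. On input $(x;\rho)$, with $\rho$ a (mixed) state of $n$ qubits, both heads start on cell $0$, the classical tape holds $x\Box n$ from cell $1$ on and blanks elsewhere, and the quantum tape holds $\rho$ in the cells $1,\dots,n$ and $|0\rangle\langle 0|$ elsewhere. When $q_h$ is first reached, the output is $(y;\sigma)$, where $y$ is the string from cell $1$ to the first blank,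 the string $m$ between the first and the second blank specifies a number of qubits, and $\sigma$ is the reduced state of the quantum cells $1,\dots,m$; write $T(x;\rho)=(y;\sigma)$ and $T^{(Q)}(x;\rho)=\sigma$. The empty quantum input is $\epsilon$. A classical Turing machine is defined in the same way without quantum tape. A dcq-TM $U$ is *universal* (with the s-m-n property) if for every dcq-TM $T$ there is a string $t$ with $U((t,x);\rho)=T(x;\rho)$ for all $(x;\rho)$ (either both sides are undefined or they are equal), and if there is a computable map $s$ such that $U((s(t,p),x);\rho)=U((t,p,x);\rho)$ for all $t,p,x,\rho$, and for each $t$ there is a constant $c_t$ with $|s(t,p)|\le|p|+c_t$ for all $p$. Universal classical Turing machines are defined in the same way. **Complexities.** For a state $\rho$ of $n$ qubits, and $D(\rho,\sigma)=\frac12\|\rho-\sigma\|_1$, let $$K_U(\rho)=\inf\{|p| : \forall k\ge 1,\ D(U^{(Q)}((p,k);\epsilon),\rho)\le 1/k\}\in\mathbb N\cup\{\infty\},$$ where the condition includes that the computations halt with an output of $n$ qubits. The classical representation $\boldsymbol\rho$ of $\rho$ is its $2^n\times 2^n$ density matrix in the computational basis, and for a classical Turing machine $V$, $K_V(\boldsymbol\rho)\in\mathbb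 N\cup\{\infty\}$ is the infimum of $|p|$ over all $p$ such that, for every $k\ge1$, $V$ on input $(p,k)$ outputs the code of a $2^n\times2^n$ array of complex numbers with rational real and imaginary parts, each within $1/k$ of the real or imaginary part of the corresponding entry of $\boldsymbol\rho$. **Theorem.** Let $U$ be a universal dcq-TM and $V$ a universal classical Turing machine. There is a constant $c\in\mathbb N$ such that for every $n\ge0$ and every state $\rho$ of $n$ qubits $$K_V(\boldsymbol\rho)\le K_U(\rho)+c\qquad\text{and}\qquad K_U(\rho)\le K_V(\boldsymbol\rho)+c.$$ (In particular, one of the two is infinite if and only if the other is.) -/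

import Mathlib

/-! ## Strings and encodings -/

/-- Binary strings. -/
abbrev BitString : Type := List Bool

/-- Natural numbers as binary numerals (least significant bit first; the number `0` is the empty
string). -/
def natToStr (n : ℕ) : BitString := n.bits

/-- The number denoted by a binary string. -/
def strToNat (s : BitString) : ℕ := s.foldr Nat.bit 0

theorem strToNat_natToStr (n : ℕ) : strToNat (natToStr n) = n := by
  unfold strToNat natToStr
  induction n using Nat.binaryRec' with
  | zero => simp
  | bit b n h ih => rw [Nat.bits_append_bit n b h, List.foldr_cons, ih]

/-- The self-delimiting form `1^{|x|} 0 x` of a string `x`. -/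
def selfDelim (x : BitString) : BitString := List.replicate x.length true ++ false :: x

/-- The pair `(x, y)`, encoded as `1^{|x|} 0 x y`.  Longer tuples are nested to the right:
`(x, y, z) = (x, (y, z))`. -/
def strPair (x y : BitString) : BitString := selfDelim x ++ y

/-- The uniquely decodable encoding `[x₁, …, x_m]` of a tuple of any length. -/
def strTuple (l : List BitString) : BitString := l.flatMap selfDelim

/-- A rational number, encoded as sign, numerator and denominator. -/
def ratToStr (q : ℚ) : BitString :=
  strTuple [[decide (q < 0)], natToStr q.num.natAbs, natToStr q.den]

/-- A square array of complex numbers with rational real and imaginary parts, encoded as the tuple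
of its rows. -/
def matToStr {N : ℕ} (A : Matrix (Fin N) (Fin N) (ℚ × ℚ)) : BitString :=
  strTuple (List.ofFn fun i => strTuple (List.ofFn fun j =>
    strTuple [ratToStr (A i j).1, ratToStr (A i j).2]))

/-! ## Classical tapes -/

/-- The tape alphabet `{0, 1, □}`; the blank is `none`. -/
abbrev TapeSymbol : Type := Option Bool

/-- Head displacements. -/
inductive HeadMove : Type
  | left
  | stay
  | right

def HeadMove.toInt : HeadMove → ℤ
  | left => -1
  | stay => 0
  | right => 1

/-- The two-way infinite tape that holds the symbols of `l` in the cells `1, 2, …`, and blanks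
elsewhere.  The anchor is the cell `0`. -/
def tapeOf (l : List TapeSymbol) : ℤ → TapeSymbol :=
  fun i => if 1 ≤ i then (l[(i - 1).toNat]?).getD none else none

/-- `y` is the string written from the cell `a` up to the first blank cell at or after `a`. -/
def ReadsFrom (tape : ℤ → TapeSymbol) (a : ℤ) (y : BitString) : Prop :=
  (∀ i : Fin y.length, tape (a + (i : ℕ)) = some (y.get i)) ∧ tape (a + y.length) = none

/-! ## Classical Turing machines -/

/-- A (deterministic, single tape) classical Turing machine over the alphabet `{0, 1, □}`. -/
structure ClassicalTM : Type 1 where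
  Q : Type
  [fintypeQ : Fintype Q]
  [decEqQ : DecidableEq Q]
  start : Q
  halt : Q
  start_ne_halt : start ≠ halt
  δ : Q → TapeSymbol → TapeSymbol × HeadMove × Q

namespace ClassicalTM

attribute [instance] ClassicalTM.fintypeQ ClassicalTM.decEqQ

structure Config (M : ClassicalTM) : Type where
  state : M.Q
  tape : ℤ → TapeSymbol
  head : ℤ

variable (M : ClassicalTM)

def init (x : BitString) : M.Config where
  state := M.start
  tape := tapeOf (x.map some)
  head := 0

/-- One step of the computation; a machine in the halting state does not move any more. -/
def step (c : M.Config) : M.Config :=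
  if c.state = M.halt then c else
    let r := M.δ c.state (c.tape c.head)
    { state := r.2.2
      tape := Function.update c.tape c.head r.1
      head := c.head + r.2.1.toInt }

/-- On input `x` the machine halts with output `y`. -/
def Outputs (x y : BitString) : Prop :=
  ∃ t : ℕ, (M.step^[t] (M.init x)).state = M.halt ∧ ReadsFrom (M.step^[t] (M.init x)).tape 1 y

/-- `U` is a universal Turing machine with the s-m-n property: it runs every machine `T` under
some program `t`, and there is a computable map `s` that fixes the first component of the input of
a program, at the cost of a constant (depending on the program) in length. -/
def IsUniversal (U : ClassicalTM) : Prop :=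
  (∀ T : ClassicalTM, ∃ t : BitString, ∀ x y : BitString,
    U.Outputs (strPair t x) y ↔ T.Outputs x y) ∧
  ∃ s : BitString → BitString → BitString, Computable₂ s ∧
    (∀ t : BitString, ∃ c : ℕ, ∀ p : BitString, (s t p).length ≤ p.length + c) ∧
    ∀ t p x y : BitString,
      U.Outputs (strPair (s t p) x) y ↔ U.Outputs (strPair t (strPair p x)) y

end ClassicalTM

/-! ## Quantum states -/

open scoped ComplexOrder in
/-- States of `n` qubits, as density matrices in the computational basis.  The basis vector
`|x₁ x₂ … x_n⟩` has the index `∑ x_i 2^(n-i)`. -/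
structure QState (n : ℕ) : Type where
  mat : Matrix (Fin (2 ^ n)) (Fin (2 ^ n)) ℂ
  posSemidef : mat.PosSemidef
  trace_eq_one : mat.trace = 1

open scoped ComplexOrder in
/-- The state `ε` of no qubits. -/
def QState.empty : QState 0 where
  mat := 1
  posSemidef := Matrix.PosSemidef.one
  trace_eq_one := by simp

/-- The trace distance `½ ‖A - B‖₁`, half the sum of the singular values of `A - B`. -/
noncomputable def traceDist {N : ℕ} (A B : Matrix (Fin N) (Fin N) ℂ) : ℝ :=
  (1 / 2) * ∑ i, √((Matrix.isHermitian_conjTranspose_mul_self (A - B)).eigenvalues i)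

/-! ## The quantum tape -/

/-- A computational basis state of the quantum tape, whose cells are indexed by `ℤ`: the finite set
of the cells that are in the state `|1⟩`. -/
abbrev TapeBasis : Type := Finset ℤ

/-- Density operators of the quantum tape, as matrices in the computational basis. -/
abbrev QTape : Type := TapeBasis → TapeBasis → ℂ

/-- The basis state of the tape with `|x₁ … x_n⟩` in the cells `1, …, n` and `|0⟩` elsewhere. -/
noncomputable def basisCells (n : ℕ) (x : Fin (2 ^ n)) : TapeBasis :=
  (Finset.Icc (1 : ℤ) n).filter fun i => (x : ℕ).testBit (n - i.toNat) = true

/-- The tape holding `ρ` in the cells `1, …, n`, and `|0⟩⟨0|` in all other cells. -/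
noncomputable def QTape.ofState {n : ℕ} (ρ : QState n) : QTape :=
  fun a b => ∑ x, ∑ y, if a = basisCells n x ∧ b = basisCells n y then ρ.mat x y else 0

/-- The partial trace over all cells but `1, …, m`.  (Of the sum, only finitely many terms are
nonzero for the tapes that occur in a computation.) -/
noncomputable def QTape.reduced (τ : QTape) (m : ℕ) : Matrix (Fin (2 ^ m)) (Fin (2 ^ m)) ℂ :=
  fun x y => ∑ᶠ (e : TapeBasis) (_ : Disjoint e (Finset.Icc (1 : ℤ) m)),
    τ (basisCells m x ∪ e) (basisCells m y ∪ e)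

/-- The values of the cells `i` and `i + 1`. -/
def getCells (i : ℤ) (a : TapeBasis) : Bool × Bool := (decide (i ∈ a), decide (i + 1 ∈ a))

/-- Overwrite the cell `i`. -/
def setCell (i : ℤ) (v : Bool) (a : TapeBasis) : TapeBasis := if v then insert i a else a.erase i

/-- Overwrite the cells `i` and `i + 1`. -/
def setCells (i : ℤ) (v : Bool × Bool) (a : TapeBasis) : TapeBasis :=
  setCell i v.1 (setCell (i + 1) v.2 a)

/-- The operation `τ ↦ G τ G†`, where `G` acts on the cells `i` and `i + 1`. -/
noncomputable def QTape.conj (τ : QTape) (i : ℤ) (G : Matrix (Bool × Bool) (Bool × Bool) ℂ) :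
    QTape :=
  fun a b => ∑ v, ∑ w,
    G (getCells i a) v * τ (setCells i v a) (setCells i w b) * star (G (getCells i b) w)

/-- The basic quantum operations: identity, Hadamard, phase, `π/8`, swap and controlled not. -/
inductive QGate : Type
  | ident
  | hadamard
  | phase
  | piEighth
  | swap
  | cnot

open scoped Kronecker in
/-- The unitary of a gate on the cell under the head (first factor) and its right neighbour.
One-qubit gates act on the cell under the head, which is also the control of `cnot`. -/
noncomputable def QGate.mat : QGate → Matrix (Bool × Bool) (Bool × Bool) ℂ
  | ident => 1
  | hadamard =>
      (Matrix.of fun a b : Bool => (if a && b then -1 else 1) / ((√2 : ℝ) : ℂ)) ⊗ₖ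
        (1 : Matrix Bool Bool ℂ)
  | phase =>
      Matrix.diagonal (fun a : Bool => if a then Complex.I else 1) ⊗ₖ (1 : Matrix Bool Bool ℂ)
  | piEighth =>
      Matrix.diagonal (fun a : Bool =>
        if a then Complex.exp (((Real.pi / 4 : ℝ) : ℂ) * Complex.I) else 1) ⊗ₖ
          (1 : Matrix Bool Bool ℂ)
  | swap => Matrix.of fun a b => if a = (b.2, b.1) then 1 else 0
  | cnot => Matrix.of fun a b => if a = (b.1, xor b.1 b.2) then 1 else 0

/-! ## Deterministic-control quantum Turing machines -/

/-- A deterministic-control quantum Turing machine.  A transition gives the gate to be applied at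
the quantum head, the move of the quantum head, the symbol to be written on the classical tape, the
move of the classical head, and the new control state. -/
structure DcqTM : Type 1 where
  Q : Type
  [fintypeQ : Fintype Q]
  [decEqQ : DecidableEq Q]
  start : Q
  halt : Q
  start_ne_halt : start ≠ halt
  δ : Q → TapeSymbol → QGate × HeadMove × TapeSymbol × HeadMove × Q

namespace DcqTM

attribute [instance] DcqTM.fintypeQ DcqTM.decEqQ

structure Config (M : DcqTM) : Type where
  state : M.Q
  tape : ℤ → TapeSymbol
  head : ℤ
  qtape : QTape
  qhead : ℤ

variable (M : DcqTM)

/-- The starting configuration on input `(x; ρ)`: the classical tape holds `x □ n`, both heads are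
on the anchor cells. -/
noncomputable def init (x : BitString) {n : ℕ} (ρ : QState n) : M.Config where
  state := M.start
  tape := tapeOf (x.map some ++ none :: (natToStr n).map some)
  head := 0
  qtape := QTape.ofState ρ
  qhead := 0

/-- One step of the computation; a machine in the halting state does not move any more. -/
noncomputable def step (c : M.Config) : M.Config :=
  if c.state = M.halt then c else
    let r := M.δ c.state (c.tape c.head)
    { state := r.2.2.2.2
      tape := Function.update c.tape c.head r.2.2.1
      head := c.head + r.2.2.2.1.toInt
      qtape := c.qtape.conj c.qhead r.1.mat
      qhead := c.qhead + r.2.1.toInt }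

/-- `M(x; ρ) = (y; σ)`, where `σ` is a state of `m` qubits: the machine halts, `y` is the string
between the anchor and the first blank, the string between the first and the second blank specifies
`m`, and `σ` is the state of the cells `1, …, m`. -/
def Outputs (x : BitString) {n : ℕ} (ρ : QState n) (y : BitString) (m : ℕ)
    (σ : Matrix (Fin (2 ^ m)) (Fin (2 ^ m)) ℂ) : Prop :=
  ∃ t : ℕ, (M.step^[t] (M.init x ρ)).state = M.halt ∧
    ReadsFrom (M.step^[t] (M.init x ρ)).tape 1 y ∧
    (∃ s : BitString,
      ReadsFrom (M.step^[t] (M.init x ρ)).tape (1 + y.length + 1) s ∧ m = strToNat s) ∧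
    σ = (M.step^[t] (M.init x ρ)).qtape.reduced m

/-- `U` is a universal dcq-TM with the s-m-n property: it runs every machine `T` under some
program `t`, and there is a computable map `s` that fixes the first component of the classical input
of a program, at the cost of a constant (depending on the program) in length. -/
def IsUniversal (U : DcqTM) : Prop :=
  (∀ T : DcqTM, ∃ t : BitString, ∀ (x : BitString) (n : ℕ) (ρ : QState n) (y : BitString) (m : ℕ)
      (σ : Matrix (Fin (2 ^ m)) (Fin (2 ^ m)) ℂ),
    U.Outputs (strPair t x) ρ y m σ ↔ T.Outputs x ρ y m σ) ∧
  ∃ s : BitString → BitString → BitString, Computable₂ s ∧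
    (∀ t : BitString, ∃ c : ℕ, ∀ p : BitString, (s t p).length ≤ p.length + c) ∧
    ∀ (t p x : BitString) (n : ℕ) (ρ : QState n) (y : BitString) (m : ℕ)
      (σ : Matrix (Fin (2 ^ m)) (Fin (2 ^ m)) ℂ),
      U.Outputs (strPair (s t p) x) ρ y m σ ↔ U.Outputs (strPair t (strPair p x)) ρ y m σ

end DcqTM

/-! ## Kolmogorov complexity -/

/-- The complexity `K_T(ρ)` of a quantum state: the least length of a string `p` such that, for all
`k ≥ 1`, the quantum output of `T` on input `((p, k); ε)` is within trace distance `1 / k` of `ρ`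
(and `∞` if there is none). -/
noncomputable def DcqTM.stateComplexity (T : DcqTM) {n : ℕ} (ρ : QState n) : ℕ∞ :=
  ⨅ (p : BitString)
    (_ : ∀ k : ℕ, 1 ≤ k → ∃ (y : BitString) (σ : Matrix (Fin (2 ^ n)) (Fin (2 ^ n)) ℂ),
      T.Outputs (strPair p (natToStr k)) QState.empty y n σ ∧
      traceDist σ ρ.mat ≤ 1 / (k : ℝ)),
    (p.length : ℕ∞)

/-- The complexity of an array of complex numbers with respect to a classical machine `V`: the least
length of a string `p` such that, for all `k ≥ 1`, the output of `V` on input `(p, k)` is an array of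
rational approximations, within `1 / k`, of the real and imaginary parts of all entries (and `∞` if
there is none). -/
noncomputable def ClassicalTM.arrayComplexity (V : ClassicalTM) {N : ℕ}
    (A : Matrix (Fin N) (Fin N) ℂ) : ℕ∞ :=
  ⨅ (p : BitString)
    (_ : ∀ k : ℕ, 1 ≤ k → ∃ B : Matrix (Fin N) (Fin N) (ℚ × ℚ),
      V.Outputs (strPair p (natToStr k)) (matToStr B) ∧
      ∀ i j, |(A i j).re - ((B i j).1 : ℝ)| ≤ 1 / (k : ℝ) ∧
        |(A i j).im - ((B i j).2 : ℝ)| ≤ 1 / (k : ℝ)),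
    (p.length : ℕ∞)

/-! Each inequality reduces to one machine. Suppose that a fixed machine `T`, given `(p, k)`,
produces the approximation of the other kind whenever `p` is a program for the state. Universality
gives a string `t` that runs `T`, and the s-m-n map turns `p` into the program `s t p`, which is
longer by at most a constant depending on `t`. It remains to construct `T` in both directions.

From quantum to classical (`ClassicalTM.exists_of_dcq`): the control of a dcq-TM never depends on
the qubits, so a classical simulation of it yields the list of the applied gates. Each gate splits a
branch of the state into at most two branches, whose phases are powers of `e^{iπ/4}`. An entry of
the reduced density matrix is therefore `2⁻ʰ`, with `h` the number of Hadamard gates, times a finite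
sum of eighth roots of unity over pairs of branches (`reduced_pathVec`), and integer square roots
give dyadic approximations of it. Closeness in trace distance implies closeness of the entries.

From classical to quantum (`DcqTM.exists_of_classical`): the machine obtains an array from `V` at a
precision of order `1 / (k 4ⁿ)`, searches for a list of gates whose computed output is close to this
array, and applies the gates. Such a list exists because the gates prepare every state approximately
(`exists_quantumRun_near`): `ρ` has a purification on `2 n` cells, and every unit vector of an
interval of cells is a limit of reachable vectors, up to a phase (`mem_approachable`).

The last fact has a variational proof. The closure of the reachable vectors is compact, so it
contains a vector `φ` with maximal overlap with the target `ψ`. The closure is invariant under the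
Clifford operators and, since `T H T H` is a rotation by an irrational multiple of `2π`, under a
continuous group of rotations. Maximality makes the derivative of the overlap vanish along these
rotations, hence along one Pauli `X`, and by Clifford conjugation along every Pauli operator. As the
Pauli operators span all matrices, `φ` has to be a multiple of `ψ`.

Both machines are unbounded searches for a witness of a primitive recursive relation; the witness
contains the running time of the simulated machine. So it is enough to compile primitive recursive
functions and one search to tapes, by way of register programs. The witness found may differ from
the one known to exist; the determinism of the simulated machine shows that any witness is good. -/

/-! ## Structured programs for one classical tape -/

/-- The memory of a machine with a classical tape: the tape, the head position, and the list of the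
actions that have been emitted so far. -/
structure Store (A : Type) : Type where
  tape : ℤ → TapeSymbol
  head : ℤ
  trace : List A

/-- Write a symbol, move the head and emit an action. -/
def Store.act {A : Type} (σ : Store A) (s : TapeSymbol) (m : HeadMove) (a : Option A) : Store A where
  tape := Function.update σ.tape σ.head s
  head := σ.head + m.toInt
  trace := σ.trace ++ a.toList

/-- A machine fragment: a control with an entry state and an exit (the next state `none`). -/
structure Fragment (A : Type) : Type 1 where
  Q : Type
  [fintypeQ : Fintype Q]
  [decEqQ : DecidableEq Q]
  entry : Q
  δ : Q → TapeSymbol → Option A × TapeSymbol × HeadMove × Option Q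

namespace Fragment

attribute [instance] Fragment.fintypeQ Fragment.decEqQ

variable {A : Type}

/-- The configuration after one step from the state `q`. -/
def next (F : Fragment A) (q : F.Q) (σ : Store A) : Option F.Q × Store A :=
  let r := F.δ q (σ.tape σ.head)
  (r.2.2.2, σ.act r.2.1 r.2.2.1 r.1)

def Step (F : Fragment A) (c c' : Option F.Q × Store A) : Prop :=
  ∃ q, c.1 = some q ∧ c' = F.next q c.2

def Reaches (F : Fragment A) : Option F.Q × Store A → Option F.Q × Store A → Prop :=
  Relation.ReflTransGen F.Step

/-- The fragment, entered with the store `σ`, is left with the store `σ'`. -/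
def Runs (F : Fragment A) (σ σ' : Store A) : Prop :=
  F.Reaches (some F.entry, σ) (none, σ')

theorem Reaches.single {F : Fragment A} (q : F.Q) (σ : Store A) :
    F.Reaches (some q, σ) (F.next q σ) :=
  Relation.ReflTransGen.single ⟨q, rfl, rfl⟩

/-- A fragment embedded in a larger one, its exit being redirected to `e`. -/
theorem Reaches.embed {F G : Fragment A} (f : F.Q → G.Q) (e : Option G.Q)
    (h : ∀ q s, G.δ (f q) s =
      ((F.δ q s).1, (F.δ q s).2.1, (F.δ q s).2.2.1, (F.δ q s).2.2.2.elim e fun q => some (f q)))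
    {c c' : Option F.Q × Store A} (hc : F.Reaches c c') :
    G.Reaches (c.1.elim e fun q => some (f q), c.2) (c'.1.elim e fun q => some (f q), c'.2) := by
  refine Relation.ReflTransGen.lift
    (f := fun c : Option F.Q × Store A => (c.1.elim e fun q => some (f q), c.2)) ?_ c c' hc
  rintro ⟨o, σ⟩ c' ⟨q, hq, rfl⟩
  simp only at hq
  subst hq
  exact ⟨f q, rfl, by simp [next, h]⟩

/-- A single step. -/
def single (w : TapeSymbol → TapeSymbol) (m : HeadMove) (a : Option A) : Fragment A where
  Q := Unit
  entry := ()
  δ _ s := (a, w s, m, none)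

/-- Run `F`, then `G`. -/
def seq (F G : Fragment A) : Fragment A where
  Q := F.Q ⊕ G.Q
  entry := .inl F.entry
  δ r s := match r with
    | .inl r => ((F.δ r s).1, (F.δ r s).2.1, (F.δ r s).2.2.1,
        (F.δ r s).2.2.2.elim (some (.inr G.entry)) fun r => some (.inl r))
    | .inr r => ((G.δ r s).1, (G.δ r s).2.1, (G.δ r s).2.2.1,
        (G.δ r s).2.2.2.elim none fun r => some (.inr r))

/-- Run `F` or `G`, depending on the symbol under the head. -/
def ite (t : TapeSymbol → Bool) (F G : Fragment A) : Fragment A where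
  Q := Unit ⊕ F.Q ⊕ G.Q
  entry := .inl ()
  δ r s := match r with
    | .inl _ => (none, s, .stay, some (.inr
        (if t s = true then .inl F.entry else .inr G.entry)))
    | .inr (.inl r) => ((F.δ r s).1, (F.δ r s).2.1, (F.δ r s).2.2.1,
        (F.δ r s).2.2.2.elim none fun r => some (.inr (.inl r)))
    | .inr (.inr r) => ((G.δ r s).1, (G.δ r s).2.1, (G.δ r s).2.2.1,
        (G.δ r s).2.2.2.elim none fun r => some (.inr (.inr r)))

/-- Repeat `F` as long as the symbol under the head satisfies `t`. -/
def loop (t : TapeSymbol → Bool) (F : Fragment A) : Fragment A where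
  Q := Unit ⊕ F.Q
  entry := .inl ()
  δ r s := match r with
    | .inl _ => (none, s, .stay, if t s = true then some (.inr F.entry) else none)
    | .inr r => ((F.δ r s).1, (F.δ r s).2.1, (F.δ r s).2.2.1,
        (F.δ r s).2.2.2.elim (some (.inl ())) fun r => some (.inr r))

end Fragment

/-- Structured tape programs that emit actions of type `A`. -/
inductive Prog (A : Type) : Type
  | op (w : TapeSymbol → TapeSymbol) (m : HeadMove) (a : Option A)
  | seq (p q : Prog A)
  | ite (t : TapeSymbol → Bool) (p q : Prog A)
  | loop (t : TapeSymbol → Bool) (p : Prog A)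

namespace Prog

variable {A : Type}

/-- Big-step semantics. -/
inductive Exec : Prog A → Store A → Store A → Prop
  | op (w m a) (σ : Store A) : Exec (op w m a) σ (σ.act (w (σ.tape σ.head)) m a)
  | seq {p q σ σ' σ''} : Exec p σ σ' → Exec q σ' σ'' → Exec (seq p q) σ σ''
  | ite_true {t p q σ σ'} : t (σ.tape σ.head) = true → Exec p σ σ' → Exec (ite t p q) σ σ'
  | ite_false {t p q σ σ'} : t (σ.tape σ.head) = false → Exec q σ σ' → Exec (ite t p q) σ σ'
  | loop_true {t p σ σ' σ''} : t (σ.tape σ.head) = true → Exec p σ σ' → Exec (loop t p) σ' σ'' →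
      Exec (loop t p) σ σ''
  | loop_false {t p σ} : t (σ.tape σ.head) = false → Exec (loop t p) σ σ

/-- The fragment of a program. -/
def fragment : Prog A → Fragment A
  | op w m a => .single w m a
  | seq p q => p.fragment.seq q.fragment
  | ite t p q => p.fragment.ite t q.fragment
  | loop t p => p.fragment.loop t

theorem act_idle (σ : Store A) : σ.act (σ.tape σ.head) .stay none = σ := by
  cases σ
  simp [Store.act, HeadMove.toInt]

/-- Induction on the derivation of a terminating run. The subfragments embed with their exits
redirected, and the body of a loop exits to the test state, so that the last premise of `loop_true`
is exactly the rest of the run. -/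
theorem Exec.runs {p : Prog A} {σ σ' : Store A} (h : Exec p σ σ') : p.fragment.Runs σ σ' := by
  induction h with
  | op w m a σ => exact Fragment.Reaches.single (F := .single w m a) () σ
  | @seq p q σ σ' σ'' _ _ ih₁ ih₂ =>
    exact (Fragment.Reaches.embed (G := p.fragment.seq q.fragment) Sum.inl
        (some (Sum.inr q.fragment.entry)) (fun _ _ => rfl) ih₁).trans
      (Fragment.Reaches.embed (G := p.fragment.seq q.fragment) Sum.inr none (fun _ _ => rfl) ih₂)
  | @ite_true t p q σ σ' ht _ ih =>
    have h₁ := Fragment.Reaches.single (F := p.fragment.ite t q.fragment) (Sum.inl ()) σ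
    have h₂ := Fragment.Reaches.embed (G := p.fragment.ite t q.fragment)
      (fun r => Sum.inr (Sum.inl r)) none (fun _ _ => rfl) ih
    simp only [Fragment.next, Fragment.ite, ht, if_true, act_idle] at h₁
    exact Relation.ReflTransGen.trans h₁ h₂
  | @ite_false t p q σ σ' ht _ ih =>
    have h₁ := Fragment.Reaches.single (F := p.fragment.ite t q.fragment) (Sum.inl ()) σ
    have h₂ := Fragment.Reaches.embed (G := p.fragment.ite t q.fragment)
      (fun r => Sum.inr (Sum.inr r)) none (fun _ _ => rfl) ih
    simp only [Fragment.next, Fragment.ite, ht, if_false, act_idle, Bool.false_eq_true] at h₁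
    exact Relation.ReflTransGen.trans h₁ h₂
  | @loop_true t p σ σ' σ'' ht _ _ ih₁ ih₂ =>
    have h₁ := Fragment.Reaches.single (F := p.fragment.loop t) (Sum.inl ()) σ
    have h₂ := Fragment.Reaches.embed (G := p.fragment.loop t) Sum.inr
      (some (Sum.inl ())) (fun _ _ => rfl) ih₁
    simp only [Fragment.next, Fragment.loop, ht, if_true, act_idle] at h₁
    exact (Relation.ReflTransGen.trans h₁ h₂).trans ih₂
  | @loop_false t p σ ht =>
    have h₁ := Fragment.Reaches.single (F := p.fragment.loop t) (Sum.inl ()) σ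
    simp only [Fragment.next, Fragment.loop, ht, if_false, act_idle, Bool.false_eq_true] at h₁
    exact h₁

end Prog

/-! ### Turing machines from fragments -/

namespace Fragment

/-- The classical Turing machine of a fragment; it ignores the actions. -/
def toClassicalTM {A : Type} (F : Fragment A) : ClassicalTM where
  Q := Option F.Q
  start := some F.entry
  halt := none
  start_ne_halt := by simp
  δ q s := match q with
    | none => (s, .stay, none)
    | some q => ((F.δ q s).2.1, (F.δ q s).2.2.1, (F.δ q s).2.2.2)

theorem Reaches.classical {A : Type} {F : Fragment A} {c c' : Option F.Q × Store A}
    (h : F.Reaches c c') :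
    ∃ t : ℕ, F.toClassicalTM.step^[t] ⟨c.1, c.2.tape, c.2.head⟩ = ⟨c'.1, c'.2.tape, c'.2.head⟩ := by
  induction h with
  | refl => exact ⟨0, rfl⟩
  | @tail b c' _ hs ih =>
    obtain ⟨t, ht⟩ := ih
    obtain ⟨q, hq, rfl⟩ := hs
    refine ⟨t + 1, ?_⟩
    rw [Function.iterate_succ_apply', ht, hq]
    rfl

theorem Runs.outputs_classical {A : Type} {F : Fragment A} {x y : BitString} {σ : Store A}
    (h : F.Runs ⟨tapeOf (x.map some), 0, []⟩ σ) (hy : ReadsFrom σ.tape 1 y) :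
    F.toClassicalTM.Outputs x y := by
  obtain ⟨t, ht⟩ := Reaches.classical h
  have ht' : F.toClassicalTM.step^[t] (F.toClassicalTM.init x) = ⟨none, σ.tape, σ.head⟩ := ht
  refine ⟨t, ?_, ?_⟩
  · rw [ht']; rfl
  · rw [ht']; exact hy

end Fragment

/-- The quantum tape and the position of the quantum head after a sequence of gates and moves. -/
noncomputable def quantumRun (l : List (QGate × HeadMove)) (c : QTape × ℤ) : QTape × ℤ :=
  l.foldl (fun c a => (c.1.conj c.2 a.1.mat, c.2 + a.2.toInt)) c

theorem setCell_decide_mem (i : ℤ) (a : TapeBasis) : setCell i (decide (i ∈ a)) a = a := by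
  unfold setCell
  by_cases h : i ∈ a <;> simp [h]

theorem setCells_getCells (i : ℤ) (a : TapeBasis) : setCells i (getCells i a) a = a := by
  simp [setCells, getCells, setCell_decide_mem]

/-- A transition of a dcq-TM always names a gate; a step without an action names `ident`, and has to
leave the tape unchanged. -/
theorem QTape.conj_ident (τ : QTape) (i : ℤ) : τ.conj i QGate.ident.mat = τ := by
  funext a b
  simp [QTape.conj, QGate.mat, Matrix.one_apply, setCells_getCells]

namespace Fragment

/-- The dcq-TM of a fragment whose actions are quantum gates and head moves. -/
def toDcqTM (F : Fragment (QGate × HeadMove)) : DcqTM where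
  Q := Option F.Q
  start := some F.entry
  halt := none
  start_ne_halt := by simp
  δ q s := match q with
    | none => (.ident, .stay, s, .stay, none)
    | some q => (((F.δ q s).1.getD (.ident, .stay)).1, ((F.δ q s).1.getD (.ident, .stay)).2,
        (F.δ q s).2.1, (F.δ q s).2.2.1, (F.δ q s).2.2.2)

/-- The control does not read the qubits, so the quantum part of a configuration is the emitted
trace replayed on `q₀`. -/
theorem Reaches.dcq {F : Fragment (QGate × HeadMove)} {c c' : Option F.Q × Store (QGate × HeadMove)}
    (h : F.Reaches c c') (q₀ : QTape × ℤ) :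
    ∃ t : ℕ, F.toDcqTM.step^[t] ⟨c.1, c.2.tape, c.2.head, (quantumRun c.2.trace q₀).1,
        (quantumRun c.2.trace q₀).2⟩ =
      ⟨c'.1, c'.2.tape, c'.2.head, (quantumRun c'.2.trace q₀).1, (quantumRun c'.2.trace q₀).2⟩ := by
  induction h with
  | refl => exact ⟨0, rfl⟩
  | @tail b c' _ hs ih =>
    obtain ⟨t, ht⟩ := ih
    obtain ⟨q, hq, rfl⟩ := hs
    refine ⟨t + 1, ?_⟩
    rw [Function.iterate_succ_apply', ht, hq]
    simp only [DcqTM.step, toDcqTM, next, Store.act]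
    rcases h : (F.δ q (b.2.tape b.2.head)).1 with _ | a
    · simp [QTape.conj_ident, HeadMove.toInt]
    · simp [quantumRun]

theorem Runs.outputs_dcq {F : Fragment (QGate × HeadMove)} {x : BitString} {n : ℕ} {ρ : QState n}
    {y s : BitString} {σ : Store (QGate × HeadMove)}
    (h : F.Runs ⟨tapeOf (x.map some ++ none :: (natToStr n).map some), 0, []⟩ σ)
    (hy : ReadsFrom σ.tape 1 y) (hs : ReadsFrom σ.tape (1 + y.length + 1) s) :
    F.toDcqTM.Outputs x ρ y (strToNat s)
      ((quantumRun σ.trace (QTape.ofState ρ, 0)).1.reduced (strToNat s)) := by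
  obtain ⟨t, ht⟩ := Reaches.dcq h (QTape.ofState ρ, 0)
  have ht' : F.toDcqTM.step^[t] (F.toDcqTM.init x ρ) =
    ⟨none, σ.tape, σ.head, (quantumRun σ.trace (QTape.ofState ρ, 0)).1,
      (quantumRun σ.trace (QTape.ofState ρ, 0)).2⟩ := ht
  refine ⟨t, ?_, ?_, ⟨s, ?_, rfl⟩, ?_⟩
  · rw [ht']; rfl
  · rw [ht']; exact hy
  · rw [ht']; exact hs
  · rw [ht']

end Fragment


/-! ## Register programs -/

namespace Prog

variable {A : Type}

def moveBy (d : HeadMove) : ℕ → Prog A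
  | 0 => op id .stay none
  | n + 1 => seq (op id d none) (moveBy d n)

def write (s : TapeSymbol) : Prog A := op (fun _ => s) .stay none

/-- Move by steps of width `n` until the head is on a blank. -/
def walk (d : HeadMove) (n : ℕ) : Prog A := loop Option.isSome (moveBy d n)

theorem exec_moveBy (d : HeadMove) (n : ℕ) (T : ℤ → TapeSymbol) (h h' : ℤ) (tr : List A)
    (hh : h' = h + n * d.toInt) : Exec (moveBy d n) ⟨T, h, tr⟩ ⟨T, h', tr⟩ := by
  induction n generalizing h with
  | zero =>
    have := Exec.op id .stay none (⟨T, h, tr⟩ : Store A)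
    simpa [moveBy, Store.act, HeadMove.toInt, hh] using this
  | succ n ih =>
    refine .seq (σ' := ⟨T, h + d.toInt, tr⟩) ?_ (ih _ (by rw [hh]; push_cast; ring))
    have := Exec.op id d none (⟨T, h, tr⟩ : Store A)
    simpa [Store.act] using this

theorem exec_write (s : TapeSymbol) (T : ℤ → TapeSymbol) (h : ℤ) (tr : List A) :
    Exec (write s) ⟨T, h, tr⟩ ⟨Function.update T h s, h, tr⟩ := by
  have := Exec.op (fun _ => s) .stay none (⟨T, h, tr⟩ : Store A)
  simpa [write, Store.act, HeadMove.toInt] using this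

theorem exec_walk (d : HeadMove) (n : ℕ) (T : ℤ → TapeSymbol) (h h' : ℤ) (tr : List A) (j : ℕ)
    (hh : h' = h + j * (n * d.toInt)) (h₁ : ∀ i < j, (T (h + i * (n * d.toInt))).isSome = true)
    (h₂ : T h' = none) : Exec (walk d n) ⟨T, h, tr⟩ ⟨T, h', tr⟩ := by
  induction j generalizing h with
  | zero =>
    obtain rfl : h' = h := by simpa using hh
    exact .loop_false (by simp [h₂])
  | succ j ih =>
    refine .loop_true (σ' := ⟨T, h + n * d.toInt, tr⟩) (by simpa using h₁ 0 (by omega))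
      (exec_moveBy _ _ _ _ _ _ rfl) (ih _ (by rw [hh]; push_cast; ring) ?_)
    intro i hi
    have := h₁ (i + 1) (by omega)
    rwa [show h + ((i + 1 : ℕ) : ℤ) * (n * d.toInt) = h + n * d.toInt + i * (n * d.toInt) by
      push_cast; ring] at this

end Prog

/-! ### Register memories on a tape -/

/-- The memory of a register program: the registers, two strings, and the emitted actions. -/
structure Mem (A : Type) : Type where
  reg : ℕ → ℕ
  fst : BitString
  snd : BitString
  trace : List A

namespace Mem

variable {A : Type}

def setReg (m : Mem A) (i v : ℕ) : Mem A := { m with reg := Function.update m.reg i v }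

@[simp] theorem setReg_self (m : Mem A) (i v : ℕ) : (m.setReg i v).reg i = v := by simp [setReg]

theorem setReg_of_ne (m : Mem A) {i j : ℕ} (v : ℕ) (h : j ≠ i) :
    (m.setReg i v).reg j = m.reg j := by simp [setReg, h]

@[simp] theorem setReg_trace (m : Mem A) (i v : ℕ) : (m.setReg i v).trace = m.trace := rfl

/-- The symbols on the right half of the tape. -/
def right (m : Mem A) : List TapeSymbol := m.fst.map some ++ none :: m.snd.map some

/-- The tape that represents a memory with registers `0, …, K - 1`.  The strings are on the right
half; the register `i` is written in unary in the cells `-(1 + i + K * q)` with `1 ≤ q`. -/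
def layout (K : ℕ) (m : Mem A) : ℤ → TapeSymbol := fun z =>
  if 0 < z then tapeOf m.right z else
    if 1 ≤ (-z - 1).toNat / K ∧ (-z - 1).toNat / K ≤ m.reg ((-z - 1).toNat % K) then some true
    else none

def store (K : ℕ) (m : Mem A) : Store A := ⟨m.layout K, 0, m.trace⟩

theorem tapeOf_succ (l : List TapeSymbol) (i : ℕ) (z : ℤ) (hz : z = 1 + i) :
    tapeOf l z = (l[i]?).getD none := by
  subst hz
  simp [tapeOf]

theorem layout_pos (K : ℕ) (m : Mem A) (i : ℕ) (z : ℤ) (hz : z = 1 + i) :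
    m.layout K z = (m.right[i]?).getD none := by
  rw [layout, if_pos (by omega), tapeOf_succ _ i z hz]

theorem layout_zero (K : ℕ) (m : Mem A) : m.layout K 0 = none := by
  simp [layout]

theorem layout_reg {K : ℕ} (m : Mem A) {i : ℕ} (hi : i < K) (q : ℕ) (z : ℤ)
    (hz : z = -(1 + i + K * q)) :
    m.layout K z = if 1 ≤ q ∧ q ≤ m.reg i then some true else none := by
  have e : (-z - 1).toNat = i + K * q := by
    have : -z - 1 = ((i + K * q : ℕ) : ℤ) := by rw [hz]; push_cast; ring
    rw [this, Int.toNat_natCast]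
  have h0 : ¬ 0 < z := by
    have : (0 : ℤ) ≤ K * q := by positivity
    omega
  rw [layout, if_neg h0, e, Nat.add_mul_div_left _ _ (by omega), Nat.div_eq_of_lt hi,
    Nat.add_mul_mod_self_left, Nat.mod_eq_of_lt hi, Nat.zero_add]

/-- A unary counter changes by one when the cell at its boundary is rewritten. By `hv`, the old and
the new value agree on all other positions; this covers increments, where `q` is the new value, and
decrements, where `q` is the old one. -/
theorem update_layout_reg {K : ℕ} (m : Mem A) {i : ℕ} (hi : i < K) (q v : ℕ) (s : TapeSymbol)
    (z : ℤ) (hz : z = -(1 + i + K * q)) (hs : s = if 1 ≤ q ∧ q ≤ v then some true else none)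
    (hv : ∀ q', q' ≠ q → 1 ≤ q' → (q' ≤ v ↔ q' ≤ m.reg i)) :
    Function.update (m.layout K) z s = (m.setReg i v).layout K := by
  funext w
  by_cases hw : w = z
  · rw [hw, Function.update_self, layout_reg _ hi q z hz, hs]
    simp
  rw [Function.update_of_ne hw]
  by_cases h0 : 0 < w
  · simp only [layout, if_pos h0]
    rfl
  simp only [layout, if_neg h0]
  by_cases hk : (-w - 1).toNat % K = i
  · simp only [hk, setReg_self]
    refine if_congr (and_congr_right fun h1 => (hv _ ?_ h1).symm) rfl rfl
    intro hq
    apply hw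
    have := Nat.mod_add_div (-w - 1).toNat K
    rw [hk, hq] at this
    have h2 : 1 ≤ (-w - 1).toNat := h1.trans (Nat.div_le_self _ _)
    zify at this
    rw [hz]
    omega
  · simp only [m.setReg_of_ne v hk]

end Mem

/-! ### Commands and their tape programs -/

/-- Commands on registers, strings and actions. -/
inductive Cmd (A : Type) : Type
  | inc (i : ℕ)
  | dec (i : ℕ)
  | seq (c d : Cmd A)
  | loop (i : ℕ) (c : Cmd A)
  | pushFst (b : Bool)
  | pushSnd (b : Bool)
  | pop (i : ℕ)
  | act (a : A)

namespace Cmd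

variable {A : Type}

/-- Big-step semantics.  `pop i` removes the last symbol of the first string and adds `1` or `2` to
the register `i` if this symbol was `0` or `1`. -/
inductive Runs : Cmd A → Mem A → Mem A → Prop
  | inc (i) (m : Mem A) : Runs (inc i) m (m.setReg i (m.reg i + 1))
  | dec (i v) (m : Mem A) : m.reg i = v + 1 → Runs (dec i) m (m.setReg i v)
  | seq {c d m m' m''} : Runs c m m' → Runs d m' m'' → Runs (seq c d) m m''
  | loop_pos {i c m m' m''} : m.reg i ≠ 0 → Runs c m m' → Runs (loop i c) m' m'' →
      Runs (loop i c) m m''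
  | loop_zero {i c m} : m.reg i = 0 → Runs (loop i c) m m
  | pushFst (b) (m : Mem A) : m.snd = [] → Runs (pushFst b) m { m with fst := m.fst ++ [b] }
  | pushSnd (b) (m : Mem A) : m.fst = [] → Runs (pushSnd b) m { m with snd := m.snd ++ [b] }
  | pop_nil (i) (m : Mem A) : m.snd = [] → m.fst = [] → Runs (pop i) m m
  | pop_false (i) (l) (m : Mem A) : m.snd = [] → m.fst = l ++ [false] →
      Runs (pop i) m ({ m with fst := l }.setReg i (m.reg i + 1))
  | pop_true (i) (l) (m : Mem A) : m.snd = [] → m.fst = l ++ [true] →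
      Runs (pop i) m ({ m with fst := l }.setReg i (m.reg i + 2))
  | act (a) (m : Mem A) : Runs (act a) m { m with trace := m.trace ++ [a] }

/-- All registers of the command are below this bound. -/
def bound : Cmd A → ℕ
  | inc i => i + 1
  | dec i => i + 1
  | seq c d => max c.bound d.bound
  | loop i c => max (i + 1) c.bound
  | pop i => i + 1
  | _ => 0

def incProg (K i : ℕ) : Prog A :=
  .seq (.moveBy .left (1 + i + K)) (.seq (.walk .left K) (.seq (.write (some true))
    (.seq (.walk .right K) (.moveBy .right (1 + i)))))

def decProg (K i : ℕ) : Prog A :=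
  .seq (.moveBy .left (1 + i + K)) (.seq (.walk .left K) (.seq (.moveBy .right K)
    (.seq (.write none) (.seq (.moveBy .right K) (.seq (.walk .right K) (.moveBy .right (1 + i)))))))

/-- Erase the last symbol of the first string, and return to the cell `0`. -/
def eraseProg : Prog A := .seq (.op (fun _ => none) .left none) (.walk .left 1)

/-- The tape program of a command, for machines with `K` registers. -/
def prog (K : ℕ) : Cmd A → Prog A
  | inc i => incProg K i
  | dec i => decProg K i
  | seq c d => .seq (c.prog K) (d.prog K)
  | loop i c => .seq (.moveBy .left (1 + i + K)) (.seq (.loop Option.isSome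
      (.seq (.moveBy .right (1 + i + K)) (.seq (c.prog K) (.moveBy .left (1 + i + K)))))
      (.moveBy .right (1 + i + K)))
  | pushFst b => .seq (.moveBy .right 1) (.seq (.walk .right 1) (.seq (.write (some b))
      (.walk .left 1)))
  | pushSnd b => .seq (.moveBy .right 2) (.seq (.walk .right 1) (.seq (.write (some b))
      (.seq (.walk .left 1) (.moveBy .left 1))))
  | pop i => .seq (.moveBy .right 1) (.seq (.walk .right 1) (.seq (.moveBy .left 1)
      (.ite (fun s => s = some true) (.seq eraseProg (.seq (incProg K i) (incProg K i)))
        (.ite (fun s => s = some false) (.seq eraseProg (incProg K i)) (.moveBy .stay 0)))))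
  | act a => .op id .stay (some a)

open Prog in
theorem exec_incProg {K i : ℕ} (hi : i < K) (m : Mem A) :
    Exec (incProg K i) (m.store K) ((m.setReg i (m.reg i + 1)).store K) := by
  have hT := m.update_layout_reg hi (m.reg i + 1) (m.reg i + 1) (some true)
    (-(1 + i + K * (m.reg i + 1 : ℕ))) (by push_cast; ring) (by simp) (fun q' h _ => by omega)
  rw [Mem.store, Mem.store, Mem.setReg_trace, ← hT]
  -- The position `q = 0` of each register is always blank. It stops the walk back at the cell `-(1
  -- + i)`, from where a move of fixed length leads to the cell `0`.
  refine .seq (exec_moveBy _ _ _ _ (-(1 + i + K * (1 : ℕ))) _ ?_) (.seq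
    (exec_walk _ _ _ _ (-(1 + i + K * (m.reg i + 1 : ℕ))) _ (m.reg i) ?_ ?_ ?_)
    (.seq (exec_write _ _ _ _) (.seq (exec_walk _ _ _ _ (-(1 + i)) _ (m.reg i + 1) ?_ ?_ ?_)
      (exec_moveBy _ _ _ _ _ _ ?_))))
  · simp [HeadMove.toInt]; try ring
  · simp [HeadMove.toInt]; ring
  · intro j hj
    rw [m.layout_reg hi (j + 1) _ (by simp [HeadMove.toInt]; ring), if_pos (by omega)]
    rfl
  · rw [m.layout_reg hi _ _ rfl, if_neg (by omega)]
  · simp [HeadMove.toInt]; ring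
  · intro j hj
    rw [hT, Mem.layout_reg _ hi (m.reg i + 1 - j) _ ?_, if_pos ?_]
    · rfl
    · simp; omega
    · rw [Nat.cast_sub (by omega)]; simp [HeadMove.toInt]; ring
  · rw [hT, Mem.layout_reg _ hi 0 _ (by simp), if_neg (by omega)]
  · simp [HeadMove.toInt]

open Prog in
theorem exec_decProg {K i v : ℕ} (hi : i < K) (m : Mem A) (hv : m.reg i = v + 1) :
    Exec (decProg K i) (m.store K) ((m.setReg i v).store K) := by
  have hT := m.update_layout_reg hi (v + 1) v none
    (-(1 + i + K * (v + 1 : ℕ))) (by push_cast; ring) (by simp) (fun q' h _ => by omega)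
  rw [Mem.store, Mem.store, Mem.setReg_trace, ← hT]
  -- The walk ends on the blank behind the last mark, hence the move back by `K` before the erasure.
  -- The second walk starts at the position `v`, and is empty if `v = 0`.
  refine .seq (exec_moveBy _ _ _ _ (-(1 + i + K * (1 : ℕ))) _ ?_) (.seq
    (exec_walk _ _ _ _ (-(1 + i + K * (m.reg i + 1 : ℕ))) _ (m.reg i) ?_ ?_ ?_)
    (.seq (exec_moveBy _ _ _ _ (-(1 + i + K * (v + 1 : ℕ))) _ ?_)
    (.seq (exec_write _ _ _ _) (.seq (exec_moveBy _ _ _ _ (-(1 + i + K * v)) _ ?_)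
    (.seq (exec_walk _ _ _ _ (-(1 + i)) _ v ?_ ?_ ?_)
      (exec_moveBy _ _ _ _ _ _ ?_))))))
  · simp [HeadMove.toInt]; try ring
  · simp [HeadMove.toInt]; ring
  · intro j hj
    rw [m.layout_reg hi (j + 1) _ (by simp [HeadMove.toInt]; ring), if_pos (by omega)]
    rfl
  · rw [m.layout_reg hi _ _ rfl, if_neg (by omega)]
  · simp [HeadMove.toInt, hv]; try ring
  · simp [HeadMove.toInt]; try ring
  · simp [HeadMove.toInt]; ring
  · intro j hj
    rw [hT, Mem.layout_reg _ hi (v - j) _ ?_, if_pos ?_]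
    · rfl
    · simp; omega
    · rw [Nat.cast_sub (by omega)]; simp [HeadMove.toInt]; ring
  · rw [hT, Mem.layout_reg _ hi 0 _ (by simp), if_neg (by omega)]
  · simp [HeadMove.toInt]

theorem update_layout_right {K : ℕ} (m m' : Mem A) (i : ℕ) (s : TapeSymbol) (z : ℤ)
    (hz : z = 1 + i) (hr : m'.reg = m.reg)
    (h : ∀ j : ℕ, (m'.right[j]?).getD none = if j = i then s else (m.right[j]?).getD none) :
    Function.update (m.layout K) z s = m'.layout K := by
  funext w
  by_cases h0 : 0 < w
  · have hw : w = 1 + ((w - 1).toNat : ℤ) := by omega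
    rw [Mem.layout_pos K m' _ w hw, h]
    split_ifs with hj
    · rw [show w = z by omega, Function.update_self]
    · rw [Function.update_of_ne (by omega), Mem.layout_pos K m _ w hw]
  · rw [Function.update_of_ne (by omega)]
    simp only [Mem.layout, if_neg h0, hr]

/-- With an empty second string, the separator cannot be told from the blanks beyond it, so the
first string can grow and shrink at its end without any shift. This is why `pushFst` and `pop`
require `snd = []`. -/
theorem right_of_snd {m : Mem A} (h : m.snd = []) (j : ℕ) :
    (m.right[j]?).getD none = m.fst[j]? := by
  rw [Mem.right, h, List.getElem?_append]
  split_ifs with hj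
  · simp at hj
    simp [hj]
  · simp at hj
    simp only [List.map_nil]
    rw [List.getElem?_eq_none hj]
    rcases hk : j - (List.map some m.fst).length with _ | k <;> simp

theorem right_of_fst {m : Mem A} (h : m.fst = []) (j : ℕ) :
    (m.right[j + 1]?).getD none = m.snd[j]? := by
  rw [Mem.right, h]
  by_cases hj : j < m.snd.length
  · simp [hj]
  · simp [hj]

open Prog in
theorem exec_pushFst {K : ℕ} (b : Bool) (m : Mem A) (h : m.snd = []) :
    Exec (prog K (.pushFst b)) (m.store K)
      (Mem.store K { m with fst := m.fst ++ [b] }) := by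
  have hT := update_layout_right (K := K) m { m with fst := m.fst ++ [b] } m.fst.length (some b)
    (1 + m.fst.length) rfl rfl (by
      intro j
      rw [right_of_snd (by exact h), right_of_snd h, List.getElem?_append]
      split_ifs with h1 h2 h2
      · omega
      · rfl
      · simp [h2]
      · rw [List.getElem?_eq_none (by simp; omega), List.getElem?_eq_none (by omega)])
  rw [Mem.store, Mem.store, ← hT]
  refine .seq (exec_moveBy _ _ _ _ 1 _ ?_) (.seq
    (exec_walk _ _ _ _ (1 + m.fst.length) _ m.fst.length ?_ ?_ ?_)
    (.seq (exec_write _ _ _ _) (exec_walk _ _ _ _ _ _ (m.fst.length + 1) ?_ ?_ ?_)))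
  · simp [HeadMove.toInt]
  · simp [HeadMove.toInt]
  · intro j hj
    rw [m.layout_pos K j _ (by simp [HeadMove.toInt]), right_of_snd h, List.getElem?_eq_getElem hj]
    rfl
  · rw [m.layout_pos K _ _ rfl, right_of_snd h]
    simp
  · simp [HeadMove.toInt]; try ring
  · intro j hj
    rw [hT, Mem.layout_pos _ _ (m.fst.length - j) _ ?_, right_of_snd (by exact h),
      List.getElem?_eq_getElem (by simp)]
    · rfl
    · simp [HeadMove.toInt]; try omega
  · rw [hT, Mem.layout_zero]

open Prog in
theorem exec_pushSnd {K : ℕ} (b : Bool) (m : Mem A) (h : m.fst = []) :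
    Exec (prog K (.pushSnd b)) (m.store K)
      (Mem.store K { m with snd := m.snd ++ [b] }) := by
  have h0 : ∀ s : BitString, (Mem.right ({ m with snd := s } : Mem A))[0]?.getD none = none := by
    simp [Mem.right, h]
  have hT := update_layout_right (K := K) m { m with snd := m.snd ++ [b] } (m.snd.length + 1)
    (some b) (1 + (m.snd.length + 1 : ℕ)) rfl rfl (by
      rintro (_ | j)
      · rw [h0, if_neg (by omega)]
        exact (h0 m.snd).symm
      rw [right_of_fst (by exact h), right_of_fst h, List.getElem?_append]
      split_ifs with h1 h2 h2
      · omega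
      · rfl
      · simp [show j = m.snd.length by omega]
      · rw [List.getElem?_eq_none (by simp; omega), List.getElem?_eq_none (by omega)])
  rw [Mem.store, Mem.store, ← hT]
  refine .seq (exec_moveBy _ _ _ _ 2 _ ?_) (.seq
    (exec_walk _ _ _ _ (1 + (m.snd.length + 1 : ℕ)) _ m.snd.length ?_ ?_ ?_)
    (.seq (exec_write _ _ _ _) (.seq (exec_walk _ _ _ _ 1 _ (m.snd.length + 1) ?_ ?_ ?_)
      (exec_moveBy _ _ _ _ _ _ ?_))))
  · simp [HeadMove.toInt]
  · simp [HeadMove.toInt]; try ring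
  · intro j hj
    rw [m.layout_pos K (j + 1) _ (by simp [HeadMove.toInt]; ring), right_of_fst h,
      List.getElem?_eq_getElem hj]
    rfl
  · rw [m.layout_pos K _ _ rfl, right_of_fst h]
    simp
  · simp [HeadMove.toInt]; ring
  · intro j hj
    rw [hT, Mem.layout_pos _ _ (m.snd.length - j + 1) _ ?_, right_of_fst (by exact h),
      List.getElem?_eq_getElem (by simp)]
    · rfl
    · simp [HeadMove.toInt]; omega
  · rw [hT, Mem.layout_pos _ _ 0 _ (by simp)]
    exact h0 _
  · simp [HeadMove.toInt]

open Prog in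
theorem exec_eraseProg {K : ℕ} (b : Bool) (l : BitString) (m : Mem A) (h : m.snd = [])
    (hl : m.fst = l ++ [b]) :
    Exec eraseProg ⟨m.layout K, 1 + l.length, m.trace⟩ (Mem.store K { m with fst := l }) := by
  have hT := update_layout_right (K := K) m { m with fst := l } l.length none
    (1 + l.length) rfl rfl (by
      intro j
      rw [right_of_snd (by exact h), right_of_snd h, hl]
      simp only
      rcases lt_trichotomy j l.length with h1 | h1 | h1
      · rw [if_neg h1.ne, List.getElem?_append_left h1]
      · simp [h1]
      · rw [if_neg h1.ne', List.getElem?_eq_none h1.le, List.getElem?_eq_none (by simp; omega)])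
  rw [Mem.store, ← hT]
  have h₁ := Exec.op (fun _ => none) .left none (⟨m.layout K, 1 + l.length, m.trace⟩ : Store A)
  simp only [Store.act, HeadMove.toInt, Option.toList_none, List.append_nil] at h₁
  refine .seq h₁ (exec_walk _ _ _ _ _ _ l.length ?_ ?_ ?_)
  · simp [HeadMove.toInt]
  · intro j hj
    rw [hT, Mem.layout_pos _ _ (l.length - 1 - j) _ ?_, right_of_snd (by exact h),
      List.getElem?_eq_getElem (by simp; omega)]
    · rfl
    · simp [HeadMove.toInt]; omega
  · rw [hT, Mem.layout_zero]

open Prog in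
theorem exec_pop_start {K : ℕ} (m : Mem A) (h : m.snd = []) (p : Prog A) (σ : Store A)
    (hp : Exec p ⟨m.layout K, m.fst.length, m.trace⟩ σ) :
    Exec (.seq (.moveBy .right 1) (.seq (.walk .right 1) (.seq (.moveBy .left 1) p)))
      (m.store K) σ := by
  refine .seq (exec_moveBy _ _ _ _ 1 _ ?_) (.seq
    (exec_walk _ _ _ _ (1 + m.fst.length) _ m.fst.length ?_ ?_ ?_)
    (.seq (exec_moveBy _ _ _ _ _ _ ?_) hp))
  · simp [HeadMove.toInt]
  · simp [HeadMove.toInt]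
  · intro j hj
    rw [m.layout_pos K j _ (by simp [HeadMove.toInt]), right_of_snd h, List.getElem?_eq_getElem hj]
    rfl
  · rw [m.layout_pos K _ _ rfl, right_of_snd h]
    simp
  · simp [HeadMove.toInt]

theorem layout_last {K : ℕ} (b : Bool) (l : BitString) (m : Mem A) (h : m.snd = [])
    (hl : m.fst = l ++ [b]) : m.layout K (m.fst.length : ℤ) = some b := by
  rw [Mem.layout_pos _ _ l.length _ (by simp [hl]; ring), right_of_snd h, hl]
  simp

open Prog in
theorem Runs.exec {c : Cmd A} {m m' : Mem A} (h : Runs c m m') {K : ℕ} (hK : c.bound ≤ K) :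
    Exec (c.prog K) (m.store K) (m'.store K) := by
  induction h with
  | inc i m => exact exec_incProg hK m
  | dec i v m hv => exact exec_decProg hK m hv
  | seq _ _ ih₁ ih₂ =>
    simp only [bound, max_le_iff] at hK
    exact .seq (ih₁ hK.1) (ih₂ hK.2)
  | @loop_pos i c m m' m'' hi _ _ ih₁ ih₂ =>
    have hK' := hK
    simp only [bound, max_le_iff] at hK'
    -- The remaining rounds form a run of the whole command, which begins by approaching the
    -- register. Taking this run apart exposes the bare tape loop; its approach becomes the end of
    -- the round that is prepended.
    cases ih₂ hK with
    | @seq _ _ _ σ _ h₁ h₂ =>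
    cases h₂ with
    | @seq _ _ _ σ' _ h₂ h₃ =>
    refine .seq (exec_moveBy _ _ _ _ (-(1 + i + K * (1 : ℕ))) _ ?_) (.seq
      (.loop_true ?_ (.seq (exec_moveBy _ _ _ _ 0 _ ?_) (.seq (ih₁ hK'.2) h₁)) h₂) h₃)
    · simp [HeadMove.toInt]; try ring
    · simp only
      rw [m.layout_reg hK'.1 _ _ rfl, if_pos (by omega)]
      rfl
    · simp [HeadMove.toInt]; try ring
  | @loop_zero i c m hi =>
    simp only [bound, max_le_iff] at hK
    refine .seq (exec_moveBy _ _ _ _ (-(1 + i + K * (1 : ℕ))) _ ?_) (.seq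
      (.loop_false ?_) (exec_moveBy _ _ _ _ _ _ ?_))
    · simp [HeadMove.toInt]; try ring
    · simp only
      rw [m.layout_reg hK.1 _ _ rfl, if_neg (by omega)]
      rfl
    · simp [HeadMove.toInt]; try ring
  | pushFst b m h => exact exec_pushFst b m h
  | pushSnd b m h => exact exec_pushSnd b m h
  | pop_nil i m h hl =>
    refine exec_pop_start m h _ _ (.ite_false ?_ (.ite_false ?_ (exec_moveBy _ _ _ _ _ _ ?_)))
    · simp [hl, Mem.layout_zero]
    · simp [hl, Mem.layout_zero]
    · simp [hl]
  | pop_false i l m h hl =>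
    refine exec_pop_start m h _ _ (.ite_false ?_ (.ite_true ?_ (.seq ?_ (exec_incProg hK _))))
    · simp [layout_last _ l m h hl]
    · simp [layout_last _ l m h hl]
    · have := exec_eraseProg (K := K) _ l m h hl
      rwa [show (1 + (l.length : ℤ)) = m.fst.length by simp [hl]; ring] at this
  | pop_true i l m h hl =>
    have e : ({ m with fst := l } : Mem A).setReg i (m.reg i + 2) =
      (({ m with fst := l } : Mem A).setReg i (m.reg i + 1)).setReg i (m.reg i + 2) := by
      simp [Mem.setReg]
    rw [e]
    refine exec_pop_start m h _ _ (.ite_true ?_ (.seq ?_ (.seq (exec_incProg hK { m with fst := l }) ?_)))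
    · simp [layout_last _ l m h hl]
    · have := exec_eraseProg (K := K) _ l m h hl
      rwa [show (1 + (l.length : ℤ)) = m.fst.length by simp [hl]; ring] at this
    · have := exec_incProg (K := K) hK (({ m with fst := l } : Mem A).setReg i (m.reg i + 1))
      simpa using this
  | act a m =>
    have := Exec.op id .stay (some a) (m.store K)
    simp only [Store.act, id, Function.update_eq_self, HeadMove.toInt, add_zero] at this
    exact this

end Cmd


/-! ## Register programs for primitive recursive functions -/

namespace Mem

variable {A : Type}

def withReg (m : Mem A) (f : ℕ → ℕ) : Mem A := { m with reg := f }

theorem withReg_congr (m : Mem A) {f g : ℕ → ℕ} (h : ∀ r, f r = g r) :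
    m.withReg f = m.withReg g := by rw [funext h]

@[simp] theorem withReg_reg (m : Mem A) (f : ℕ → ℕ) : (m.withReg f).reg = f := rfl

@[simp] theorem withReg_self (m : Mem A) : m.withReg m.reg = m := rfl

@[simp] theorem withReg_withReg (m : Mem A) (f g : ℕ → ℕ) :
    (m.withReg f).withReg g = m.withReg g := rfl

theorem eq_withReg (m : Mem A) {f : ℕ → ℕ} (h : ∀ r, m.reg r = f r) : m = m.withReg f := by
  rw [← funext h]; rfl

theorem setReg_eq (m : Mem A) (i v : ℕ) :
    m.setReg i v = m.withReg (Function.update m.reg i v) := rfl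

end Mem

namespace Cmd

variable {A : Type}

theorem Runs.congr {c : Cmd A} {m m' m'' : Mem A} (h : Runs c m m') (e : m' = m'') :
    Runs c m m'' := e ▸ h

/-- A loop that counts down a register. -/
theorem Runs.countdown {i : ℕ} {c : Cmd A} (N : ℕ) (S : ℕ → Mem A) (h : ∀ k ≤ N, (S k).reg i = k)
    (hc : ∀ k < N, Runs c (S (k + 1)) (S k)) {m m' : Mem A} (hm : m = S N) (hm' : S 0 = m') :
    Runs (loop i c) m m' := by
  subst hm hm'
  induction N with
  | zero => exact .loop_zero (h 0 le_rfl)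
  | succ N ih =>
    exact .loop_pos (by rw [h _ le_rfl]; omega) (hc N (by omega))
      (ih (fun k hk => h k (by omega)) (fun k hk => hc k (by omega)))

def skip : Cmd A := .seq (.inc 0) (.dec 0)

theorem runs_skip (m : Mem A) : Runs skip m m := by
  refine .seq (.inc 0 m) ((Runs.dec 0 (m.reg 0) _ (by simp)).congr ?_)
  simp [Mem.setReg_eq]

def clear (i : ℕ) : Cmd A := .loop i (.dec i)

theorem runs_clear (i : ℕ) (m : Mem A) : Runs (clear i) m (m.setReg i 0) := by
  exact Runs.countdown (m.reg i) (fun k => m.setReg i k) (by simp)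
    (fun k _ => (Runs.dec i k _ (by simp)).congr (by simp [Mem.setReg_eq]))
    (by simp [Mem.setReg_eq]) rfl

/-- Add the register `i` to the register `j`, and clear the former. -/
def transfer (i j : ℕ) : Cmd A := .loop i (.seq (.dec i) (.inc j))

theorem runs_transfer {i j : ℕ} (hij : i ≠ j) (m : Mem A) :
    Runs (transfer i j) m ((m.setReg i 0).setReg j (m.reg j + m.reg i)) := by
  refine Runs.countdown (m.reg i)
    (fun k => m.withReg fun r =>
      if r = i then k else if r = j then m.reg j + m.reg i - k else m.reg r) (by simp)
    (fun k hk => .seq (.dec i k _ (by simp)) ((Runs.inc j _).congr (by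
      simp only [Mem.setReg_eq, Mem.withReg_reg, Mem.withReg_withReg]
      refine m.withReg_congr fun r => ?_
      simp only [Function.update_apply]
      split_ifs <;> omega)))
    (m.eq_withReg fun r => by split_ifs <;> simp_all) ?_
  simp only [Mem.setReg_eq, Mem.withReg_withReg]
  refine m.withReg_congr fun r => ?_
  simp only [Function.update_apply, Mem.withReg_reg]
  split_ifs <;> omega

/-- Copy the register `i` to the empty register `j`, using the empty register `t`. -/
def copy (i j t : ℕ) : Cmd A :=
  .seq (.loop i (.seq (.dec i) (.seq (.inc j) (.inc t)))) (transfer t i)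

theorem runs_copy {i j t : ℕ} (hij : i ≠ j) (hit : i ≠ t) (hjt : j ≠ t) (m : Mem A)
    (hj : m.reg j = 0) (ht : m.reg t = 0) : Runs (copy i j t) m (m.setReg j (m.reg i)) := by
  have : Runs (.loop i (.seq (.dec i) (.seq (.inc j) (.inc t)))) m (m.withReg fun r =>
      if r = i then 0 else if r = j then m.reg i else if r = t then m.reg i else m.reg r) := by
    refine Runs.countdown (m.reg i) (fun k => m.withReg fun r =>
      if r = i then k else if r = j then m.reg i - k else if r = t then m.reg i - k else m.reg r)
      (by simp)
      (fun k hk => .seq (.dec i k _ (by simp)) (.seq (.inc j _) ((Runs.inc t _).congr ?_)))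
      (m.eq_withReg fun r => by split_ifs <;> simp_all) (m.withReg_congr fun r => by simp)
    simp only [Mem.setReg_eq, Mem.withReg_reg, Mem.withReg_withReg]
    refine m.withReg_congr fun r => ?_
    simp only [Function.update_apply]
    split_ifs <;> omega
  refine .seq this ((runs_transfer hit.symm _).congr ?_)
  simp only [Mem.setReg_eq, Mem.withReg_withReg]
  refine m.withReg_congr fun r => ?_
  simp only [Function.update_apply, Mem.withReg_reg]
  split_ifs <;> first | omega | simp_all

/-- The value of `f` at the registers `inp` can be computed into the register `out` by a program that
uses the empty registers from `b` on. -/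
def Computes (A : Type) {n : ℕ} (f : List.Vector ℕ n → ℕ) : Prop :=
  ∀ (inp : Fin n → ℕ) (out b : ℕ), (∀ i, inp i < b) → out < b →
    ∃ c : Cmd A, ∀ m : Mem A, (∀ r, b ≤ r → m.reg r = 0) →
      Runs c m (m.setReg out (f (List.Vector.ofFn fun i => m.reg (inp i))))

/-- It is enough to compute the value into the register `b`. -/
theorem Computes.of_fresh {n : ℕ} {f : List.Vector ℕ n → ℕ}
    (h : ∀ (inp : Fin n → ℕ) (b : ℕ), (∀ i, inp i < b) →
      ∃ c : Cmd A, ∀ m : Mem A, (∀ r, b ≤ r → m.reg r = 0) →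
        Runs c m (m.setReg b (f (List.Vector.ofFn fun i => m.reg (inp i))))) : Computes A f := by
  intro inp out b hi ho
  obtain ⟨c, hc⟩ := h inp b hi
  refine ⟨.seq c (.seq (clear out) (transfer b out)), fun m hm => ?_⟩
  refine .seq (hc m hm) (.seq (runs_clear out _) ((runs_transfer (by omega) _).congr ?_))
  simp only [Mem.setReg_eq, Mem.withReg_withReg]
  refine m.withReg_congr fun r => ?_
  have := hm b le_rfl
  simp only [Function.update_apply, Mem.withReg_reg]
  split_ifs <;> first | omega | simp_all

/-- Compute several functions into the registers from `b` on. -/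
theorem Computes.sequence {k n : ℕ} (g : Fin n → List.Vector ℕ k → ℕ) (hg : ∀ i, Computes A (g i))
    (inp : Fin k → ℕ) (b : ℕ) (hi : ∀ i, inp i < b) (j : ℕ) (hj : j ≤ n) :
    ∃ c : Cmd A, ∀ m : Mem A, (∀ r, b ≤ r → m.reg r = 0) →
      Runs c m (m.withReg fun r => if h : b ≤ r ∧ r < b + j then
        g ⟨r - b, by omega⟩ (List.Vector.ofFn fun i => m.reg (inp i)) else m.reg r) := by
  induction j with
  | zero =>
    refine ⟨skip, fun m _ => (runs_skip m).congr ?_⟩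
    rw [← m.withReg_self]
    exact m.withReg_congr fun r => by rw [dif_neg (by omega)]; rfl
  | succ j ih =>
    obtain ⟨c, hc⟩ := ih (by omega)
    obtain ⟨d, hd⟩ := hg ⟨j, by omega⟩ inp (b + j) (b + j + 1)
      (fun i => by have := hi i; omega) (by omega)
    refine ⟨.seq c d, fun m hm => .seq (hc m hm) ((hd _ ?_).congr ?_)⟩
    · intro r hr
      rw [Mem.withReg_reg, dif_neg (by omega), hm r (by omega)]
    · simp only [Mem.setReg_eq, Mem.withReg_withReg, Mem.withReg_reg]
      refine m.withReg_congr fun r => ?_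
      simp only [Function.update_apply]
      have e : ∀ i, (if h : b ≤ inp i ∧ inp i < b + j then
          g ⟨inp i - b, by omega⟩ (List.Vector.ofFn fun i => m.reg (inp i)) else m.reg (inp i)) =
          m.reg (inp i) := fun i => by have := hi i; rw [dif_neg (by omega)]
      simp only [e]
      by_cases h1 : r = b + j
      · subst h1
        rw [if_pos rfl, dif_pos (by omega)]
        simp
      · rw [if_neg h1]
        by_cases h2 : b ≤ r ∧ r < b + j
        · rw [dif_pos h2, dif_pos (by omega)]
        · rw [dif_neg h2, dif_neg (by omega)]

theorem runs_clear_range (b j : ℕ) : ∃ c : Cmd A, ∀ m : Mem A,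
    Runs c m (m.withReg fun r => if b ≤ r ∧ r < b + j then 0 else m.reg r) := by
  induction j with
  | zero =>
    refine ⟨skip, fun m => (runs_skip m).congr ?_⟩
    rw [← m.withReg_self]
    exact m.withReg_congr fun r => by rw [if_neg (by omega)]; rfl
  | succ j ih =>
    obtain ⟨c, hc⟩ := ih
    refine ⟨.seq c (clear (b + j)), fun m => .seq (hc m) ((runs_clear _ _).congr ?_)⟩
    simp only [Mem.setReg_eq, Mem.withReg_withReg, Mem.withReg_reg]
    refine m.withReg_congr fun r => ?_
    simp only [Function.update_apply]
    split_ifs <;> omega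

/-- Composition computes the inner values side by side in fresh registers and wipes them; primitive
recursion counts down a copy of its argument. Every program restores all registers but the output,
which is what allows the programs to be combined. -/
theorem computes_of_primrec' {n : ℕ} {f : List.Vector ℕ n → ℕ} (hf : Nat.Primrec' f) :
    Computes A f := by
  induction hf with
  | zero => exact fun inp out b _ _ => ⟨clear out, fun m _ => runs_clear out m⟩
  | succ =>
    refine .of_fresh fun inp b hi => ⟨.seq (copy (inp 0) b (b + 1)) (.inc b), fun m hm => ?_⟩
    have := hi 0
    refine .seq (runs_copy (by omega) (by omega) (by omega) m (hm _ (by omega)) (hm _ (by omega)))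
      ((Runs.inc b _).congr ?_)
    simp [Mem.setReg_eq, List.Vector.head_ofFn]
  | get i =>
    refine .of_fresh fun inp b hi => ⟨copy (inp i) b (b + 1), fun m hm => ?_⟩
    have := hi i
    refine (runs_copy (by omega) (by omega) (by omega) m (hm _ (by omega))
      (hm _ (by omega))).congr ?_
    simp
  | @comp k n f g _ _ ihf ihg =>
    refine .of_fresh fun inp b hi => ?_
    obtain ⟨c₁, h₁⟩ := Computes.sequence g ihg inp (b + 1) (fun i => (hi i).trans (by omega)) n le_rfl
    obtain ⟨c₂, h₂⟩ := ihf (fun i => b + 1 + i) b (b + 1 + n) (fun i => by omega) (by omega)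
    obtain ⟨c₃, h₃⟩ := runs_clear_range (A := A) (b + 1) n
    refine ⟨.seq c₁ (.seq c₂ c₃), fun m hm => .seq (h₁ m fun r hr => hm r (by omega))
      (.seq (h₂ _ ?_) ((h₃ _).congr ?_))⟩
    · intro r hr
      rw [Mem.withReg_reg, dif_neg (by omega), hm r (by omega)]
    · simp only [Mem.setReg_eq, Mem.withReg_withReg, Mem.withReg_reg]
      refine m.withReg_congr fun r => ?_
      simp only [Function.update_apply]
      by_cases h1 : b + 1 ≤ r ∧ r < b + 1 + n
      · rw [if_pos h1, if_neg (by omega), hm r (by omega)]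
      · rw [if_neg h1]
        by_cases h2 : r = b
        · rw [if_pos h2, if_pos h2]
          congr 2
          funext i
          rw [dif_pos (by omega)]
          simp
        · rw [if_neg h2, if_neg h2, dif_neg h1]
  | @prec n f g _ _ ihf ihg =>
    refine .of_fresh fun inp b hi => ?_
    obtain ⟨c₁, h₁⟩ := ihf (fun i => inp i.succ) b (b + 3) (fun i => (hi _).trans (by omega))
      (by omega)
    obtain ⟨c₂, h₂⟩ := ihg (Fin.cons (b + 2) (Fin.cons b fun i => inp i.succ)) b (b + 3)
      (by
        intro i
        refine Fin.cases (by simp) (fun i => Fin.cases (by simp) (fun i => ?_) i) i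
        simpa using (hi _).trans (by omega)) (by omega)
    have h0 := hi 0
    refine ⟨.seq c₁ (.seq (copy (inp 0) (b + 1) (b + 2)) (.seq
      (.loop (b + 1) (.seq c₂ (.seq (.inc (b + 2)) (.dec (b + 1))))) (clear (b + 2)))),
      fun m hm => ?_⟩
    set v := List.Vector.ofFn fun i : Fin n => m.reg (inp i.succ) with hv
    set F : ℕ → ℕ := fun k => k.rec (f v) fun y IH => g (y ::ᵥ IH ::ᵥ v) with hF
    set N := m.reg (inp 0) with hN
    -- With `k` rounds to go, `b` holds the value at `N - k`, `b + 1` holds `k`, and `b + 2` holds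
    -- the index `N - k` that the next application of `g` needs.
    refine .seq (h₁ m fun r hr => hm r (by omega)) (.seq
        (runs_copy (by omega) (by omega) (by omega) _ ?_ ?_) (.seq (Runs.countdown N
      (fun k => m.withReg fun r => if r = b + 1 then k else if r = b then F (N - k)
        else if r = b + 2 then N - k else m.reg r) (by simp)
      (fun k hk => .seq (h₂ _ ?_) (.seq (.inc _ _) ((Runs.dec (b + 1) k _ ?_).congr ?_)))
      ?_ rfl) ((runs_clear _ _).congr ?_)))
    · rw [Mem.setReg_of_ne _ _ (by omega), hm _ (by omega)]
    · rw [Mem.setReg_of_ne _ _ (by omega), hm _ (by omega)]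
    · intro r hr
      simp only [Mem.withReg_reg]
      rw [if_neg (by omega), if_neg (by omega), if_neg (by omega), hm r (by omega)]
    · simp [Mem.setReg_eq]
    · simp only [Mem.setReg_eq, Mem.withReg_withReg, Mem.withReg_reg]
      refine m.withReg_congr fun r => ?_
      have e : N - k = N - (k + 1) + 1 := by omega
      have e' : F (N - k) = g ((N - (k + 1)) ::ᵥ F (N - (k + 1)) ::ᵥ v) := by rw [e]
      simp only [Function.update_apply]
      by_cases h1 : r = b + 1
      · simp [h1]
      by_cases h2 : r = b + 2
      · simp [h2]; omega
      by_cases h3 : r = b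
      · subst h3
        simp only [if_neg h1, if_neg h2, if_true, e']
        congr 1
        apply List.Vector.ext
        intro i
        refine Fin.cases (by simp) (fun i => Fin.cases (by simp; rfl) (fun i => ?_) i) i
        have := hi i.succ
        simp only [List.Vector.get_ofFn, Fin.cons_succ, List.Vector.get_cons_succ, hv]
        rw [if_neg (by omega), if_neg (by omega), if_neg (by omega)]
      · simp only [if_neg h1, if_neg h2, if_neg h3]
    · simp only [Mem.setReg_eq, Mem.withReg_withReg, Mem.withReg_reg]
      refine m.withReg_congr fun r => ?_
      simp only [Function.update_apply]
      have := hm (b + 2) (by omega)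
      split_ifs <;> first | omega | simp_all
    · simp only [Mem.setReg_eq, Mem.withReg_withReg, Mem.withReg_reg]
      refine m.withReg_congr fun r => ?_
      simp only [Function.update_apply]
      have := hm (b + 2) (by omega)
      have := hm (b + 1) (by omega)
      have e : (List.Vector.ofFn fun i => m.reg (inp i)) = N ::ᵥ v := rfl
      rw [e]
      split_ifs <;> first | omega | simp_all

end Cmd


/-! ## Search programs -/

/-- The gates, numbered. -/
def QGate.equivFin : QGate ≃ Fin 6 where
  toFun
    | ident => 0
    | hadamard => 1
    | phase => 2
    | piEighth => 3
    | swap => 4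
    | cnot => 5
  invFun := ![ident, hadamard, phase, piEighth, swap, cnot]
  left_inv g := by cases g <;> rfl
  right_inv i := by fin_cases i <;> rfl

/-- The head moves, numbered. -/
def HeadMove.equivFin : HeadMove ≃ Fin 3 where
  toFun
    | left => 0
    | stay => 1
    | right => 2
  invFun := ![left, stay, right]
  left_inv g := by cases g <;> rfl
  right_inv i := by fin_cases i <;> rfl

instance : DecidableEq QGate := QGate.equivFin.decidableEq
instance : Fintype QGate := .ofEquiv _ QGate.equivFin.symm
instance : Primcodable QGate := .ofEquiv _ QGate.equivFin
instance : DecidableEq HeadMove := HeadMove.equivFin.decidableEq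
instance : Fintype HeadMove := .ofEquiv _ HeadMove.equivFin.symm
instance : Primcodable HeadMove := .ofEquiv _ HeadMove.equivFin

/-- The number with the digits `code a + 1`, for `a` in `l`, in the bijective numeration of base
`B`. -/
def digitsCode {α : Type} (B : ℕ) (code : α → ℕ) (l : List α) : ℕ :=
  l.foldr (fun a e => B * e + 1 + code a) 0

theorem primrec_digitsCode {α : Type} [Primcodable α] (B : ℕ) {code : α → ℕ} (h : Primrec code) :
    Primrec (digitsCode B code) :=
  Primrec.list_foldr (f := fun l => l) (g := fun _ => 0) (h := fun _ p => B * p.2 + 1 + code p.1)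
    .id (.const 0)
    (Primrec.nat_add.comp (Primrec.nat_add.comp (Primrec.nat_mul.comp (.const B)
      (Primrec.snd.comp .snd)) (.const 1)) (h.comp (Primrec.fst.comp .snd)))

/-- The code of a string as a number. -/
def strCode (x : BitString) : ℕ := digitsCode 2 Bool.toNat x

/-- The digits are `1` and `2`, so zeros at the end of a string are not lost, as they would be in
ordinary binary notation. -/
theorem strCode_injective : Function.Injective strCode := by
  intro x y h
  induction x generalizing y with
  | nil =>
    cases y with
    | nil => rfl
    | cons b y =>
      simp only [strCode, digitsCode, List.foldr_nil, List.foldr_cons] at h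
      omega
  | cons a x ih =>
    cases y with
    | nil => simp [strCode, digitsCode] at h
    | cons b y =>
      have h' : 2 * strCode x + 1 + a.toNat = 2 * strCode y + 1 + b.toNat := h
      have := a.toNat_le
      have := b.toNat_le
      have e : strCode x = strCode y := by omega
      rw [ih e]
      congr 1
      have : a.toNat = b.toNat := by omega
      cases a <;> cases b <;> simp_all

namespace Cmd

variable {A : Type}

theorem exists_assign₁ {f : ℕ → ℕ} (hf : Primrec f) {i out b : ℕ} (hi : i < b) (ho : out < b) :
    ∃ c : Cmd A, ∀ m : Mem A, (∀ r, b ≤ r → m.reg r = 0) →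
      Runs c m (m.setReg out (f (m.reg i))) := by
  obtain ⟨c, hc⟩ := computes_of_primrec' (A := A) (Nat.Primrec'.prim_iff₁.2 hf) (fun _ => i) out b
    (fun _ => hi) ho
  exact ⟨c, fun m hm => hc m hm⟩

theorem exists_assign₂ {f : ℕ → ℕ → ℕ} (hf : Primrec₂ f) {i j out b : ℕ} (hi : i < b) (hj : j < b)
    (ho : out < b) : ∃ c : Cmd A, ∀ m : Mem A, (∀ r, b ≤ r → m.reg r = 0) →
      Runs c m (m.setReg out (f (m.reg i) (m.reg j))) := by
  obtain ⟨c, hc⟩ := computes_of_primrec' (A := A) (Nat.Primrec'.prim_iff₂.2 hf) ![i, j] out b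
    (by simp [Fin.forall_fin_two, hi, hj]) ho
  exact ⟨c, fun m hm => hc m hm⟩

/-- Read the first string into the register `0`. -/
theorem exists_input : ∃ c : Cmd A, ∀ m : Mem A, m.snd = [] → m.reg 1 = 0 →
    (∀ r, 8 ≤ r → m.reg r = 0) →
      Runs c m ({ m with fst := [] }.setReg 0
        (m.fst.foldr (fun (b : Bool) e => 2 * e + 1 + b.toNat) (m.reg 0))) := by
  obtain ⟨c, hc⟩ := exists_assign₂ (A := A) (f := fun a b => 2 * a + b) (i := 0) (j := 1) (out := 0)
    (b := 8) (Primrec.nat_add.comp (Primrec.nat_mul.comp (.const 2) .fst) .snd)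
    (by norm_num) (by norm_num) (by norm_num)
  -- The symbols come off the end, so the most significant digit is first and Horner's rule applies.
  -- As `pop` adds `1` or `2`, the register `1` stays `0` exactly when the string is exhausted.
  refine ⟨.seq (.pop 1) (.loop 1 (.seq c (.seq (clear 1) (.pop 1)))), ?_⟩
  intro m
  obtain ⟨f, l, s, tr⟩ := m
  induction l using List.reverseRecOn generalizing f with
  | nil =>
    intro hs h1 _
    refine (Runs.seq (.pop_nil 1 _ hs rfl) (.loop_zero h1)).congr ?_
    simp [Mem.setReg_eq, Mem.withReg]
  | append_singleton l b ih =>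
    intro hs h1 h8
    simp only at hs h1 h8
    subst hs
    have ih := ih (Function.update f 0 (2 * f 0 + (1 + b.toNat))) rfl (by simpa using h1)
      (by intro r hr; simpa [show r ≠ 0 by omega] using h8 r hr)
    cases ih with
    | @seq _ _ _ m₁ _ hp hl =>
    have hpop : Runs (.pop 1 : Cmd A) ⟨f, l ++ [b], [], tr⟩
        ((⟨f, l, [], tr⟩ : Mem A).setReg 1 (1 + b.toNat)) := by
      cases b
      · exact (Runs.pop_false 1 l _ rfl rfl).congr (by simp [h1])
      · exact (Runs.pop_true 1 l _ rfl rfl).congr (by simp [h1])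
    refine .seq hpop (.loop_pos (m' := m₁) (by simp) (.seq (hc _ ?_) (.seq (runs_clear _ _) ?_)) ?_)

    · intro r hr
      rw [Mem.setReg_of_ne _ _ (by omega)]
      exact h8 r hr
    · convert hp using 1
      simp only [Mem.setReg_eq, Mem.withReg, Mem.mk.injEq, and_self, and_true]
      funext r
      by_cases hr : r = 1
      · simp [hr, h1]
      · simp [Function.update_apply, hr]
    · convert hl using 1
      simp [Mem.setReg_eq, Mem.withReg, List.foldr_append, add_assoc]

/-- Increase the register `1` until a primitive recursive test of the registers `0` and `1` is
passed. -/
theorem exists_search {f : ℕ → ℕ → ℕ} (hf : Primrec₂ f) : ∃ c : Cmd A, ∀ m : Mem A,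
    (∀ r, 8 ≤ r → m.reg r = 0) → m.reg 1 = 0 → m.reg 2 = 0 → (∃ n, f (m.reg 0) n = 0) →
      ∃ n, f (m.reg 0) n = 0 ∧ Runs c m (m.setReg 1 n) := by
  obtain ⟨c, hc⟩ := exists_assign₂ (A := A) hf (i := 0) (j := 1) (out := 2) (b := 8)
    (by norm_num) (by norm_num) (by norm_num)
  refine ⟨.seq c (.loop 2 (.seq (.inc 1) c)), fun m h8 h1 h2 hn => ?_⟩
  classical
  refine ⟨Nat.find hn, Nat.find_spec hn, ?_⟩
  -- Induction on the distance `k` to the least zero. The register `2` ends with the value `0` that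
  -- it had at the beginning, so only the register `1` changes.
  suffices h : ∀ j k, j + k = Nat.find hn →
      Runs (.loop 2 (.seq (.inc 1) c)) ((m.setReg 1 j).setReg 2 (f (m.reg 0) j))
        (m.setReg 1 (Nat.find hn)) by
    refine .seq ((hc m h8).congr ?_) (h 0 _ (Nat.zero_add _))
    have e : m.setReg 1 0 = m := by
      calc m.setReg 1 0 = m.setReg 1 (m.reg 1) := by rw [h1]
        _ = m := by simp [Mem.setReg_eq]
    rw [e, h1]
  intro j k hk
  induction k generalizing j with
  | zero =>
    have e : f (m.reg 0) j = 0 := by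
      have := Nat.find_spec hn
      rwa [← hk] at this
    refine (Runs.loop_zero (by simp [e])).congr ?_
    rw [← hk, e]
    simp only [Mem.setReg_eq, Mem.withReg_withReg]
    refine m.withReg_congr fun r => ?_
    simp only [Function.update_apply, Mem.withReg_reg]
    split_ifs <;> simp_all
  | succ k ih =>
    have e : f (m.reg 0) j ≠ 0 := Nat.find_min hn (by omega)
    refine .loop_pos (by simpa using e) (.seq (.inc 1 _) (hc _ ?_)) ?_
    · intro r hr
      simp only [Mem.setReg_eq, Mem.withReg_reg, Function.update_apply]
      rw [if_neg (by omega), if_neg (by omega), if_neg (by omega), h8 r hr]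
    · convert ih (j + 1) (by omega) using 1
      simp only [Mem.setReg_eq, Mem.withReg_withReg]
      refine m.withReg_congr fun r => ?_
      simp only [Function.update_apply, Mem.withReg_reg]
      split_ifs <;> simp_all

noncomputable def finCode {α : Type} [Fintype α] (a : α) : ℕ := Fintype.equivFin α a

theorem finCode_injective {α : Type} [Fintype α] : Function.Injective (finCode (α := α)) :=
  Fin.val_injective.comp (Fintype.equivFin α).injective

theorem finCode_lt {α : Type} [Fintype α] (a : α) : finCode a < Fintype.card α :=
  (Fintype.equivFin α a).2

/-- Emit the item whose code is in the register `6`, if it is in the list. -/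
theorem exists_dispatch {α S : Type} [Fintype α] [DecidableEq α] (W : S → (ℕ → ℕ) → Mem A)
    (upd : S → α → S)
    (hW : ∀ l f, (W l f).reg = f)
    (hW' : ∀ l f i v, (W l f).setReg i v = W l (Function.update f i v)) (cmd : α → Cmd A)
    (hcmd : ∀ l f a, Runs (cmd a) (W l f) (W (upd l a) f)) (as : List α) (has : as.Nodup) :
    ∃ c : Cmd A, ∀ l f a, f 6 = finCode a → f 7 = 0 → (∀ r, 8 ≤ r → f r = 0) →
      Runs c (W l f) (W (if a ∈ as then upd l a else l) f) := by
  induction as with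
  | nil => exact ⟨skip, fun l f a _ _ _ => (runs_skip _).congr (by simp)⟩
  | cons a' as ih =>
    rw [List.nodup_cons] at has
    obtain ⟨c, hc⟩ := ih has.2
    obtain ⟨d, hd⟩ := exists_assign₁ (A := A) (f := fun n => if n = finCode a' then 1 else 0) (i := 6)
      (out := 7) (b := 8) (Primrec.ite (Primrec.eq.comp .id (.const _)) (.const 1) (.const 0))
      (by norm_num) (by norm_num)
    -- The register `7` holds a truth value, so the loop on it is a conditional. The memory `W l f`
    -- has the registers `f` and the accumulated output `l`, which treats both strings and the trace
    -- in a uniform way.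
    refine ⟨.seq d (.seq (.loop 7 (.seq (.dec 7) (cmd a'))) c), fun l f a h6 h7 h8 => ?_⟩
    refine .seq (hd _ (by simpa [hW] using h8)) ?_
    rw [hW, hW', h6]
    have e : Function.update f 7 0 = f := by rw [← h7]; simp
    by_cases h : a = a'
    · subst h
      rw [if_pos rfl, if_pos (by simp)]
      refine .seq (.loop_pos (by simp [hW]) (.seq (.dec 7 0 _ (by simp [hW])) (?_))
        (.loop_zero (m := W (upd l a) f) (by rw [hW, h7]))) ?_
      · rw [hW', Function.update_idem, e]
        exact hcmd _ _ _
      · have := hc (upd l a) f a h6 h7 h8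
        rwa [if_neg has.1] at this
    · rw [if_neg (fun h' => h (finCode_injective h')), e]
      refine .seq (.loop_zero (by rw [hW, h7])) ?_
      have := hc l f a h6 h7 h8
      simpa [h] using this

/-- Emit the items whose code is in the register `r`. -/
theorem exists_emit {α S : Type} [Fintype α] [DecidableEq α] (W : S → (ℕ → ℕ) → Mem A)
    (upd : S → α → S)
    (hW : ∀ l f, (W l f).reg = f)
    (hW' : ∀ l f i v, (W l f).setReg i v = W l (Function.update f i v)) (cmd : α → Cmd A)
    (hcmd : ∀ l f a, Runs (cmd a) (W l f) (W (upd l a) f)) (r : ℕ) (hr : r < 6) :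
    ∃ c : Cmd A, ∀ l₀ l f, f 6 = 0 → f 7 = 0 →
    (∀ r, 8 ≤ r → f r = 0) → f r = digitsCode (Fintype.card α) finCode l →
      Runs c (W l₀ f) (W (l.foldl upd l₀) (Function.update f r 0)) := by
  obtain ⟨c, hc⟩ := exists_dispatch W upd hW hW' cmd hcmd Finset.univ.toList (Finset.nodup_toList _)
  set B := Fintype.card α with hB
  -- Remainder and quotient of `n - 1` strip the lowest digit in bijective numeration; only the
  -- empty list has the code `0`, which ends the loop.
  obtain ⟨d₁, hd₁⟩ := exists_assign₁ (A := A) (f := fun n => (n - 1) % B) (i := r)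
    (out := 6) (b := 8) (Primrec.nat_mod.comp (Primrec.nat_sub.comp .id (.const 1)) (.const B))
    (by omega) (by norm_num)
  obtain ⟨d₂, hd₂⟩ := exists_assign₁ (A := A) (f := fun n => (n - 1) / B) (i := r)
    (out := r) (b := 8) (Primrec.nat_div.comp (Primrec.nat_sub.comp .id (.const 1)) (.const B))
    (by omega) (by omega)
  refine ⟨.loop r (.seq d₁ (.seq d₂ (.seq c (clear 6)))), fun l₀ l f h6 h7 h8 hl => ?_⟩
  induction l generalizing l₀ f with
  | nil =>
    have h0 : f r = 0 := hl
    refine (Runs.loop_zero (by rw [hW, h0])).congr ?_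
    rw [List.foldl_nil, ← h0]
    simp
  | cons a l ih =>
    have hl' : f r = B * digitsCode B finCode l + 1 + finCode a := hl
    have ha := finCode_lt a
    rw [← hB] at ha
    have e₁ : (f r - 1) % B = finCode a := by
      rw [hl', show B * digitsCode B finCode l + 1 + finCode a - 1 =
        finCode a + B * digitsCode B finCode l by omega, Nat.add_mul_mod_self_left,
        Nat.mod_eq_of_lt ha]
    have e₂ : (f r - 1) / B = digitsCode B finCode l := by
      rw [hl', show B * digitsCode B finCode l + 1 + finCode a - 1 =
        finCode a + B * digitsCode B finCode l by omega, Nat.add_mul_div_left _ _ (by omega),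
        Nat.div_eq_of_lt ha, Nat.zero_add]
    have h₁ := hd₁ (W l₀ f) (by simpa [hW] using h8)
    rw [hW, hW', e₁] at h₁
    have h₂ := hd₂ (W l₀ (Function.update f 6 (finCode a))) (by
      intro s hs; rw [hW, Function.update_of_ne (by omega), h8 s hs])
    rw [hW, hW', Function.update_of_ne (by omega), e₂] at h₂
    have h₃ := hc l₀ (Function.update (Function.update f 6 (finCode a)) r (digitsCode B finCode l)) a
      (by rw [Function.update_of_ne (by omega), Function.update_self])
      (by rw [Function.update_of_ne (by omega), Function.update_of_ne (by omega), h7])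
      (by intro s hs; rw [Function.update_of_ne (by omega), Function.update_of_ne (by omega), h8 s hs])
    rw [if_pos (by simp)] at h₃
    refine .loop_pos (by rw [hW, hl']; omega) (.seq h₁ (.seq h₂ (.seq h₃ (runs_clear _ _)))) ?_
    rw [hW']
    have := ih (upd l₀ a) (Function.update f r (digitsCode B finCode l))
      (by rw [Function.update_of_ne (by omega), h6])
      (by rw [Function.update_of_ne (by omega), h7])
      (by intro s hs; rw [Function.update_of_ne (by omega), h8 s hs]) (by simp)
    rw [Function.update_idem] at this
    convert this using 2
    · funext s
      simp only [Function.update_apply]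
      split_ifs <;> first | omega | simp_all
    · rfl

end Cmd


/-! ## Machines that search -/

theorem tapeOf_of_nonpos (l : List TapeSymbol) {z : ℤ} (hz : ¬ 0 < z) : tapeOf l z = none := by
  rw [tapeOf, if_neg (by omega)]

theorem Mem.layout_init {A : Type} (K : ℕ) (x s : BitString) (tr : List A) :
    (⟨fun _ => 0, x, s, tr⟩ : Mem A).layout K = tapeOf (x.map some ++ none :: s.map some) := by
  funext z
  by_cases hz : 0 < z
  · rw [Mem.layout, if_pos hz]
    rfl
  · rw [Mem.layout, if_neg hz, tapeOf_of_nonpos _ hz, if_neg (by simp only; omega)]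

theorem tapeOf_append_none (l : List TapeSymbol) : tapeOf (l ++ [none]) = tapeOf l := by
  funext z
  by_cases hz : 0 < z
  · obtain ⟨i, rfl⟩ : ∃ i : ℕ, z = 1 + i := ⟨(z - 1).toNat, by omega⟩
    rw [Mem.tapeOf_succ _ i _ rfl, Mem.tapeOf_succ _ i _ rfl]
    rcases lt_trichotomy i l.length with h | h | h
    · rw [List.getElem?_append_left h]
    · simp [h]
    · rw [List.getElem?_eq_none h.le, List.getElem?_eq_none (by simp; omega)]
  · rw [tapeOf_of_nonpos _ hz, tapeOf_of_nonpos _ hz]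

theorem Mem.readsFrom_fst {A : Type} (K : ℕ) (m : Mem A) : ReadsFrom (m.layout K) 1 m.fst := by
  refine ⟨fun i => ?_, ?_⟩
  · rw [Mem.layout_pos _ _ i _ rfl, Mem.right, List.getElem?_append_left (by simp)]
    simp
  · rw [Mem.layout_pos _ _ _ _ rfl, Mem.right]
    simp

theorem Mem.readsFrom_snd {A : Type} (K : ℕ) (m : Mem A) :
    ReadsFrom (m.layout K) (1 + m.fst.length + 1) m.snd := by
  refine ⟨fun i => ?_, ?_⟩
  · rw [Mem.layout_pos _ _ (m.fst.length + (i + 1)) _ (by push_cast; ring), Mem.right,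
      List.getElem?_append_right (by simp)]
    simp
  · rw [Mem.layout_pos _ _ (m.fst.length + (m.snd.length + 1)) _ (by push_cast; ring), Mem.right,
      List.getElem?_append_right (by simp)]
    simp

theorem foldl_concat {α : Type} (l l' : List α) :
    l'.foldl (fun l a => l ++ [a]) l = l ++ l' := by
  induction l' generalizing l with
  | nil => simp
  | cons a l' ih => simp [ih]

theorem foldl_concat_fst {α β : Type} (l l' : List α) (b : β) :
    l'.foldl (fun (p : List α × β) a => (p.1 ++ [a], p.2)) (l, b) = (l ++ l', b) := by
  induction l' generalizing l with
  | nil => simp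
  | cons a l' ih => simp [ih]

namespace Cmd

variable {A γ : Type} [Primcodable γ]

/-- Test whether the number `n` is the code of a pair of the string with code `e` and of a related
item. -/
theorem exists_test {R : BitString → γ → Prop} (hR : PrimrecRel R) :
    ∃ f : ℕ → ℕ → ℕ, Primrec₂ f ∧ ∀ x n, f (strCode x) n = 0 ↔
      ∃ c, R x c ∧ (Encodable.decode n : Option (BitString × γ)) = some (x, c) := by
  classical
  -- The witness carries its own copy of the input string, which is compared by its code; so strings
  -- never have to be recovered from `strCode`. Numbers that decode to nothing get the value `1`
  -- below and fail the test.
  let g : ℕ × ℕ → BitString × γ → Option ℕ :=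
    fun p q => if strCode q.1 = p.1 ∧ R q.1 q.2 then some 0 else none
  have hg : Primrec₂ g :=
    Primrec.ite (PrimrecPred.and
      (Primrec.eq.comp ((primrec_digitsCode 2 (Primrec.dom_finite _)).comp
        (Primrec.fst.comp .snd)) (Primrec.fst.comp .fst))
      (hR.comp (Primrec.fst.comp .snd) (Primrec.snd.comp .snd))) (.const _) (.const _)
  refine ⟨fun e n => (((Encodable.decode n : Option (BitString × γ)).bind (g (e, n))).getD 1),
    Primrec.option_getD.comp (Primrec.option_bind (Primrec.decode.comp .snd)
      (hg.comp .fst .snd)) (.const 1), fun x n => ?_⟩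
  change ((Encodable.decode n : Option (BitString × γ)).bind (g (strCode x, n))).getD 1 = 0 ↔ _
  rcases h : (Encodable.decode n : Option (BitString × γ)) with _ | ⟨y, c⟩
  · simp
  · by_cases hy : strCode y = strCode x ∧ R y c
    · obtain rfl := strCode_injective hy.1
      simp [g, hy]
    · simp only [Option.bind_some, g, if_neg hy, Option.getD_none, one_ne_zero, Option.some.injEq,
        Prod.mk.injEq, false_iff, not_exists, not_and]
      rintro c' hc' rfl rfl
      exact hy ⟨rfl, hc'⟩

/-- Find an item related to the input. -/
theorem exists_find {R : BitString → γ → Prop} (hR : PrimrecRel R) :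
    ∃ d : Cmd A, ∀ x, (∃ c, R x c) → ∃ c n, R x c ∧
      (Encodable.decode n : Option (BitString × γ)) = some (x, c) ∧
      Runs d ⟨fun _ => 0, x, [], []⟩
        ⟨fun r => if r = 0 then strCode x else if r = 1 then n else 0, [], [], []⟩ := by
  obtain ⟨f, hf, hf'⟩ := exists_test hR
  obtain ⟨d₁, h₁⟩ := exists_input (A := A)
  obtain ⟨d₂, h₂⟩ := exists_search (A := A) hf
  refine ⟨.seq d₁ d₂, fun x ⟨c, hc⟩ => ?_⟩
  have r₁ := h₁ ⟨fun _ => 0, x, [], []⟩ rfl rfl (fun _ _ => rfl)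
  set m : Mem A := ({ reg := fun _ => 0, fst := [], snd := [], trace := [] } : Mem A).setReg 0
    (strCode x) with hm
  have r₁ : Runs d₁ ⟨fun _ => 0, x, [], []⟩ m := r₁
  have h0 : m.reg 0 = strCode x := by simp [hm]
  obtain ⟨n, hn, r₂⟩ := h₂ m
    (fun r hr => by rw [hm, Mem.setReg_of_ne _ _ (by omega)])
    (by rw [hm, Mem.setReg_of_ne _ _ (by omega)])
    (by rw [hm, Mem.setReg_of_ne _ _ (by omega)])
    ⟨Encodable.encode (x, c), by rw [h0, hf']; exact ⟨c, hc, Encodable.encodek _⟩⟩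
  rw [h0, hf'] at hn
  obtain ⟨c', hc', hn⟩ := hn
  refine ⟨c', n, hc', hn, .seq r₁ (r₂.congr ?_)⟩
  simp only [hm, Mem.setReg_eq, Mem.withReg, Mem.mk.injEq, and_self, and_true]
  funext r
  simp only [Function.update_apply]
  split_ifs <;> omega

/-- Put the code of a function of the item that was found into the register `r`. -/
theorem exists_code {α : Type} [Fintype α] [Primcodable α] {o : γ → List α} (ho : Primrec o) (r : ℕ)
    (hr : r < 8) : ∃ d : Cmd A, ∀ (m : Mem A) (x : BitString) (c : γ),
      (∀ r, 8 ≤ r → m.reg r = 0) →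
      (Encodable.decode (m.reg 1) : Option (BitString × γ)) = some (x, c) →
      Runs d m (m.setReg r (digitsCode (Fintype.card α) finCode (o c))) := by
  obtain ⟨d, hd⟩ := exists_assign₁ (A := A) (i := 1) (out := r) (b := 8)
    (f := fun n => ((Encodable.decode n : Option (BitString × γ)).map fun p =>
      digitsCode (Fintype.card α) finCode (o p.2)).getD 0)
    (Primrec.option_getD.comp (Primrec.option_map Primrec.decode (Primrec.to₂
      ((primrec_digitsCode _ (Primrec.dom_finite _)).comp
        (ho.comp (Primrec.snd.comp .snd))))) (.const 0)) (by norm_num) hr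
  refine ⟨d, fun m x c h8 h => (hd m h8).congr ?_⟩
  simp only [h, Option.map_some, Option.getD_some]

end Cmd

/-- A classical Turing machine that finds an item related to its input, and that outputs a function
of it. -/
theorem ClassicalTM.exists_of_primrec {γ : Type} [Primcodable γ] {R : BitString → γ → Prop}
    (hR : PrimrecRel R) {o : γ → BitString} (ho : Primrec o) :
    ∃ T : ClassicalTM, ∀ x, (∃ c, R x c) → ∃ c, R x c ∧ T.Outputs x (o c) := by
  obtain ⟨d₁, h₁⟩ := Cmd.exists_find (A := Unit) hR
  obtain ⟨d₂, h₂⟩ := Cmd.exists_code (A := Unit) ho 2 (by norm_num)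
  obtain ⟨d₃, h₃⟩ := Cmd.exists_emit (A := Unit) (fun l f => ⟨f, l, [], []⟩)
    (fun l b => l ++ [b]) (fun _ _ => rfl)
    (fun _ _ _ _ => rfl) .pushFst (fun _ _ b => .pushFst b _ rfl) 2 (by norm_num)
  set d : Cmd Unit := .seq d₁ (.seq d₂ d₃) with hd
  refine ⟨(d.prog d.bound).fragment.toClassicalTM, fun x hx => ?_⟩
  obtain ⟨c, n, hc, hn, r₁⟩ := h₁ x hx
  refine ⟨c, hc, ?_⟩
  have r₂ := h₂ ⟨fun r => if r = 0 then strCode x else if r = 1 then n else 0, [], [], []⟩ x c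
    (by intro r hr; simp only; rw [if_neg (by omega), if_neg (by omega)]) hn
  have r₃ := h₃ [] (o c) (Function.update (fun r => if r = 0 then strCode x else if r = 1 then n
    else 0) 2 (digitsCode (Fintype.card Bool) Cmd.finCode (o c))) (by simp) (by simp)
    (by intro r hr; rw [Function.update_of_ne (by omega), if_neg (by omega), if_neg (by omega)])
    (by simp)
  rw [foldl_concat] at r₃
  have r : Cmd.Runs d _ _ := .seq r₁ (.seq r₂ r₃)
  have := (r.exec le_rfl).runs
  simp only [Mem.store, Mem.layout_init, List.map_nil, tapeOf_append_none] at this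
  exact this.outputs_classical (Mem.readsFrom_fst _ _)

/-- A dcq-TM that finds an item related to its input, and that applies a sequence of gates which is a
function of it. -/
theorem DcqTM.exists_of_primrec {γ : Type} [Primcodable γ] {R : BitString → γ → Prop}
    (hR : PrimrecRel R) {g : γ → List (QGate × HeadMove)} (hg : Primrec g) {o : γ → BitString}
    (ho : Primrec o) :
    ∃ T : DcqTM, ∀ x, (∃ c, R x c) → ∃ c, R x c ∧ T.Outputs x QState.empty [] (strToNat (o c))
      ((quantumRun (g c) (QTape.ofState QState.empty, 0)).1.reduced (strToNat (o c))) := by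
  obtain ⟨d₁, h₁⟩ := Cmd.exists_find (A := QGate × HeadMove) hR
  obtain ⟨d₂, h₂⟩ := Cmd.exists_code (A := QGate × HeadMove) hg 2 (by norm_num)
  obtain ⟨d₃, h₃⟩ := Cmd.exists_code (A := QGate × HeadMove) ho 3 (by norm_num)
  obtain ⟨d₄, h₄⟩ := Cmd.exists_emit (A := QGate × HeadMove) (fun l f => ⟨f, [], [], l⟩)
    (fun l b => l ++ [b])
    (fun _ _ => rfl) (fun _ _ _ _ => rfl) .act (fun _ _ b => .act b _) 2 (by norm_num)
  -- The input has been consumed, so the first string is empty: the classical output is `[]`, and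
  -- the second string states the number of qubits.
  obtain ⟨d₅, h₅⟩ := Cmd.exists_emit (A := QGate × HeadMove) (fun l f => ⟨f, [], l.1, l.2⟩)
    (fun (l : BitString × List (QGate × HeadMove)) b => (l.1 ++ [b], l.2))
    (fun _ _ => rfl) (fun _ _ _ _ => rfl) .pushSnd (fun _ _ b => .pushSnd b _ rfl) 3 (by norm_num)
  set d : Cmd (QGate × HeadMove) := .seq d₁ (.seq d₂ (.seq d₃ (.seq d₄ d₅))) with hd
  refine ⟨(d.prog d.bound).fragment.toDcqTM, fun x hx => ?_⟩
  obtain ⟨c, n, hc, hn, r₁⟩ := h₁ x hx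
  refine ⟨c, hc, ?_⟩
  set f : ℕ → ℕ := fun r => if r = 0 then strCode x else if r = 1 then n else 0 with hf
  have hf8 : ∀ r, 8 ≤ r → f r = 0 := by intro r hr; simp only [hf]; rw [if_neg (by omega), if_neg (by omega)]
  have r₂ := h₂ ⟨f, [], [], []⟩ x c hf8 hn
  set f₂ := Function.update f 2 (digitsCode (Fintype.card (QGate × HeadMove)) Cmd.finCode (g c))
    with hf₂
  have hf₂8 : ∀ r, 8 ≤ r → f₂ r = 0 := by
    intro r hr; rw [hf₂, Function.update_of_ne (by omega), hf8 r hr]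
  have r₃ := h₃ ⟨f₂, [], [], []⟩ x c hf₂8 hn
  set f₃ := Function.update f₂ 3 (digitsCode (Fintype.card Bool) Cmd.finCode (o c)) with hf₃
  have hf₃8 : ∀ r, 8 ≤ r → f₃ r = 0 := by
    intro r hr; rw [hf₃, Function.update_of_ne (by omega), hf₂8 r hr]
  have r₄ := h₄ [] (g c) f₃ (by simp [hf₃, hf₂, hf]) (by simp [hf₃, hf₂, hf]) hf₃8
    (by simp [hf₃, hf₂])
  have r₅ := h₅ ([], g c) (o c) (Function.update f₃ 2 0) (by simp [hf₃, hf₂, hf])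
    (by simp [hf₃, hf₂, hf])
    (by intro r hr; rw [Function.update_of_ne (by omega), hf₃8 r hr]) (by simp [hf₃])
  rw [foldl_concat] at r₄
  rw [foldl_concat_fst] at r₅
  have r : Cmd.Runs d _ _ := .seq r₁ (.seq r₂ (.seq r₃ (.seq r₄ r₅)))
  have := (r.exec le_rfl).runs
  simp only [Mem.store, Mem.layout_init] at this
  have := this.outputs_dcq (n := 0) (ρ := QState.empty) (x := x) (Mem.readsFrom_fst _ _)
    (Mem.readsFrom_snd _ _)
  exact this

section
open scoped symmDiff

/-! ## State vectors of the quantum tape -/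

/-- The action of a gate on the cells `i` and `i + 1` on state vectors. -/
noncomputable def gateVec (i : ℤ) (G : Matrix (Bool × Bool) (Bool × Bool) ℂ)
    (ψ : TapeBasis → ℂ) : TapeBasis → ℂ :=
  fun a => ∑ v, G (getCells i a) v * ψ (setCells i v a)

/-- The density operator of a state vector. -/
def pureTape (ψ : TapeBasis → ℂ) : QTape := fun a b => ψ a * star (ψ b)

/-- Conjugation of a rank one operator acts on its vector. As the empty input `ε` is pure, state
vectors suffice for the whole proof. -/
theorem pureTape_conj (ψ : TapeBasis → ℂ) (i : ℤ) (G : Matrix (Bool × Bool) (Bool × Bool) ℂ) :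
    (pureTape ψ).conj i G = pureTape (gateVec i G ψ) := by
  funext a b
  simp only [QTape.conj, pureTape, gateVec, star_sum, star_mul']
  rw [Finset.sum_mul_sum]
  refine Finset.sum_congr rfl fun v _ => Finset.sum_congr rfl fun w _ => ?_
  ring

/-- The state vector of the empty tape. -/
noncomputable def vacuum : TapeBasis → ℂ := Pi.single ∅ 1

theorem ofState_empty : QTape.ofState QState.empty = pureTape vacuum := by
  funext a b
  have : Subsingleton (Fin (2 ^ 0)) := inferInstanceAs (Subsingleton (Fin 1))
  have h : ∀ x : Fin (2 ^ 0), basisCells 0 x = ∅ := fun x => by simp [basisCells]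
  rw [QTape.ofState, Fintype.sum_eq_single (0 : Fin (2 ^ 0)) fun x hx => (hx (Subsingleton.elim _ _)).elim,
    Fintype.sum_eq_single (0 : Fin (2 ^ 0)) fun x hx => (hx (Subsingleton.elim _ _)).elim]
  simp only [h, QState.empty, Matrix.one_apply_eq, pureTape, vacuum, Pi.single_apply]
  by_cases ha : a = ∅ <;> by_cases hb : b = ∅ <;> simp [ha, hb]

noncomputable def vecRun (l : List (QGate × HeadMove)) (c : (TapeBasis → ℂ) × ℤ) :
    (TapeBasis → ℂ) × ℤ :=
  l.foldl (fun c a => (gateVec c.2 a.1.mat c.1, c.2 + a.2.toInt)) c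

theorem quantumRun_pureTape (l : List (QGate × HeadMove)) (ψ : TapeBasis → ℂ) (p : ℤ) :
    quantumRun l (pureTape ψ, p) = (pureTape (vecRun l (ψ, p)).1, (vecRun l (ψ, p)).2) := by
  induction l generalizing ψ p with
  | nil => rfl
  | cons a l ih =>
    simp only [quantumRun, vecRun, List.foldl_cons] at ih ⊢
    rw [pureTape_conj, ih]

/-- The eigenvalue of the Pauli operator `Z` on the cell `i`. -/
noncomputable def zSign (i : ℤ) (a : TapeBasis) : ℂ := if i ∈ a then -1 else 1

theorem setCell_false_true (i : ℤ) (a : TapeBasis) :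
    (i ∈ a → setCell i true a = a ∧ setCell i false a = a ∆ {i}) ∧
      (i ∉ a → setCell i false a = a ∧ setCell i true a = a ∆ {i}) := by
  refine ⟨fun h => ⟨by simp [setCell, h], ?_⟩, fun h => ⟨by simp [setCell, h], ?_⟩⟩
  · ext j
    by_cases hj : j = i <;> simp [setCell, Finset.mem_symmDiff, hj, h]
  · ext j
    by_cases hj : j = i <;> simp [setCell, Finset.mem_symmDiff, hj, h]

/-- The phase factor `e^{iπ/4}`. -/
noncomputable def omega8 : ℂ := Complex.exp (((Real.pi / 4 : ℝ) : ℂ) * Complex.I)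

theorem gateVec_ident (i : ℤ) (ψ : TapeBasis → ℂ) : gateVec i QGate.ident.mat ψ = ψ := by
  funext a
  simp [gateVec, QGate.mat, Matrix.one_apply, setCells_getCells]

theorem gateVec_oneQubit (i : ℤ) (G : Matrix Bool Bool ℂ) (ψ : TapeBasis → ℂ) (a : TapeBasis) :
    gateVec i (Matrix.kroneckerMap (· * ·) G (1 : Matrix Bool Bool ℂ)) ψ a =
      ∑ v, G (decide (i ∈ a)) v * ψ (setCell i v a) := by
  simp only [gateVec, Fintype.sum_prod_type, Matrix.kroneckerMap_apply, getCells, setCells]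
  refine Finset.sum_congr rfl fun v _ => ?_
  rw [Fintype.sum_eq_single (decide (i + 1 ∈ a))]
  · rw [Matrix.one_apply_eq, mul_one, setCell_decide_mem]
  · intro w hw
    rw [Matrix.one_apply_ne hw.symm]
    simp

theorem gateVec_hadamard (i : ℤ) (ψ : TapeBasis → ℂ) (a : TapeBasis) :
    gateVec i QGate.hadamard.mat ψ a = (ψ (a ∆ {i}) + zSign i a * ψ a) / ((√2 : ℝ) : ℂ) := by
  rw [QGate.mat, gateVec_oneQubit]
  have := setCell_false_true i a
  by_cases h : i ∈ a
  · simp [h, zSign, this.1 h]; ring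
  · simp [h, zSign, this.2 h]; ring

theorem gateVec_diagonal (i : ℤ) (d : Bool → ℂ) (ψ : TapeBasis → ℂ) (a : TapeBasis) :
    gateVec i (Matrix.kroneckerMap (· * ·) (Matrix.diagonal d) (1 : Matrix Bool Bool ℂ)) ψ a =
      d (decide (i ∈ a)) * ψ a := by
  rw [gateVec_oneQubit, Fintype.sum_eq_single (decide (i ∈ a))]
  · rw [Matrix.diagonal_apply_eq, setCell_decide_mem]
  · intro w hw
    rw [Matrix.diagonal_apply_ne _ hw.symm, zero_mul]

theorem gateVec_phase (i : ℤ) (ψ : TapeBasis → ℂ) (a : TapeBasis) :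
    gateVec i QGate.phase.mat ψ a = (if i ∈ a then Complex.I else 1) * ψ a := by
  rw [QGate.mat, gateVec_diagonal]
  simp

theorem gateVec_piEighth (i : ℤ) (ψ : TapeBasis → ℂ) (a : TapeBasis) :
    gateVec i QGate.piEighth.mat ψ a = (if i ∈ a then omega8 else 1) * ψ a := by
  rw [QGate.mat, gateVec_diagonal]
  simp [omega8]

/-- Exchange the cells `i` and `i + 1` of a basis state. -/
def swapCells (i : ℤ) (a : TapeBasis) : TapeBasis := a.map (Equiv.swap i (i + 1)).toEmbedding

/-- Negate the cell `j` of a basis state if the cell `i` is `1`. -/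
def cnotCells (i j : ℤ) (a : TapeBasis) : TapeBasis := if i ∈ a then a ∆ {j} else a

theorem mem_setCell (i j : ℤ) (v : Bool) (a : TapeBasis) :
    j ∈ setCell i v a ↔ if j = i then v = true else j ∈ a := by
  unfold setCell
  cases v <;> by_cases h : j = i <;> simp [h]

theorem gateVec_swap (i : ℤ) (ψ : TapeBasis → ℂ) (a : TapeBasis) :
    gateVec i QGate.swap.mat ψ a = ψ (swapCells i a) := by
  rw [gateVec, Fintype.sum_eq_single ((getCells i a).2, (getCells i a).1)]
  · simp only [QGate.mat, Matrix.of_apply, if_true, one_mul]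
    congr 1
    ext j
    simp only [setCells, getCells, mem_setCell, swapCells, Finset.mem_map_equiv, Equiv.symm_swap]
    by_cases h₁ : j = i
    · simp [h₁]
    by_cases h₂ : j = i + 1
    · simp [h₂]
    simp [h₁, h₂, Equiv.swap_apply_of_ne_of_ne h₁ h₂]
  · intro v hv
    rw [QGate.mat, Matrix.of_apply, if_neg, zero_mul]
    rintro h
    exact hv (by rw [h])

theorem gateVec_cnot (i : ℤ) (ψ : TapeBasis → ℂ) (a : TapeBasis) :
    gateVec i QGate.cnot.mat ψ a = ψ (cnotCells i (i + 1) a) := by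
  rw [gateVec, Fintype.sum_eq_single ((getCells i a).1, xor (getCells i a).1 (getCells i a).2)]
  · simp only [QGate.mat, Matrix.of_apply]
    rw [if_pos (by simp), one_mul]
    congr 1
    ext j
    simp only [setCells, getCells, mem_setCell, cnotCells]
    by_cases h : i ∈ a
    · by_cases h₁ : j = i
      · simp [h₁, h, Finset.mem_symmDiff]
      by_cases h₂ : j = i + 1
      · simp [h₂, h, Finset.mem_symmDiff]
      simp [h₁, h₂, h, Finset.mem_symmDiff]
    · by_cases h₁ : j = i
      · simp [h₁, h]
      by_cases h₂ : j = i + 1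
      · simp [h₂, h]
      simp [h₁, h₂, h]
  · intro v hv
    rw [QGate.mat, Matrix.of_apply, if_neg, zero_mul]
    rintro h
    exact hv (by rw [h]; simp)

end

section
open scoped symmDiff ComplexConjugate

/-! ## Operators on the state vectors of a finite set of cells -/

/-- The inner product of the restrictions of state vectors to the cells in `R`. -/
noncomputable def cellInner (R : Finset ℤ) (ψ φ : TapeBasis → ℂ) : ℂ :=
  ∑ a ∈ R.powerset, conj (ψ a) * φ a

theorem cellInner_conj (R : Finset ℤ) (ψ φ : TapeBasis → ℂ) :
    conj (cellInner R ψ φ) = cellInner R φ ψ := by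
  simp only [cellInner, map_sum, map_mul, Complex.conj_conj]
  exact Finset.sum_congr rfl fun _ _ => mul_comm _ _

theorem cellInner_add (R : Finset ℤ) (ψ φ φ' : TapeBasis → ℂ) :
    cellInner R ψ (φ + φ') = cellInner R ψ φ + cellInner R ψ φ' := by
  simp [cellInner, mul_add, Finset.sum_add_distrib]

theorem cellInner_smul (R : Finset ℤ) (ψ φ : TapeBasis → ℂ) (c : ℂ) :
    cellInner R ψ (c • φ) = c * cellInner R ψ φ := by
  simp only [cellInner, Finset.mul_sum, Pi.smul_apply, smul_eq_mul]
  exact Finset.sum_congr rfl fun _ _ => by ring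

theorem cellInner_continuous (R : Finset ℤ) (ψ : TapeBasis → ℂ) : Continuous (cellInner R ψ) := by
  unfold cellInner
  fun_prop

/-- The vector has no component outside of the cells in `R`. -/
def SupportedOn (R : Finset ℤ) (ψ : TapeBasis → ℂ) : Prop := ∀ a, ¬ a ⊆ R → ψ a = 0

/-- The state vectors that gates on the cells in `R` produce from the vacuum. -/
inductive Reachable (R : Finset ℤ) : (TapeBasis → ℂ) → Prop
  | vacuum : Reachable R vacuum
  | gate {ψ} (g : QGate) (i : ℤ) (hi : i ∈ R) (hg : g = .swap ∨ g = .cnot → i + 1 ∈ R) :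
      Reachable R ψ → Reachable R (gateVec i g.mat ψ)

/-- The vectors that can be approximated, up to a phase factor. -/
def approachable (R : Finset ℤ) : Set (TapeBasis → ℂ) :=
  closure {φ | ∃ (c : ℂ) (ψ : TapeBasis → ℂ), ‖c‖ = 1 ∧ Reachable R ψ ∧ φ = c • ψ}

theorem smul_mem_approachable {R : Finset ℤ} {φ : TapeBasis → ℂ} (hφ : φ ∈ approachable R) {c : ℂ}
    (hc : ‖c‖ = 1) : c • φ ∈ approachable R := by
  refine map_mem_closure (f := fun φ : TapeBasis → ℂ => c • φ) (continuous_const_smul c) hφ ?_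
  rintro _ ⟨d, ψ, hd, hψ, rfl⟩
  exact ⟨c * d, ψ, by simp [hc, hd], hψ, smul_smul _ _ _⟩

theorem gateVec_continuous (i : ℤ) (G : Matrix (Bool × Bool) (Bool × Bool) ℂ) :
    Continuous (gateVec i G) := by
  unfold gateVec
  fun_prop

theorem gateVec_smul (i : ℤ) (G : Matrix (Bool × Bool) (Bool × Bool) ℂ) (c : ℂ)
    (ψ : TapeBasis → ℂ) : gateVec i G (c • ψ) = c • gateVec i G ψ := by
  funext a
  simp only [gateVec, Pi.smul_apply, smul_eq_mul, Finset.mul_sum]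
  exact Finset.sum_congr rfl fun _ _ => by ring

theorem gateVec_mem_approachable {R : Finset ℤ} {φ : TapeBasis → ℂ} (hφ : φ ∈ approachable R)
    (g : QGate) {i : ℤ} (hi : i ∈ R) (hg : g = .swap ∨ g = .cnot → i + 1 ∈ R) :
    gateVec i g.mat φ ∈ approachable R := by
  refine map_mem_closure (gateVec_continuous i g.mat) hφ ?_
  rintro _ ⟨c, ψ, hc, hψ, rfl⟩
  exact ⟨c, _, hc, hψ.gate g i hi hg, gateVec_smul _ _ _ _⟩

/-- An operator `U` with the inverse and adjoint `U'`, both of which are realized by gates. -/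
structure IsSymmetry (R : Finset ℤ) (U U' : (TapeBasis → ℂ) → TapeBasis → ℂ) : Prop where
  adjoint : ∀ ψ φ, cellInner R (U ψ) φ = cellInner R ψ (U' φ)
  left_inv : ∀ φ, U' (U φ) = φ
  mapsTo : ∀ φ ∈ approachable R, U φ ∈ approachable R
  mapsTo' : ∀ φ ∈ approachable R, U' φ ∈ approachable R

theorem IsSymmetry.congr {R : Finset ℤ} {U U' W W' : (TapeBasis → ℂ) → TapeBasis → ℂ}
    (hU : IsSymmetry R U U') (h : ∀ φ, U φ = W φ) (h' : ∀ φ, U' φ = W' φ) : IsSymmetry R W W' := by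
  rwa [← funext h, ← funext h']

theorem IsSymmetry.inner_map {R : Finset ℤ} {U U' : (TapeBasis → ℂ) → TapeBasis → ℂ}
    (hU : IsSymmetry R U U') (ψ φ : TapeBasis → ℂ) :
    cellInner R (U ψ) (U φ) = cellInner R ψ φ := by
  rw [hU.adjoint, hU.left_inv]

/-- A permutation of the basis states of the cells in `R`. -/
theorem cellInner_involution {R : Finset ℤ} (f : TapeBasis → TapeBasis) (hf : ∀ a, f (f a) = a)
    (hR : ∀ a ⊆ R, f a ⊆ R) (ψ φ : TapeBasis → ℂ) :
    cellInner R (fun a => ψ (f a)) φ = cellInner R ψ fun a => φ (f a) := by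
  unfold cellInner
  refine Finset.sum_nbij' f f ?_ ?_ ?_ ?_ ?_
  · simpa using hR
  · simpa using hR
  · simp [hf]
  · simp [hf]
  · simp [hf]

theorem cellInner_diagonal {R : Finset ℤ} (d : TapeBasis → ℂ) (ψ φ : TapeBasis → ℂ) :
    cellInner R (fun a => d a * ψ a) φ = cellInner R ψ fun a => conj (d a) * φ a := by
  unfold cellInner
  refine Finset.sum_congr rfl fun a _ => ?_
  simp only [map_mul]
  ring

theorem symmDiff_subset {R a b : Finset ℤ} (ha : a ⊆ R) (hb : b ⊆ R) : a ∆ b ⊆ R := by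
  intro j hj
  rcases Finset.mem_symmDiff.1 hj with h | h
  · exact ha h.1
  · exact hb h.1

theorem zSign_mul_self (i : ℤ) (a : TapeBasis) : zSign i a * zSign i a = 1 := by
  unfold zSign; split_ifs <;> norm_num

theorem zSign_conj (i : ℤ) (a : TapeBasis) : conj (zSign i a) = zSign i a := by
  unfold zSign; split_ifs <;> simp

theorem zSign_symmDiff (i : ℤ) (a b : TapeBasis) :
    zSign i (a ∆ b) = zSign i a * zSign i b := by
  unfold zSign
  by_cases h₁ : i ∈ a <;> by_cases h₂ : i ∈ b <;> simp [Finset.mem_symmDiff, h₁, h₂]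

theorem zSign_symmDiff_self (i : ℤ) (a : TapeBasis) : zSign i (a ∆ {i}) = -zSign i a := by
  rw [zSign_symmDiff]; simp [zSign]

theorem zSign_symmDiff_of_ne {i j : ℤ} (h : i ≠ j) (a : TapeBasis) :
    zSign i (a ∆ {j}) = zSign i a := by
  rw [zSign_symmDiff]; simp [zSign, h]

theorem symmDiff_cancel_right (a b : TapeBasis) : (a ∆ b) ∆ b = a := by
  rw [symmDiff_assoc, symmDiff_self, symmDiff_bot]

theorem sqrt_two_sq : ((√2 : ℝ) : ℂ) * ((√2 : ℝ) : ℂ) = 2 := by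
  rw [← Complex.ofReal_mul, Real.mul_self_sqrt (by norm_num)]; norm_num

theorem sqrt_two_ne : ((√2 : ℝ) : ℂ) ≠ 0 := by
  intro h; have := sqrt_two_sq; rw [h] at this; norm_num at this

/-- The Hadamard gate on the cell `i`. -/
noncomputable def opH (i : ℤ) (ψ : TapeBasis → ℂ) : TapeBasis → ℂ :=
  fun a => (ψ (a ∆ {i}) + zSign i a * ψ a) / ((√2 : ℝ) : ℂ)

theorem opH_opH (i : ℤ) (ψ : TapeBasis → ℂ) : opH i (opH i ψ) = ψ := by
  funext a
  simp only [opH, symmDiff_cancel_right, zSign_symmDiff_self]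
  have h := sqrt_two_sq
  have h0 := sqrt_two_ne
  field_simp
  linear_combination (-1 : ℂ) * ψ a * h + ψ a * zSign_mul_self i a

theorem isSymmetry_opH {R : Finset ℤ} {i : ℤ} (hi : i ∈ R) : IsSymmetry R (opH i) (opH i) := by
  have hm : ∀ φ ∈ approachable R, opH i φ ∈ approachable R := fun φ hφ => by
    have := gateVec_mem_approachable hφ .hadamard hi (by simp)
    rwa [show gateVec i QGate.hadamard.mat φ = opH i φ from
      funext fun a => gateVec_hadamard i φ a] at this
  refine ⟨fun ψ φ => ?_, opH_opH i, hm, hm⟩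
  have h₁ := cellInner_involution (R := R) (fun a => a ∆ {i}) (fun a => symmDiff_cancel_right a _)
    (fun a ha => symmDiff_subset ha (by simpa using hi)) ψ φ
  have h₂ := cellInner_diagonal (R := R) (zSign i) ψ φ
  simp only [zSign_conj] at h₂
  have e₁ : cellInner R (opH i ψ) φ = (cellInner R (fun a => ψ (a ∆ {i})) φ +
      cellInner R (fun a => zSign i a * ψ a) φ) / ((√2 : ℝ) : ℂ) := by
    simp only [cellInner, opH, ← Finset.sum_add_distrib, Finset.sum_div]
    refine Finset.sum_congr rfl fun a _ => ?_
    simp only [map_div₀, map_add, map_mul, Complex.conj_ofReal]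
    ring
  have e₂ : cellInner R ψ (opH i φ) = (cellInner R ψ (fun a => φ (a ∆ {i})) +
      cellInner R ψ (fun a => zSign i a * φ a)) / ((√2 : ℝ) : ℂ) := by
    simp only [cellInner, opH, ← Finset.sum_add_distrib, Finset.sum_div]
    refine Finset.sum_congr rfl fun a _ => ?_
    ring
  rw [e₁, e₂, h₁, h₂]

/-- The phase gate on the cell `i`. -/
noncomputable def opS (i : ℤ) (ψ : TapeBasis → ℂ) : TapeBasis → ℂ :=
  fun a => (if i ∈ a then Complex.I else 1) * ψ a

theorem opS_mem {R : Finset ℤ} {i : ℤ} (hi : i ∈ R) {φ : TapeBasis → ℂ} (hφ : φ ∈ approachable R) :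
    opS i φ ∈ approachable R := by
  have := gateVec_mem_approachable hφ .phase hi (by simp)
  rwa [show gateVec i QGate.phase.mat φ = opS i φ from
    funext fun a => gateVec_phase i φ a] at this

theorem isSymmetry_opS {R : Finset ℤ} {i : ℤ} (hi : i ∈ R) :
    IsSymmetry R (opS i) (fun φ => opS i (opS i (opS i φ))) := by
  refine ⟨fun ψ φ => ?_, fun φ => ?_, fun φ => opS_mem hi,
    fun φ hφ => opS_mem hi (opS_mem hi (opS_mem hi hφ))⟩
  · refine (cellInner_diagonal _ _ _).trans ?_
    congr 1
    funext a
    by_cases h : i ∈ a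
    · simp only [opS, h, if_true, Complex.conj_I]
      linear_combination (-Complex.I) * φ a * Complex.I_sq
    · simp [opS, h]
  · funext a
    by_cases h : i ∈ a
    · simp only [opS, h, if_true]
      linear_combination (Complex.I ^ 2 - 1) * φ a * Complex.I_sq
    · simp [opS, h]

/-- The Pauli operator `X` on the cells in `A`. -/
def opX (A : Finset ℤ) (ψ : TapeBasis → ℂ) : TapeBasis → ℂ := fun a => ψ (a ∆ A)

/-- `X = H S S H`. -/
theorem isSymmetry_opX {R : Finset ℤ} {i : ℤ} (hi : i ∈ R) :
    IsSymmetry R (opX {i}) (opX {i}) := by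
  have e : ∀ φ, opH i (opS i (opS i (opH i φ))) = opX {i} φ := by
    intro φ
    funext a
    have h := sqrt_two_sq
    have h0 := sqrt_two_ne
    simp only [opH, opS, opX, symmDiff_cancel_right, zSign_symmDiff_self]
    by_cases hi : i ∈ a
    · simp only [hi, zSign, if_true, Finset.mem_symmDiff, Finset.mem_singleton, not_true,
        and_false, or_self, if_false]
      field_simp
      linear_combination (-1 : ℂ) * φ (a ∆ {i}) * h + (φ a - φ (a ∆ {i})) * Complex.I_sq
    · simp only [hi, zSign, if_true, Finset.mem_symmDiff, Finset.mem_singleton, not_true,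
        and_false, if_false, not_false_iff, and_true, or_true]
      field_simp
      linear_combination (-1 : ℂ) * φ (a ∆ {i}) * h + (φ a - φ (a ∆ {i})) * Complex.I_sq
  have hm : ∀ φ ∈ approachable R, opX {i} φ ∈ approachable R := fun φ hφ => by
    rw [← e]
    exact (isSymmetry_opH hi).mapsTo _ (opS_mem hi (opS_mem hi ((isSymmetry_opH hi).mapsTo _ hφ)))
  exact ⟨cellInner_involution (R := R) (fun a => a ∆ {i}) (fun a => symmDiff_cancel_right a _)
    (fun a ha => symmDiff_subset ha (by simpa using hi)),
    fun φ => funext fun a => by simp [opX], hm, hm⟩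

/-- The controlled `Z` gate on the cells `i` and `j`. -/
noncomputable def opCZ (i j : ℤ) (ψ : TapeBasis → ℂ) : TapeBasis → ℂ :=
  fun a => (if i ∈ a ∧ j ∈ a then -1 else 1) * ψ a

theorem opCZ_adjoint (R : Finset ℤ) (i j : ℤ) (ψ φ : TapeBasis → ℂ) :
    cellInner R (opCZ i j ψ) φ = cellInner R ψ (opCZ i j φ) := by
  refine (cellInner_diagonal _ _ _).trans ?_
  congr 1
  funext a
  unfold opCZ
  split_ifs <;> simp

theorem opCZ_opCZ (i j : ℤ) (φ : TapeBasis → ℂ) : opCZ i j (opCZ i j φ) = φ := by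
  funext a
  unfold opCZ
  split_ifs <;> simp

theorem opCZ_comm (i j : ℤ) (φ : TapeBasis → ℂ) : opCZ i j φ = opCZ j i φ := by
  funext a
  simp only [opCZ, and_comm]

/-- The conjugate of `CNOT` by a Hadamard gate on the target. The controlled `Z` is preferred
because it is diagonal and symmetric in its cells. -/
theorem isSymmetry_opCZ_adjacent {R : Finset ℤ} {i : ℤ} (hi : i ∈ R) (hj : i + 1 ∈ R) :
    IsSymmetry R (opCZ i (i + 1)) (opCZ i (i + 1)) := by
  have e : ∀ φ, opH (i + 1) (fun a => opH (i + 1) φ (cnotCells i (i + 1) a)) =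
      opCZ i (i + 1) φ := by
    intro φ
    funext a
    have h := sqrt_two_sq
    have h0 := sqrt_two_ne
    have h1 : i ∈ a ∆ {i + 1} ↔ i ∈ a := by simp [Finset.mem_symmDiff]
    have hz : (if i + 1 ∈ a then (-1 : ℂ) else 1) = zSign (i + 1) a := rfl
    by_cases hi : i ∈ a
    · simp only [opH, opCZ, cnotCells, h1, hi, if_true, symmDiff_cancel_right,
        zSign_symmDiff_self, true_and, hz]
      field_simp
      linear_combination (-1 : ℂ) * zSign (i + 1) a * φ a * h -
        φ (a ∆ {i + 1}) * zSign_mul_self (i + 1) a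
    · simp only [opH, opCZ, cnotCells, h1, hi, if_false, symmDiff_cancel_right,
        zSign_symmDiff_self, false_and]
      field_simp
      linear_combination (-1 : ℂ) * φ a * h + φ a * zSign_mul_self (i + 1) a
  have hm : ∀ φ ∈ approachable R, opCZ i (i + 1) φ ∈ approachable R := fun φ hφ => by
    rw [← e]
    refine (isSymmetry_opH hj).mapsTo _ ?_
    have := gateVec_mem_approachable ((isSymmetry_opH hj).mapsTo _ hφ) .cnot hi (fun _ => hj)
    rwa [show gateVec i QGate.cnot.mat (opH (i + 1) φ) = _ from
      funext fun a => gateVec_cnot i _ a] at this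
  exact ⟨opCZ_adjoint R _ _, opCZ_opCZ _ _, hm, hm⟩

theorem mem_swapCells (i j : ℤ) (a : TapeBasis) :
    j ∈ swapCells i a ↔ Equiv.swap i (i + 1) j ∈ a := by
  simp [swapCells, Finset.mem_map_equiv]

/-- Two-qubit gates act on neighbours, but conjugation by a swap moves one end of the controlled `Z`
by a cell. All cells between `i` and `j` are used on the way, hence the interval. -/
theorem isSymmetry_opCZ {R : Finset ℤ} (a b : ℤ) (hR : R = Finset.Icc a b) {i j : ℤ} (hi : i ∈ R)
    (hj : j ∈ R) (hij : i ≠ j) : IsSymmetry R (opCZ i j) (opCZ i j) := by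
  have key : ∀ k : ℕ, ∀ i ∈ R, i + 1 + k ∈ R → IsSymmetry R (opCZ i (i + 1 + k)) (opCZ i (i + 1 + k)) := by
    intro k
    induction k with
    | zero =>
      intro i hi hk
      rw [Nat.cast_zero, add_zero] at hk ⊢
      exact isSymmetry_opCZ_adjacent hi hk
    | succ k ih =>
      intro i hi hk
      have hk' : i + 1 + k ∈ R := by
        rw [hR, Finset.mem_Icc] at hi hk ⊢
        push_cast at hk
        omega
      have h := ih i hi hk'
      set j := i + 1 + (k : ℤ) with hj
      have ej : i + 1 + ((k + 1 : ℕ) : ℤ) = j + 1 := by push_cast; ring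
      rw [ej] at hk ⊢
      have hs : ∀ φ ∈ approachable R, (fun a => φ (swapCells j a)) ∈ approachable R := by
        intro φ hφ
        have := gateVec_mem_approachable hφ .swap hk' (fun _ => hk)
        rwa [show gateVec j QGate.swap.mat φ = _ from funext fun a => gateVec_swap j _ a] at this
      have hss : ∀ a, swapCells j (swapCells j a) = a := by
        intro a; ext l; simp [mem_swapCells]
      have e : ∀ φ, (fun a => opCZ i j (fun a => φ (swapCells j a)) (swapCells j a)) =
          opCZ i (j + 1) φ := by
        intro φ
        funext a
        have h1 : i ∈ swapCells j a ↔ i ∈ a := by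
          rw [mem_swapCells, Equiv.swap_apply_of_ne_of_ne (by omega) (by omega)]
        simp [opCZ, h1, mem_swapCells j j a, hss]
      have hm : ∀ φ ∈ approachable R, opCZ i (j + 1) φ ∈ approachable R := fun φ hφ => by
        rw [← e]
        exact hs _ (h.mapsTo _ (hs _ hφ))
      exact ⟨opCZ_adjoint R _ _, opCZ_opCZ _ _, hm, hm⟩
  rcases lt_or_gt_of_ne hij with h | h
  · have := key (j - i - 1).toNat i hi
    rw [show i + 1 + ((j - i - 1).toNat : ℤ) = j by omega] at this
    exact this hj
  · have := key (i - j - 1).toNat j hj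
    rw [show j + 1 + ((i - j - 1).toNat : ℤ) = i by omega] at this
    exact (this hi).congr (fun φ => opCZ_comm _ _ φ) (fun φ => opCZ_comm _ _ φ)

end

section
open scoped symmDiff ComplexConjugate

/-! ## The orbit of the vacuum -/

/-- Apart from the Hadamard gate, which is an isometry by `isSymmetry_opH`, every gate is diagonal
with entries of modulus one or permutes the basis states by an involution that preserves `R`. -/
theorem Reachable.supported_norm {R : Finset ℤ} {ψ : TapeBasis → ℂ} (h : Reachable R ψ) :
    SupportedOn R ψ ∧ cellInner R ψ ψ = 1 := by
  induction h with
  | vacuum =>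
    refine ⟨fun a ha => ?_, ?_⟩
    · rw [_root_.vacuum, Pi.single_apply, if_neg]
      rintro rfl
      exact ha (Finset.empty_subset _)
    · rw [cellInner, Finset.sum_eq_single ∅]
      · simp [_root_.vacuum]
      · intro b _ hb
        simp [_root_.vacuum, hb]
      · simp
  | @gate ψ g i hi hg _ ih =>
    obtain ⟨hs, hn⟩ := ih
    have hsub : ∀ a : Finset ℤ, ¬ a ⊆ R → ∀ j ∈ R, ¬ a ∆ {j} ⊆ R := fun a ha j hj h => ha (by
      rw [← symmDiff_cancel_right a {j}]
      exact symmDiff_subset h (by simpa using hj))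
    have diag : ∀ (d : TapeBasis → ℂ) (φ : TapeBasis → ℂ), φ = (fun a => d a * ψ a) →
        (∀ a, conj (d a) * d a = 1) → SupportedOn R φ ∧ cellInner R φ φ = 1 := by
      rintro d φ rfl hd
      refine ⟨fun a ha => by simp [hs a ha], ?_⟩
      rw [cellInner_diagonal, ← hn]
      congr 1
      funext a
      rw [← mul_assoc, hd, one_mul]
    have perm : ∀ (f : TapeBasis → TapeBasis) (φ : TapeBasis → ℂ), φ = (fun a => ψ (f a)) →
        (∀ a, f (f a) = a) → (∀ a ⊆ R, f a ⊆ R) → SupportedOn R φ ∧ cellInner R φ φ = 1 := by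
      rintro f φ rfl hf hR
      refine ⟨fun a ha => hs _ fun h => ha (by rw [← hf a]; exact hR _ h), ?_⟩
      rw [cellInner_involution f hf hR, ← hn]
      congr 1
      funext a
      rw [hf]
    cases g with
    | ident => rw [gateVec_ident]; exact ⟨hs, hn⟩
    | hadamard =>
      have e : gateVec i QGate.hadamard.mat ψ = opH i ψ := funext fun a => gateVec_hadamard i ψ a
      rw [e]
      refine ⟨fun a ha => ?_, ((isSymmetry_opH hi).inner_map ψ ψ).trans hn⟩
      rw [opH, hs a ha, hs _ (hsub a ha i hi)]
      simp
    | phase =>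
      refine diag _ _ (funext fun a => gateVec_phase i ψ a) fun a => ?_
      split_ifs <;> simp
    | piEighth =>
      refine diag _ _ (funext fun a => gateVec_piEighth i ψ a) fun a => ?_
      split_ifs
      · rw [← Complex.normSq_eq_conj_mul_self, Complex.normSq_eq_norm_sq, omega8,
          Complex.norm_exp_ofReal_mul_I]
        simp
      · simp
    | swap =>
      have hi' := hg (by simp)
      refine perm _ _ (funext fun a => gateVec_swap i ψ a) (fun a => ?_) fun a ha j hj => ?_
      · ext l; simp [mem_swapCells]
      · rw [mem_swapCells] at hj
        by_cases h₁ : j = i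
        · rwa [h₁]
        by_cases h₂ : j = i + 1
        · rwa [h₂]
        rw [Equiv.swap_apply_of_ne_of_ne h₁ h₂] at hj
        exact ha hj
    | cnot =>
      have hi' := hg (by simp)
      refine perm _ _ (funext fun a => gateVec_cnot i ψ a) (fun a => ?_) fun a ha => ?_
      · unfold cnotCells
        by_cases h : i ∈ a
        · simp only [h, if_true]
          rw [if_pos (by simp [Finset.mem_symmDiff, h]), symmDiff_cancel_right]
        · simp [h]
      · unfold cnotCells
        split_ifs
        · exact symmDiff_subset ha (by simpa using hi')
        · exact ha

theorem approachable_subset (R : Finset ℤ) :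
    approachable R ⊆ {φ | SupportedOn R φ ∧ cellInner R φ φ = 1} := by
  refine closure_minimal ?_ ?_
  · rintro _ ⟨c, ψ, hc, hψ, rfl⟩
    obtain ⟨h₁, h₂⟩ := hψ.supported_norm
    refine ⟨fun a ha => by simp [h₁ a ha], ?_⟩
    rw [cellInner_smul, ← cellInner_conj, cellInner_smul, h₂, mul_one, Complex.mul_conj,
      Complex.normSq_eq_norm_sq, hc]
    simp
  · have e : {φ | SupportedOn R φ ∧ cellInner R φ φ = 1} =
        (⋂ a : {a : TapeBasis // ¬ a ⊆ R}, {φ : TapeBasis → ℂ | φ a = 0}) ∩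
          {φ | cellInner R φ φ = 1} := by
      ext φ
      simp [SupportedOn]
    rw [e]
    refine (isClosed_iInter fun a => isClosed_eq (continuous_apply _) continuous_const).inter
      (isClosed_eq ?_ continuous_const)
    unfold cellInner
    fun_prop

/-- The vectors are functions on all basis states of the infinite tape with the topology of
pointwise convergence. Normalization bounds the coordinates by `1`, so the set is closed in a
product of discs, and Tychonoff's theorem applies. -/
theorem isCompact_approachable (R : Finset ℤ) : IsCompact (approachable R) := by
  refine IsCompact.of_isClosed_subset
    (isCompact_univ_pi fun _ : TapeBasis => isCompact_closedBall (0 : ℂ) 1) isClosed_closure ?_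
  intro φ hφ a _
  obtain ⟨h₁, h₂⟩ := approachable_subset R hφ
  rw [mem_closedBall_zero_iff]
  by_cases ha : a ⊆ R
  · have h₃ : ∑ b ∈ R.powerset, ‖φ b‖ ^ 2 = 1 := by
      have : ((∑ b ∈ R.powerset, ‖φ b‖ ^ 2 : ℝ) : ℂ) = 1 := by
        rw [← h₂, cellInner]
        push_cast
        exact Finset.sum_congr rfl fun b _ => by rw [← Complex.conj_mul']
      exact_mod_cast this
    have h₄ : ‖φ a‖ ^ 2 ≤ 1 := h₃ ▸ Finset.single_le_sum (f := fun b => ‖φ b‖ ^ 2)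
      (fun b _ => by positivity) (Finset.mem_powerset.2 ha)
    nlinarith [norm_nonneg (φ a)]
  · simp [h₁ a ha]

theorem vacuum_mem_approachable (R : Finset ℤ) : vacuum ∈ approachable R :=
  subset_closure ⟨1, vacuum, by simp, .vacuum, by simp⟩

/-- Flip the cells of `A` one by one, starting from the vacuum. -/
theorem single_mem_approachable {R A : Finset ℤ} (hA : A ⊆ R) :
    (Pi.single A 1 : TapeBasis → ℂ) ∈ approachable R := by
  induction A using Finset.induction_on with
  | empty => exact vacuum_mem_approachable R
  | insert i A hi ih =>
    have h := (isSymmetry_opX (hA (Finset.mem_insert_self i A))).mapsTo _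
      (ih fun j hj => hA (Finset.mem_insert_of_mem hj))
    convert h using 1
    funext a
    have e : insert i A = A ∆ {i} := by
      ext j
      by_cases hj : j = i <;> simp [Finset.mem_symmDiff, hj, hi]
    simp only [opX, Pi.single_apply, e]
    congr 1
    exact propext ⟨fun h => by rw [h, symmDiff_cancel_right],
      fun h => by rw [← h, symmDiff_cancel_right]⟩

/-- The vector `φ` maximizes the overlap with `ψ` among the approachable vectors. -/
def IsBest (R : Finset ℤ) (φ ψ : TapeBasis → ℂ) : Prop :=
  φ ∈ approachable R ∧ ∀ φ' ∈ approachable R, ‖cellInner R ψ φ'‖ ≤ ‖cellInner R ψ φ‖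

theorem exists_isBest (R : Finset ℤ) (ψ : TapeBasis → ℂ) : ∃ φ, IsBest R φ ψ := by
  obtain ⟨φ, h₁, h₂⟩ := (isCompact_approachable R).exists_isMaxOn ⟨_, vacuum_mem_approachable R⟩
    ((cellInner_continuous R ψ).norm.continuousOn)
  exact ⟨φ, h₁, fun φ' h => h₂ h⟩

/-- A competitor `φ'` of `U φ` is pulled back to the competitor `U' φ'` of `φ`; this is where the
inverse has to preserve the approachable vectors. -/
theorem IsBest.map {R : Finset ℤ} {U U' : (TapeBasis → ℂ) → TapeBasis → ℂ} (hU : IsSymmetry R U U')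
    {φ ψ : TapeBasis → ℂ} (h : IsBest R φ ψ) : IsBest R (U φ) (U ψ) := by
  refine ⟨hU.mapsTo _ h.1, fun φ' hφ' => ?_⟩
  rw [hU.inner_map, hU.adjoint]
  exact h.2 _ (hU.mapsTo' _ hφ')

/-- The first order condition for an overlap to be extremal in the direction of the operator `P`. -/
def StationaryAlong (R : Finset ℤ) (P : (TapeBasis → ℂ) → TapeBasis → ℂ) : Prop :=
  ∀ φ ψ, IsBest R φ ψ →
    conj (cellInner R ψ φ) * cellInner R ψ (P φ) = cellInner R ψ φ * cellInner R φ (P ψ)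

/-- The condition for `P` at the best pair `(U φ, U ψ)` is the condition for `U' P U` at `(φ, ψ)`.
For self-adjoint `P` the condition says that `conj ⟨ψ, φ⟩ ⟨ψ, P φ⟩` is real; in the chosen form it
is homogeneous in `P`, so factors `c` such as `-i` do no harm. -/
theorem StationaryAlong.transport {R : Finset ℤ} {U U' P P' : (TapeBasis → ℂ) → TapeBasis → ℂ}
    (hP : StationaryAlong R P) (hU : IsSymmetry R U U') (c : ℂ)
    (h : ∀ φ, U (P' φ) = c • P (U φ)) : StationaryAlong R P' := by
  intro φ ψ hb
  have := hP _ _ (hb.map hU)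
  rw [hU.inner_map] at this
  rw [← hU.inner_map ψ (P' φ), ← hU.inner_map φ (P' ψ), h, h, cellInner_smul, cellInner_smul]
  linear_combination c * this

/-! ## Rotations about an axis of infinite order -/

/-- The operator `T H T H`, up to a phase. -/
noncomputable def opRot (i : ℤ) (φ : TapeBasis → ℂ) : TapeBasis → ℂ := fun a =>
  if i ∈ a then (omega8 + 1) / 2 * φ a + (1 - omega8) / 2 * φ (a ∆ {i})
  else (conj omega8 + 1) / 2 * φ a + (conj omega8 - 1) / 2 * φ (a ∆ {i})

theorem omega8_eq : omega8 = (√2 / 2 : ℝ) + (√2 / 2 : ℝ) * Complex.I := by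
  rw [omega8, Complex.exp_mul_I, ← Complex.ofReal_cos, ← Complex.ofReal_sin, Real.cos_pi_div_four,
    Real.sin_pi_div_four]

theorem omega8_conj_mul : conj omega8 * omega8 = 1 := by
  rw [← Complex.normSq_eq_conj_mul_self, Complex.normSq_eq_norm_sq, omega8,
    Complex.norm_exp_ofReal_mul_I]
  simp

theorem omega8_add_conj : omega8 + conj omega8 = (√2 : ℝ) := by
  rw [Complex.add_conj, omega8_eq]; simp; ring

theorem omega8_sub_conj : omega8 - conj omega8 = (√2 : ℝ) * Complex.I := by
  rw [Complex.sub_conj, omega8_eq]; simp; ring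

/-- The phase `e^{-iπ/4}` gives `T H T H` the determinant `1`, so that it is a genuine rotation. It
is allowed because vectors are only approached up to a phase. -/
theorem opRot_mem {R : Finset ℤ} {i : ℤ} (hi : i ∈ R) {φ : TapeBasis → ℂ}
    (hφ : φ ∈ approachable R) : opRot i φ ∈ approachable R := by
  have e : opRot i φ = conj omega8 • gateVec i QGate.piEighth.mat (gateVec i QGate.hadamard.mat
      (gateVec i QGate.piEighth.mat (gateVec i QGate.hadamard.mat φ))) := by
    funext a
    have h := sqrt_two_sq
    have h0 := sqrt_two_ne
    have hw := omega8_conj_mul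
    simp only [opRot, Pi.smul_apply, smul_eq_mul, gateVec_piEighth, gateVec_hadamard,
      symmDiff_cancel_right, zSign_symmDiff_self]
    by_cases hi : i ∈ a
    · simp only [hi, zSign, if_true, Finset.mem_symmDiff, Finset.mem_singleton, not_true,
        and_false, or_self, if_false]
      rw [← mul_assoc, hw]
      field_simp
      linear_combination (((omega8 + 1) * φ a + (1 - omega8) * φ (a ∆ {i}))) * h
    · simp only [hi, zSign, if_true, Finset.mem_symmDiff, Finset.mem_singleton,
        not_false_iff, and_true, or_true, if_false]
      field_simp
      linear_combination (((conj omega8 + 1) * φ a + (conj omega8 - 1) * φ (a ∆ {i}))) * h +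
        2 * (φ (a ∆ {i}) - φ a) * hw
  rw [e]
  refine smul_mem_approachable ?_ (by rw [RCLike.norm_conj, omega8, Complex.norm_exp_ofReal_mul_I])
  exact gateVec_mem_approachable (gateVec_mem_approachable (gateVec_mem_approachable
    (gateVec_mem_approachable hφ .hadamard hi (by simp)) .piEighth hi (by simp))
      .hadamard hi (by simp)) .piEighth hi (by simp)

/-- The cosine of the angle of the rotation. -/
noncomputable def rotCos : ℝ := 1 / 2 + √2 / 4

theorem rotCos_bounds : 0 < rotCos ∧ rotCos < 1 := by
  have h1 : √2 < 2 := by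
    rw [Real.sqrt_lt' (by norm_num)]; norm_num
  unfold rotCos
  constructor
  · positivity
  · linarith

/-- The angle of the rotation. -/
noncomputable def rotAngle : ℝ := Real.arccos rotCos

theorem cos_rotAngle : Real.cos rotAngle = rotCos :=
  Real.cos_arccos (by linarith [rotCos_bounds.1]) rotCos_bounds.2.le

theorem sin_rotAngle_pos : 0 < Real.sin rotAngle := by
  rw [rotAngle, Real.sin_arccos]
  apply Real.sqrt_pos.2
  nlinarith [rotCos_bounds.1, rotCos_bounds.2]

/-- Otherwise `e^{iθ}` is a root of unity, and `2 cos θ = 1 + √2 / 2` is an algebraic integer. Then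
so are `√2 / 2` and its square `1 / 2`, which is absurd since `ℤ` is integrally closed. -/
theorem irrational_rotAngle : Irrational (rotAngle / (2 * Real.pi)) := by
  rw [irrational_iff_ne_rational]
  intro m k hk h
  have hk' : (k : ℝ) ≠ 0 := by exact_mod_cast hk
  have h1 : (k : ℝ) * rotAngle = m * (2 * Real.pi) := by
    have := Real.pi_ne_zero
    field_simp at h
    linarith
  set z : ℂ := Complex.exp ((rotAngle : ℂ) * Complex.I) with hz
  have hzk : z ^ k = 1 := by
    rw [hz, ← Complex.exp_int_mul, ← mul_assoc]
    have : (k : ℂ) * (rotAngle : ℂ) = m * (2 * Real.pi) := by exact_mod_cast h1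
    rw [this, mul_assoc, Complex.exp_int_mul_two_pi_mul_I]
  have hzn : z ^ k.natAbs = 1 := by
    rcases Int.natAbs_eq k with hk' | hk'
    · rw [hk', zpow_natCast] at hzk; exact hzk
    · rw [hk', zpow_neg, zpow_natCast, inv_eq_one] at hzk; exact hzk
  have hn : 0 < k.natAbs := Int.natAbs_pos.2 hk
  have i1 : IsIntegral ℤ z := IsIntegral.of_pow hn (by rw [hzn]; exact isIntegral_one)
  have i2 : IsIntegral ℤ (conj z) := IsIntegral.of_pow hn (by
    rw [← map_pow, hzn, map_one]; exact isIntegral_one)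
  have e : z + conj z = 1 + ((√2 : ℝ) : ℂ) / 2 := by
    rw [Complex.add_conj, hz, Complex.exp_ofReal_mul_I_re, cos_rotAngle, rotCos]
    push_cast
    ring
  have i3 : IsIntegral ℤ (((√2 : ℝ) : ℂ) / 2) := by
    have := (i1.add i2).sub isIntegral_one
    rwa [e, add_sub_cancel_left] at this
  have i4 : IsIntegral ℤ (algebraMap ℚ ℂ (1 / 2)) := by
    have := i3.pow 2
    have e2 : (((√2 : ℝ) : ℂ) / 2) ^ 2 = algebraMap ℚ ℂ (1 / 2) := by
      have := sqrt_two_sq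
      simp only [one_div, map_inv₀, map_ofNat]
      linear_combination this / 4
    rwa [e2] at this
  rw [isIntegral_algebraMap_iff (algebraMap ℚ ℂ).injective] at i4
  obtain ⟨y, hy⟩ := IsIntegrallyClosed.isIntegral_iff.1 i4
  have h2 : (y : ℚ) = 1 / 2 := by simpa using hy
  have h3 : (2 * y : ℚ) = 1 := by rw [h2]; norm_num
  have h4 : 2 * y = 1 := by exact_mod_cast h3
  omega

/-- The generator of the one-parameter group that contains the rotation. -/
noncomputable def opGen (i : ℤ) (φ : TapeBasis → ℂ) : TapeBasis → ℂ :=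
  fun a => (opRot i φ a - (rotCos : ℝ) * φ a) / (Real.sin rotAngle : ℝ)

/-- Cayley–Hamilton for determinant `1` and trace `2 cos θ`. -/
theorem opRot_opRot (i : ℤ) (φ : TapeBasis → ℂ) (a : TapeBasis) :
    opRot i (opRot i φ) a = 2 * (rotCos : ℝ) * opRot i φ a - φ a := by
  have hw := omega8_conj_mul
  have hs := omega8_add_conj
  have hc : 2 * ((rotCos : ℝ) : ℂ) = 1 + (omega8 + conj omega8) / 2 := by
    rw [hs, rotCos]; push_cast; ring
  rw [hc]
  simp only [opRot, symmDiff_cancel_right]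
  by_cases hi : i ∈ a
  · simp only [hi, if_true, Finset.mem_symmDiff, Finset.mem_singleton, not_true,
      and_false, or_self, if_false]
    linear_combination (-φ a / 2) * hw
  · simp only [hi, if_true, Finset.mem_symmDiff, Finset.mem_singleton,
      not_false_iff, and_true, or_true, if_false]
    linear_combination (-φ a / 2) * hw

/-- With the generator `G`, the `k`-th power of the rotation is `cos kθ + sin kθ G`. The multiples
of `θ` are dense in the circle, already those with natural `k`, and the approachable vectors form a
closed set, so all angles occur. -/
theorem rotation_mem {R : Finset ℤ} {i : ℤ} (hi : i ∈ R) {φ : TapeBasis → ℂ}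
    (hφ : φ ∈ approachable R) (t : Real.Angle) :
    (fun a => (t.cos : ℂ) * φ a + (t.sin : ℂ) * opGen i φ a) ∈ approachable R := by
  set f : Real.Angle → TapeBasis → ℂ :=
    fun t a => (t.cos : ℂ) * φ a + (t.sin : ℂ) * opGen i φ a with hf
  have hcont : Continuous f := by
    refine continuous_pi fun a => ?_
    have := Real.Angle.continuous_cos
    have := Real.Angle.continuous_sin
    fun_prop
  have hiter : ∀ k : ℕ, f (k • (rotAngle : Real.Angle)) = (opRot i)^[k] φ := by
    have hs : ((Real.sin rotAngle : ℝ) : ℂ) ≠ 0 := by exact_mod_cast sin_rotAngle_pos.ne'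
    have hsc : ((Real.sin rotAngle : ℝ) : ℂ) ^ 2 + ((rotCos : ℝ) : ℂ) ^ 2 = 1 := by
      rw [← cos_rotAngle]; exact_mod_cast Real.sin_sq_add_cos_sq rotAngle
    have hlin : ∀ (x y : ℂ) (α β : TapeBasis → ℂ) (a : TapeBasis),
        opRot i (fun a => x * α a + y * β a) a = x * opRot i α a + y * opRot i β a := by
      intro x y α β a
      simp only [opRot]
      split_ifs <;> ring
    have hgen : opGen i φ = fun a => (1 / ((Real.sin rotAngle : ℝ) : ℂ)) * opRot i φ a +
        (-((rotCos : ℝ) : ℂ) / ((Real.sin rotAngle : ℝ) : ℂ)) * φ a := by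
      funext a; rw [opGen]; ring
    intro k
    induction k with
    | zero => funext a; simp [hf]
    | succ k ih =>
      rw [Function.iterate_succ_apply', ← ih]
      funext a
      have e : ((k + 1 : ℕ) • (rotAngle : Real.Angle)) =
          (((k : ℝ) * rotAngle + rotAngle : ℝ) : Real.Angle) := by
        rw [← Real.Angle.natCast_mul_eq_nsmul]; push_cast; ring_nf
      simp only [hf]
      rw [hlin, e, ← Real.Angle.natCast_mul_eq_nsmul, Real.Angle.cos_coe, Real.Angle.sin_coe,
        Real.Angle.cos_coe, Real.Angle.sin_coe, Real.cos_add, Real.sin_add, cos_rotAngle, hgen,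
        hlin, opRot_opRot]
      push_cast
      rw [← Complex.ofReal_sin] at *
      generalize ((Real.sin rotAngle : ℝ) : ℂ) = S at *
      generalize ((rotCos : ℝ) : ℂ) = C at *
      field_simp
      linear_combination (-(Complex.sin (k * rotAngle)) * φ a) * hsc
  have hd : DenseRange (fun k : ℕ => k • (rotAngle : Real.Angle)) := by
    have h := AddCircle.denseRange_zsmul_coe_iff.2 irrational_rotAngle
    have : Fact (0 < 2 * Real.pi) := ⟨by positivity⟩
    exact denseRange_zsmul_iff_nsmul (G := AddCircle (2 * Real.pi)).1 h
  have hall : ∀ k : ℕ, (opRot i)^[k] φ ∈ approachable R := by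
    intro k
    induction k with
    | zero => exact hφ
    | succ k ih => rw [Function.iterate_succ_apply']; exact opRot_mem hi ih
  have hcl : IsClosed (f ⁻¹' approachable R) := isClosed_closure.preimage hcont
  have : (Set.univ : Set Real.Angle) ⊆ f ⁻¹' approachable R := by
    rw [← hd.closure_range]
    refine closure_minimal ?_ hcl
    rintro _ ⟨k, rfl⟩
    rw [Set.mem_preimage, hiter]
    exact hall k
  exact this (Set.mem_univ t)

end

section
open scoped symmDiff ComplexConjugate

/-! ## Universality of the gate set -/

/-- The derivative at `0` of `|cos t u + sin t v|²` is twice this real part. With `ε = tan t`, the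
maximality becomes a quadratic inequality that holds for all real `ε`. -/
theorem re_eq_zero_of_norm_le {u v : ℂ}
    (h : ∀ t : Real.Angle, ‖(t.cos : ℂ) * u + (t.sin : ℂ) * v‖ ≤ ‖u‖) : (conj u * v).re = 0 := by
  have key : ∀ ε : ℝ, 2 * ε * (conj u * v).re + ε ^ 2 * (Complex.normSq v - Complex.normSq u) ≤ 0 := by
    intro ε
    have h1 := h (Real.arctan ε : ℝ)
    rw [Real.Angle.cos_coe, Real.Angle.sin_coe, Real.cos_arctan, Real.sin_arctan] at h1
    have hp : 0 < √(1 + ε ^ 2) := Real.sqrt_pos.2 (by positivity)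
    have h2 : ‖u + (ε : ℂ) * v‖ ≤ √(1 + ε ^ 2) * ‖u‖ := by
      have e : u + (ε : ℂ) * v = ((√(1 + ε ^ 2) : ℝ) : ℂ) *
          (((1 / √(1 + ε ^ 2) : ℝ) : ℂ) * u + ((ε / √(1 + ε ^ 2) : ℝ) : ℂ) * v) := by
        have : ((√(1 + ε ^ 2) : ℝ) : ℂ) ≠ 0 := by exact_mod_cast hp.ne'
        push_cast
        field_simp
      rw [e, norm_mul, Complex.norm_real, Real.norm_of_nonneg hp.le]
      exact mul_le_mul_of_nonneg_left h1 hp.le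
    have h3 : ‖u + (ε : ℂ) * v‖ ^ 2 ≤ (√(1 + ε ^ 2) * ‖u‖) ^ 2 :=
      pow_le_pow_left₀ (norm_nonneg _) h2 2
    rw [mul_pow, Real.sq_sqrt (by positivity), ← Complex.normSq_eq_norm_sq,
      ← Complex.normSq_eq_norm_sq] at h3
    simp only [Complex.normSq_apply, Complex.add_re, Complex.add_im, Complex.mul_re,
      Complex.mul_im, Complex.ofReal_re, Complex.ofReal_im, Complex.conj_re, Complex.conj_im] at h3 ⊢
    nlinarith [h3]
  set w := (conj u * v).re
  set D := Complex.normSq v - Complex.normSq u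
  -- A step in the direction of `w`, short enough for the linear term to dominate the quadratic one.
  have h1 := key (w / (|D| + 1))
  have hp : 0 < |D| + 1 := by positivity
  have h2 : w ^ 2 * (2 * (|D| + 1) + D) ≤ 0 := by
    have e : 2 * (w / (|D| + 1)) * w + (w / (|D| + 1)) ^ 2 * D =
        w ^ 2 * (2 * (|D| + 1) + D) / (|D| + 1) ^ 2 := by
      field_simp
    rw [e, div_le_iff₀ (by positivity), zero_mul] at h1
    exact h1
  have h3 : 0 < 2 * (|D| + 1) + D := by linarith [neg_abs_le D]
  have h4 : w ^ 2 ≤ 0 := by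
    by_contra h
    have := mul_pos (not_le.1 h) h3
    linarith
  exact pow_eq_zero_iff (two_ne_zero) |>.1 (le_antisymm h4 (sq_nonneg w))

theorem IsBest.re_opGen {R : Finset ℤ} {i : ℤ} (hi : i ∈ R) {φ ψ : TapeBasis → ℂ}
    (h : IsBest R φ ψ) : (conj (cellInner R ψ φ) * cellInner R ψ (opGen i φ)).re = 0 := by
  refine re_eq_zero_of_norm_le fun t => ?_
  have := h.2 _ (rotation_mem hi h.1 t)
  rw [show (fun a => (t.cos : ℂ) * φ a + (t.sin : ℂ) * opGen i φ a) =
    (t.cos : ℂ) • φ + (t.sin : ℂ) • opGen i φ from rfl, cellInner_add, cellInner_smul,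
    cellInner_smul] at this
  exact this

/-- The axis of the rotation is not a coordinate axis. Conjugation by `X` reverses its other two
components, so for the generator `G` the sum `G + X G X` is `i r X` with a real `r ≠ 0`. Adding the
first order conditions at `(φ, ψ)` and at `(X φ, X ψ)` gives the condition for `X`. -/
theorem stationaryAlong_opX {R : Finset ℤ} {i : ℤ} (hi : i ∈ R) :
    StationaryAlong R (opX {i}) := by
  intro φ ψ h
  have hX := isSymmetry_opX hi
  have h₁ := h.re_opGen hi
  have h₂ := (h.map hX).re_opGen hi
  rw [hX.inner_map, hX.adjoint] at h₂
  have e : opGen i φ + opX {i} (opGen i (opX {i} φ)) =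
      ((-(√2 / 2) / Real.sin rotAngle : ℝ) * Complex.I) • opX {i} φ := by
    have hs : ((Real.sin rotAngle : ℝ) : ℂ) ≠ 0 := by exact_mod_cast sin_rotAngle_pos.ne'
    have hc : 2 * ((rotCos : ℝ) : ℂ) = 1 + (omega8 + conj omega8) / 2 := by
      rw [omega8_add_conj, rotCos]; push_cast; ring
    have hd : ((√2 : ℝ) : ℂ) * Complex.I = omega8 - conj omega8 := omega8_sub_conj.symm
    funext a
    simp only [Pi.add_apply, Pi.smul_apply, smul_eq_mul, opGen, opRot, opX, symmDiff_cancel_right]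
    rw [Complex.ofReal_div]
    generalize ((Real.sin rotAngle : ℝ) : ℂ) = S at *
    push_cast
    by_cases hi : i ∈ a
    · simp only [hi, if_true, Finset.mem_symmDiff, Finset.mem_singleton, not_true,
        and_false, or_self, if_false]
      field_simp
      linear_combination (-2 * φ a) * hc + (φ (a ∆ {i})) * hd
    · simp only [hi, if_true, Finset.mem_symmDiff, Finset.mem_singleton,
        not_false_iff, and_true, or_true, if_false]
      field_simp
      linear_combination (-2 * φ a) * hc + (φ (a ∆ {i})) * hd
  have h₃ : (conj (cellInner R ψ φ) * (((-(√2 / 2) / Real.sin rotAngle : ℝ) * Complex.I) *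
      cellInner R ψ (opX {i} φ))).re = 0 := by
    rw [← cellInner_smul, ← e, cellInner_add, mul_add, Complex.add_re, h₁, h₂, add_zero]
  have h₄ : (conj (cellInner R ψ φ) * cellInner R ψ (opX {i} φ)).im = 0 := by
    rw [show conj (cellInner R ψ φ) * (((-(√2 / 2) / Real.sin rotAngle : ℝ) * Complex.I) *
      cellInner R ψ (opX {i} φ)) = (-(√2 / 2) / Real.sin rotAngle : ℝ) * (Complex.I *
        (conj (cellInner R ψ φ) * cellInner R ψ (opX {i} φ))) by ring, Complex.re_ofReal_mul,
      Complex.I_mul_re] at h₃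
    rcases mul_eq_zero.1 h₃ with h | h
    · have h2 : (0 : ℝ) < √2 := by positivity
      have := div_neg_of_neg_of_pos (show -(√2 / 2) < 0 by linarith) sin_rotAngle_pos
      exact absurd h this.ne
    · linarith
  have h₅ := Complex.conj_eq_iff_im.2 h₄
  rw [map_mul, Complex.conj_conj, cellInner_conj, hX.adjoint] at h₅
  exact h₅.symm

/-! ### Pauli operators and Clifford conjugation -/

/-- The product of the operators `Z` on the cells in `B`. -/
noncomputable def zChar (B : Finset ℤ) (a : TapeBasis) : ℂ := ∏ j ∈ B, zSign j a

/-- The Pauli operators. -/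
noncomputable def opPauli (A B : Finset ℤ) (φ : TapeBasis → ℂ) : TapeBasis → ℂ :=
  fun a => zChar B a * φ (a ∆ A)

theorem zChar_insert {B : Finset ℤ} {j : ℤ} (h : j ∉ B) (a : TapeBasis) :
    zChar (insert j B) a = zSign j a * zChar B a := Finset.prod_insert h

theorem zChar_symmDiff_of_notMem {B : Finset ℤ} {j : ℤ} (h : j ∉ B) (a : TapeBasis) :
    zChar B (a ∆ {j}) = zChar B a :=
  Finset.prod_congr rfl fun i hi => zSign_symmDiff_of_ne (by rintro rfl; exact h hi) a

theorem insert_eq_symmDiff {A : Finset ℤ} {j : ℤ} (h : j ∉ A) : insert j A = A ∆ {j} := by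
  ext i
  by_cases hi : i = j <;> simp [Finset.mem_symmDiff, hi, h]

theorem opH_opPauli {A B : Finset ℤ} {j : ℤ} (hA : j ∉ A) (hB : j ∉ B) (φ : TapeBasis → ℂ) :
    opH j (opPauli A (insert j B) φ) = opPauli (insert j A) B (opH j φ) := by
  funext a
  have e₁ : a ∆ {j} ∆ A = a ∆ A ∆ {j} := symmDiff_right_comm _ _ _
  have e₂ : a ∆ (A ∆ {j}) = a ∆ A ∆ {j} := (symmDiff_assoc _ _ _).symm
  have e₃ : zSign j (a ∆ A) = zSign j a := by rw [zSign_symmDiff]; simp [zSign, hA]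
  simp only [opH, opPauli, zChar_insert hB, zSign_symmDiff_self, zChar_symmDiff_of_notMem hB,
    insert_eq_symmDiff hA, e₁, e₂, symmDiff_cancel_right, e₃]
  linear_combination (zChar B a * φ (a ∆ A) / ((√2 : ℝ) : ℂ)) * zSign_mul_self j a

theorem opPauli_opH {A B : Finset ℤ} {j : ℤ} (hA : j ∉ A) (hB : j ∉ B) (φ : TapeBasis → ℂ) :
    opH j (opPauli (insert j A) B φ) = opPauli A (insert j B) (opH j φ) := by
  rw [← opH_opH j (opPauli A (insert j B) (opH j φ)), opH_opPauli hA hB, opH_opH]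

theorem opS_opPauli {A B : Finset ℤ} {j : ℤ} (hA : j ∈ A) (hB : j ∉ B) (φ : TapeBasis → ℂ) :
    opS j (opPauli A (insert j B) φ) = (-Complex.I) • opPauli A B (opS j φ) := by
  funext a
  simp only [opS, opPauli, zChar_insert hB, Pi.smul_apply, smul_eq_mul, Finset.mem_symmDiff, hA]
  by_cases h : j ∈ a
  · simp [h, zSign]
  · simp only [h, zSign, if_false, not_false_iff, not_true, and_true, and_false, or_true, if_true]
    linear_combination (zChar B a * φ (a ∆ A)) * Complex.I_sq

theorem opCZ_opPauli {B : Finset ℤ} {i j : ℤ} (hij : i ≠ j) (hB : j ∉ B) (φ : TapeBasis → ℂ) :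
    opCZ i j (opPauli {i} (insert j B) φ) = opPauli {i} B (opCZ i j φ) := by
  funext a
  have h1 : j ∈ a ∆ {i} ↔ j ∈ a := by simp [Finset.mem_symmDiff, hij.symm]
  simp only [opCZ, opPauli, zChar_insert hB, h1]
  by_cases h : i ∈ a <;> by_cases h' : j ∈ a <;> simp [h, h', zSign, Finset.mem_symmDiff]

/-- Every Pauli operator but the identity arises from a single `X` by Clifford conjugation. Starting
with `X` on the cell `i`, controlled `Z` gates attach factors `Z` on other cells, Hadamard gates
turn some of these into `X`, and phase gates turn `X` into `X Z` where both are wanted. For `A = ∅`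
a Hadamard gate turns the initial `X` into `Z`. -/
theorem stationaryAlong_opPauli {R A B : Finset ℤ} {x y : ℤ} (hR : R = Finset.Icc x y)
    (hA : A ⊆ R) (hB : B ⊆ R) : StationaryAlong R (opPauli A B) := by
  have pauli_single : ∀ i ∈ R, ∀ B ⊆ R, i ∉ B → StationaryAlong R (opPauli {i} B) := by
    intro i hi B
    induction B using Finset.induction_on with
    | empty =>
      intro _ _
      have := stationaryAlong_opX hi
      rwa [show opX {i} = opPauli {i} ∅ by funext φ a; simp [opX, opPauli, zChar]] at this
    | insert j B hj ih =>
      intro hB hiB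
      rw [Finset.mem_insert, not_or] at hiB
      rw [Finset.insert_subset_iff] at hB
      exact (ih hB.2 hiB.2).transport (isSymmetry_opCZ x y hR hi hB.1 hiB.1) 1 fun φ => by
        rw [one_smul, opCZ_opPauli hiB.1 hj]
  have pauli_disjoint : ∀ i ∈ R, ∀ A ⊆ R, i ∉ A → ∀ B ⊆ R, i ∉ B → Disjoint A B →
      StationaryAlong R (opPauli (insert i A) B) := by
    intro i hi A
    induction A using Finset.induction_on with
    | empty => intro _ _ B hB hiB _; exact pauli_single i hi B hB hiB
    | insert j A hj ih =>
      intro hA hiA B hB hiB hd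
      rw [Finset.mem_insert, not_or] at hiA
      rw [Finset.insert_subset_iff] at hA
      rw [Finset.disjoint_insert_left] at hd
      have := ih hA.2 hiA.2 (insert j B) (Finset.insert_subset hA.1 hB)
        (by simp [hiA.1, hiB]) (by simp [Finset.disjoint_insert_right, hj, hd.2])
      rw [Finset.insert_comm]
      refine this.transport (isSymmetry_opH hA.1) 1 fun φ => ?_
      rw [one_smul, opPauli_opH (by simp [hj, Ne.symm hiA.1]) hd.1]
  have pauli_all : ∀ A ⊆ R, A.Nonempty → ∀ B ⊆ R, Disjoint A B → ∀ C ⊆ A,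
      StationaryAlong R (opPauli A (C ∪ B)) := by
    intro A hA hAn B hB hd C
    induction C using Finset.induction_on with
    | empty =>
      intro _
      obtain ⟨i, hi⟩ := hAn
      rw [Finset.empty_union, ← Finset.insert_erase hi]
      exact pauli_disjoint i (hA hi) _ ((Finset.erase_subset _ _).trans hA) (by simp) B hB
        (Finset.disjoint_left.1 hd hi) (hd.mono_left (Finset.erase_subset _ _))
    | insert j C hj ih =>
      intro hC
      rw [Finset.insert_subset_iff] at hC
      refine (ih hC.2).transport (isSymmetry_opS (hA hC.1)) (-Complex.I) fun φ => ?_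
      rw [Finset.insert_union, opS_opPauli hC.1 (by
        simp [hj, Finset.disjoint_left.1 hd hC.1])]
  rcases A.eq_empty_or_nonempty with rfl | hAn
  · rcases B.eq_empty_or_nonempty with rfl | ⟨i, hi⟩
    · intro φ ψ _
      have e : opPauli ∅ ∅ = id := by
        funext φ a
        simp [opPauli, zChar, show a ∆ ∅ = a from symmDiff_bot a]
      rw [e, id, id, ← cellInner_conj R ψ φ, mul_comm]
    · rw [← Finset.insert_erase hi]
      refine (pauli_single i (hB hi) (B.erase i) ((Finset.erase_subset _ _).trans hB) (by simp)).transport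
        (isSymmetry_opH (hB hi)) 1 fun φ => ?_
      rw [one_smul, opH_opPauli (by simp) (Finset.notMem_erase i B), insert_empty_eq]
  · have := pauli_all A hA hAn (B \ A) (Finset.sdiff_subset.trans hB) Finset.disjoint_sdiff (B ∩ A)
      Finset.inter_subset_right
    rwa [show B ∩ A ∪ B \ A = B by rw [Finset.union_comm, Finset.sdiff_union_inter]] at this

/-- Fourier inversion on the group of subsets of `R`, whose characters are the signs `zChar B`: the
sum over `B` of `zChar B b * zChar B a` factors over the cells, and vanishes unless `a = b`. -/
theorem eq_zero_of_zChar_sum {R : Finset ℤ} {g : TapeBasis → ℂ}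
    (h : ∀ B ⊆ R, ∑ a ∈ R.powerset, zChar B a * g a = 0) {b : TapeBasis} (hb : b ⊆ R) :
    g b = 0 := by
  have h₁ : ∑ B ∈ R.powerset, zChar B b * ∑ a ∈ R.powerset, zChar B a * g a = 0 :=
    Finset.sum_eq_zero fun B hB => by rw [h B (Finset.mem_powerset.1 hB), mul_zero]
  simp only [Finset.mul_sum] at h₁
  rw [Finset.sum_comm] at h₁
  have h₂ : ∀ a, ∑ B ∈ R.powerset, zChar B b * (zChar B a * g a) =
      (∏ j ∈ R, (1 + zSign j b * zSign j a)) * g a := by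
    intro a
    rw [Finset.prod_one_add, Finset.sum_mul]
    exact Finset.sum_congr rfl fun B _ => by rw [zChar, zChar, Finset.prod_mul_distrib]; ring
  simp only [h₂] at h₁
  rw [Finset.sum_eq_single b] at h₁
  · rcases mul_eq_zero.1 h₁ with h | h
    · simp only [zSign_mul_self] at h
      rw [Finset.prod_const] at h
      exact absurd h (pow_ne_zero _ (by norm_num))
    · exact h
  · intro a ha hab
    rw [Finset.mem_powerset] at ha
    have : ∃ j ∈ R, ¬ (j ∈ b ↔ j ∈ a) := by
      by_contra! hc
      refine hab (Finset.ext fun j => ⟨fun hj => (hc j (ha hj)).2 hj, fun hj => (hc j (hb hj)).1 hj⟩)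
    obtain ⟨j, hj, hj'⟩ := this
    rw [Finset.prod_eq_zero hj, zero_mul]
    unfold zSign
    by_cases h₁ : j ∈ a <;> by_cases h₂ : j ∈ b <;> simp_all
  · intro h
    exact absurd (Finset.mem_powerset.2 hb) h

/-- Every state vector of the cells in an interval can be approximated by the gates. -/
theorem mem_approachable {R : Finset ℤ} {x y : ℤ} (hR : R = Finset.Icc x y) {ψ : TapeBasis → ℂ}
    (hs : SupportedOn R ψ) (hn : cellInner R ψ ψ = 1) : ψ ∈ approachable R := by
  obtain ⟨φ, hφ⟩ := exists_isBest R ψ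
  obtain ⟨hφs, hφn⟩ := approachable_subset R hφ.1
  set u := cellInner R ψ φ with hu
  -- The basis states are approachable, so a maximal overlap of `0` would force `ψ = 0`.
  have hu0 : u ≠ 0 := by
    intro h0
    have h₁ : ∀ a ∈ R.powerset, ψ a = 0 := by
      intro a ha
      have := hφ.2 _ (single_mem_approachable (Finset.mem_powerset.1 ha))
      rw [← hu, h0, norm_zero] at this
      have h2 := norm_le_zero_iff.1 this
      rw [cellInner, Finset.sum_eq_single a] at h2
      · simpa using h2
      · intro b _ hb; simp [hb]
      · intro h; exact absurd ha h
    rw [cellInner, Finset.sum_eq_zero fun a ha => by rw [h₁ a ha, mul_zero]] at hn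
    exact zero_ne_one hn
  -- The entries of `conj u |φ⟩⟨ψ| = u |ψ⟩⟨φ|`. The factors `X` on `b ∆ a` select a diagonal of the
  -- matrix, and the characters `zChar B` separate the entries on it.
  have key : ∀ a ⊆ R, ∀ b ⊆ R, conj u * conj (ψ a) * φ b = u * conj (φ a) * ψ b := by
    intro a ha b hb
    have hA : b ∆ a ⊆ R := symmDiff_subset hb ha
    have := eq_zero_of_zChar_sum (R := R)
      (g := fun a' => conj u * (conj (ψ a') * φ (a' ∆ (b ∆ a))) -
        u * (conj (φ a') * ψ (a' ∆ (b ∆ a)))) (fun B hB => ?_) ha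
    · rw [show a ∆ (b ∆ a) = b by rw [symmDiff_comm b a, symmDiff_symmDiff_cancel_left]] at this
      linear_combination this
    · have h := stationaryAlong_opPauli hR hA hB φ ψ hφ
      rw [← hu] at h
      simp only [cellInner, opPauli, Finset.mul_sum] at h
      rw [← sub_eq_zero, ← Finset.sum_sub_distrib] at h
      rw [← h]
      exact Finset.sum_congr rfl fun a _ => by ring
  -- Apply this identity of operators to `ψ`, and cancel `conj u`.
  have hφψ : ∀ b ⊆ R, φ b = u * ψ b := by
    intro b hb
    have h₁ : ∑ a ∈ R.powerset, ψ a * (conj u * conj (ψ a) * φ b) =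
        ∑ a ∈ R.powerset, ψ a * (u * conj (φ a) * ψ b) :=
      Finset.sum_congr rfl fun a ha => by rw [key a (Finset.mem_powerset.1 ha) b hb]
    have h₂ : ∑ a ∈ R.powerset, ψ a * (conj u * conj (ψ a) * φ b) = conj u * φ b := by
      rw [← mul_one (conj u * φ b), ← hn, cellInner, Finset.mul_sum]
      exact Finset.sum_congr rfl fun a _ => by ring
    have h₃ : ∑ a ∈ R.powerset, ψ a * (u * conj (φ a) * ψ b) = conj u * (u * ψ b) := by
      rw [hu, cellInner_conj, ← hu, cellInner, Finset.sum_mul]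
      exact Finset.sum_congr rfl fun a _ => by ring
    rw [h₂, h₃] at h₁
    exact mul_left_cancel₀ (by simpa using hu0) h₁
  have hφeq : φ = u • ψ := by
    funext a
    by_cases ha : a ⊆ R
    · exact hφψ a ha
    · simp [hs a ha, hφs a ha]
  have huu : conj u * u = 1 := by
    rw [hφeq, cellInner_smul, ← cellInner_conj, cellInner_smul, hn, mul_one] at hφn
    rw [mul_comm]; exact hφn
  have hun : ‖conj u‖ = 1 := by
    rw [← Complex.normSq_eq_conj_mul_self, Complex.normSq_eq_norm_sq] at huu
    have : ‖u‖ ^ 2 = 1 := by exact_mod_cast huu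
    rw [RCLike.norm_conj]
    nlinarith [norm_nonneg u]
  have := smul_mem_approachable hφ.1 hun
  rwa [hφeq, smul_smul, huu, one_smul] at this

end

section
open scoped symmDiff ComplexConjugate

open scoped ComplexOrder MatrixOrder Matrix.Norms.L2Operator in
theorem Matrix.PosSemidef.exists_eq_mul_conjTranspose {m : Type*} [Fintype m] [DecidableEq m]
    {A : Matrix m m ℂ} (hA : A.PosSemidef) : ∃ C : Matrix m m ℂ, A = C * C.conjTranspose := by
  obtain ⟨B, hB⟩ := CStarAlgebra.nonneg_iff_eq_star_mul_self.1 hA.nonneg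
  exact ⟨star B, by rw [hB, ← Matrix.star_eq_conjTranspose, star_star]⟩

/-! ## Preparation of mixed states -/

theorem vecRun_append (l l' : List (QGate × HeadMove)) (c : (TapeBasis → ℂ) × ℤ) :
    vecRun (l ++ l') c = vecRun l' (vecRun l c) := by
  simp [vecRun, List.foldl_append]

/-- Identity gates serve as pure head moves. -/
theorem exists_vecRun_move (ψ : TapeBasis → ℂ) (p q : ℤ) :
    ∃ l, vecRun l (ψ, p) = (ψ, q) := by
  have key : ∀ (m : HeadMove) (k : ℕ) (p : ℤ),
      vecRun (List.replicate k (QGate.ident, m)) (ψ, p) = (ψ, p + k * m.toInt) := by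
    intro m k
    induction k with
    | zero => intro p; simp [vecRun]
    | succ k ih =>
      intro p
      have := ih (p + m.toInt)
      rw [List.replicate_succ]
      simp only [vecRun, List.foldl_cons, gateVec_ident] at this ⊢
      rw [this]
      push_cast
      congr 1
      ring
  rcases le_total p q with h | h
  · refine ⟨_, (key .right (q - p).toNat p).trans ?_⟩
    rw [HeadMove.toInt]
    congr 1
    omega
  · refine ⟨_, (key .left (p - q).toNat p).trans ?_⟩
    rw [HeadMove.toInt]
    congr 1
    omega

theorem Reachable.exists_vecRun {R : Finset ℤ} {ψ : TapeBasis → ℂ} (h : Reachable R ψ) :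
    ∃ l, (vecRun l (_root_.vacuum, 0)).1 = ψ := by
  induction h with
  | vacuum => exact ⟨[], rfl⟩
  | @gate ψ g i _ _ _ ih =>
    obtain ⟨l, hl⟩ := ih
    obtain ⟨l', hl'⟩ := exists_vecRun_move ψ (vecRun l (_root_.vacuum, 0)).2 i
    refine ⟨l ++ (l' ++ [(g, HeadMove.stay)]), ?_⟩
    rw [vecRun_append, vecRun_append,
      show vecRun l (_root_.vacuum, 0) = (ψ, (vecRun l (_root_.vacuum, 0)).2) from
        Prod.ext hl rfl, hl']
    rfl

theorem basisCells_subset (n : ℕ) (x : Fin (2 ^ n)) : basisCells n x ⊆ Finset.Icc 1 (n : ℤ) :=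
  Finset.filter_subset _ _

theorem basisCells_injective (n : ℕ) : Function.Injective (basisCells n) := by
  intro x y h
  refine Fin.ext (Nat.eq_of_testBit_eq fun k => ?_)
  rcases lt_or_ge k n with hk | hk
  · have h₁ : ∀ z : Fin (2 ^ n), ((n : ℤ) - k) ∈ basisCells n z ↔ (z : ℕ).testBit k = true := by
      intro z
      simp only [basisCells, Finset.mem_filter, Finset.mem_Icc]
      rw [show n - ((n : ℤ) - k).toNat = k by omega]
      exact ⟨fun h => h.2, fun h => ⟨by omega, h⟩⟩
    have := h₁ x
    rw [h, h₁ y] at this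
    exact Bool.eq_iff_iff.2 this.symm
  · have h₁ : ∀ z : Fin (2 ^ n), (z : ℕ).testBit k = false := fun z =>
      Nat.testBit_lt_two_pow (z.2.trans_le (Nat.pow_le_pow_right (by norm_num) hk))
    rw [h₁, h₁]

theorem union_eq_union_iff {I b b' e e' : Finset ℤ} (hb : b ⊆ I) (hb' : b' ⊆ I)
    (he : Disjoint e I) (he' : Disjoint e' I) : b ∪ e = b' ∪ e' ↔ b = b' ∧ e = e' := by
  refine ⟨fun h => ?_, fun h => by rw [h.1, h.2]⟩
  have h₁ : ∀ j, (j ∈ b ∨ j ∈ e) ↔ (j ∈ b' ∨ j ∈ e') := fun j => by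
    simpa using Finset.ext_iff.1 h j
  rw [Finset.disjoint_left] at he he'
  constructor
  · ext j
    have := h₁ j; have := @hb j; have := @hb' j; have := @he j; have := @he' j
    tauto
  · ext j
    have := h₁ j; have := @hb j; have := @hb' j; have := @he j; have := @he' j
    tauto

/-- The reduced density matrix of the cells `1, …, n` of a state vector of the cells
`1, …, 2 n`. -/
noncomputable def reducedVec (n : ℕ) (ψ : TapeBasis → ℂ) : Matrix (Fin (2 ^ n)) (Fin (2 ^ n)) ℂ :=
  fun x y => ∑ e ∈ (Finset.Icc ((n : ℤ) + 1) (2 * n)).powerset,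
    ψ (basisCells n x ∪ e) * conj (ψ (basisCells n y ∪ e))

/-- The support condition cuts the `finsum` over all environments down to a fixed finite sum, which
is continuous in the vector. -/
theorem reduced_pureTape {n : ℕ} {ψ : TapeBasis → ℂ}
    (h : SupportedOn (Finset.Icc 1 (2 * (n : ℤ))) ψ) :
    (pureTape ψ).reduced n = reducedVec n ψ := by
  funext x y
  refine finsum_mem_eq_sum_of_inter_support_eq
    (s := {e : TapeBasis | Disjoint e (Finset.Icc (1 : ℤ) n)})
    (fun e => pureTape ψ (basisCells n x ∪ e) (basisCells n y ∪ e)) ?_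
  ext e
  simp only [Set.mem_inter_iff, Set.mem_ofPred_eq, Finset.coe_powerset, Set.mem_preimage,
    Set.mem_powerset_iff, and_congr_left_iff, Finset.coe_subset, Function.mem_support, pureTape]
  intro hne
  have hsub : basisCells n x ∪ e ⊆ Finset.Icc 1 (2 * (n : ℤ)) := by
    by_contra hc
    exact hne (by rw [h _ hc, zero_mul])
  constructor
  · intro hd j hj
    have h₁ := Finset.mem_Icc.1 (hsub (Finset.mem_union_right _ hj))
    have h₂ := Finset.disjoint_left.1 hd hj
    rw [Finset.mem_Icc] at h₂ ⊢
    omega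
  · intro hd
    rw [Finset.disjoint_left]
    intro j hj h₂
    have h₁ := Finset.mem_Icc.1 (hd hj)
    rw [Finset.mem_Icc] at h₂
    omega

/-! ### Purification by an environment of equal size -/

/-- The cells of an environment of `n` qubits to the right of the cells `1, …, n`. -/
noncomputable def environmentCells (n : ℕ) (z : Fin (2 ^ n)) : TapeBasis :=
  (basisCells n z).map (addRightEmbedding (n : ℤ))

theorem environmentCells_subset (n : ℕ) (z : Fin (2 ^ n)) :
    environmentCells n z ⊆ Finset.Icc ((n : ℤ) + 1) (2 * n) := by
  intro j hj
  obtain ⟨i, hi, rfl⟩ := Finset.mem_map.1 hj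
  have := Finset.mem_Icc.1 (basisCells_subset n z hi)
  rw [addRightEmbedding_apply, Finset.mem_Icc]
  omega

theorem disjoint_of_subset_environment {n : ℕ} {e : TapeBasis}
    (he : e ⊆ Finset.Icc ((n : ℤ) + 1) (2 * n)) : Disjoint e (Finset.Icc (1 : ℤ) n) := by
  rw [Finset.disjoint_left]
  intro j hj h₂
  have h₁ := Finset.mem_Icc.1 (he hj)
  rw [Finset.mem_Icc] at h₂
  omega

theorem environmentCells_injective (n : ℕ) : Function.Injective (environmentCells n) :=
  (Finset.map_injective _).comp (basisCells_injective n)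

/-- The vector with the coefficients `B` with respect to the cells and their environment. -/
noncomputable def bipartiteVec {n : ℕ} (B : Matrix (Fin (2 ^ n)) (Fin (2 ^ n)) ℂ) :
    TapeBasis → ℂ :=
  fun a => ∑ x, ∑ z, if a = basisCells n x ∪ environmentCells n z then B x z else 0

theorem bipartiteVec_apply {n : ℕ} (B : Matrix (Fin (2 ^ n)) (Fin (2 ^ n)) ℂ) (x : Fin (2 ^ n))
    {e : TapeBasis} (he : e ⊆ Finset.Icc ((n : ℤ) + 1) (2 * n)) :
    bipartiteVec B (basisCells n x ∪ e) = ∑ z, if e = environmentCells n z then B x z else 0 := by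
  rw [bipartiteVec, Finset.sum_eq_single x]
  · refine Finset.sum_congr rfl fun z _ => ?_
    simp only [union_eq_union_iff (basisCells_subset n x) (basisCells_subset n x)
      (disjoint_of_subset_environment he)
      (disjoint_of_subset_environment (environmentCells_subset n z)), true_and]
  · intro y _ hy
    refine Finset.sum_eq_zero fun z _ => if_neg fun h => hy ?_
    exact (basisCells_injective n ((union_eq_union_iff (basisCells_subset n x)
      (basisCells_subset n y) (disjoint_of_subset_environment he)
      (disjoint_of_subset_environment (environmentCells_subset n z))).1 h).1).symm
  · simp

/-- Tracing out the second factor contracts the column index. A factorization `ρ = C C†` thus yields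
a purification of `ρ`, and its norm is the trace of `ρ`. -/
theorem reducedVec_bipartiteVec {n : ℕ} (B : Matrix (Fin (2 ^ n)) (Fin (2 ^ n)) ℂ) :
    reducedVec n (bipartiteVec B) = B * B.conjTranspose := by
  funext x y
  rw [reducedVec, Matrix.mul_apply]
  have h : ∀ e ∈ (Finset.Icc ((n : ℤ) + 1) (2 * n)).powerset,
      bipartiteVec B (basisCells n x ∪ e) * conj (bipartiteVec B (basisCells n y ∪ e)) =
        ∑ z, if e = environmentCells n z then B x z * conj (B y z) else 0 := by
    intro e he
    rw [Finset.mem_powerset] at he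
    rw [bipartiteVec_apply B x he, bipartiteVec_apply B y he]
    by_cases hz : ∃ z, e = environmentCells n z
    · obtain ⟨z, rfl⟩ := hz
      simp only [(environmentCells_injective n).eq_iff, Finset.sum_ite_eq, Finset.mem_univ, if_true]
    · rw [not_exists] at hz
      simp [hz]
  rw [Finset.sum_congr rfl h, Finset.sum_comm]
  refine Finset.sum_congr rfl fun z _ => ?_
  rw [Finset.sum_ite_eq', if_pos (Finset.mem_powerset.2 (environmentCells_subset n z))]
  rfl

theorem supportedOn_bipartiteVec {n : ℕ} (B : Matrix (Fin (2 ^ n)) (Fin (2 ^ n)) ℂ) :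
    SupportedOn (Finset.Icc 1 (2 * (n : ℤ))) (bipartiteVec B) := by
  intro a ha
  refine Finset.sum_eq_zero fun x _ => Finset.sum_eq_zero fun z _ => if_neg ?_
  rintro rfl
  refine ha (Finset.union_subset (fun j hj => ?_) fun j hj => ?_)
  · have := Finset.mem_Icc.1 (basisCells_subset n x hj)
    rw [Finset.mem_Icc]
    omega
  · have := Finset.mem_Icc.1 (environmentCells_subset n z hj)
    rw [Finset.mem_Icc]
    omega

theorem cellInner_bipartiteVec {n : ℕ} (B : Matrix (Fin (2 ^ n)) (Fin (2 ^ n)) ℂ) :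
    cellInner (Finset.Icc 1 (2 * (n : ℤ))) (bipartiteVec B) (bipartiteVec B) =
      (B * B.conjTranspose).trace := by
  have hsub : ∀ x z, basisCells n x ∪ environmentCells n z ∈
      (Finset.Icc 1 (2 * (n : ℤ))).powerset := by
    intro x z
    refine Finset.mem_powerset.2 (Finset.union_subset (fun j hj => ?_) fun j hj => ?_)
    · have := Finset.mem_Icc.1 (basisCells_subset n x hj)
      rw [Finset.mem_Icc]
      omega
    · have := Finset.mem_Icc.1 (environmentCells_subset n z hj)
      rw [Finset.mem_Icc]
      omega
  have e : ∀ a, conj (bipartiteVec B a) * bipartiteVec B a =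
      ∑ x, ∑ z, if a = basisCells n x ∪ environmentCells n z then
        conj (bipartiteVec B a) * B x z else 0 := by
    intro a
    generalize hw : conj (bipartiteVec B a) = w
    rw [show bipartiteVec B a = ∑ x, ∑ z,
      if a = basisCells n x ∪ environmentCells n z then B x z else 0 from rfl, Finset.mul_sum]
    refine Finset.sum_congr rfl fun x _ => ?_
    rw [Finset.mul_sum]
    refine Finset.sum_congr rfl fun z _ => ?_
    split_ifs <;> simp
  rw [cellInner, Finset.sum_congr rfl fun a _ => e a, Finset.sum_comm, Matrix.trace]
  refine Finset.sum_congr rfl fun x _ => ?_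
  rw [Finset.sum_comm, Matrix.diag_apply, Matrix.mul_apply]
  refine Finset.sum_congr rfl fun z _ => ?_
  rw [Finset.sum_ite_eq', if_pos (hsub x z), bipartiteVec_apply B x (environmentCells_subset n z)]
  simp only [(environmentCells_injective n).eq_iff, Finset.sum_ite_eq, Finset.mem_univ, if_true,
    Matrix.conjTranspose_apply]
  rw [mul_comm]
  rfl

/-- Every state can be prepared from the vacuum, up to an arbitrarily small error. -/
theorem exists_quantumRun_near {n : ℕ} (ρ : QState n) {ε : ℝ} (hε : 0 < ε) :
    ∃ l : List (QGate × HeadMove), ∀ x y,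
      ‖(quantumRun l (QTape.ofState QState.empty, 0)).1.reduced n x y - ρ.mat x y‖ < ε := by
  obtain ⟨C, hC⟩ : ∃ C : Matrix (Fin (2 ^ n)) (Fin (2 ^ n)) ℂ, ρ.mat = C * C.conjTranspose :=
    ρ.posSemidef.exists_eq_mul_conjTranspose
  have h₁ : bipartiteVec C ∈ approachable (Finset.Icc 1 (2 * (n : ℤ))) :=
    mem_approachable rfl (supportedOn_bipartiteVec C)
      (by rw [cellInner_bipartiteVec, ← hC, ρ.trace_eq_one])
  have hcont : ∀ x y, Continuous fun φ : TapeBasis → ℂ => reducedVec n φ x y := by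
    intro x y
    unfold reducedVec
    fun_prop
  -- Only finitely many coordinates of `φ` enter, so this is an open condition for pointwise
  -- convergence. The phase `c` of the approximating vector cancels in the density matrix.
  have hopen : IsOpen {φ : TapeBasis → ℂ | ∀ x y, ‖reducedVec n φ x y - ρ.mat x y‖ < ε} := by
    simp only [Set.ofPred_forall]
    exact isOpen_iInter_of_finite fun x => isOpen_iInter_of_finite fun y =>
      isOpen_lt ((hcont x y).sub continuous_const).norm continuous_const
  obtain ⟨_, hφ, c, χ, hc, hχ, rfl⟩ := mem_closure_iff.1 h₁ _ hopen (fun x y => by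
    rw [reducedVec_bipartiteVec, hC]; simpa using hε)
  obtain ⟨l, hl⟩ := hχ.exists_vecRun
  refine ⟨l, fun x y => ?_⟩
  rw [ofState_empty, quantumRun_pureTape, hl, reduced_pureTape hχ.supported_norm.1]
  have e : reducedVec n (c • χ) x y = reducedVec n χ x y := by
    have hcc : c * conj c = 1 := by
      rw [Complex.mul_conj, Complex.normSq_eq_norm_sq, hc]; simp
    refine Finset.sum_congr rfl fun e _ => ?_
    simp only [Pi.smul_apply, smul_eq_mul, map_mul]
    linear_combination (χ (basisCells n x ∪ e) * conj (χ (basisCells n y ∪ e))) * hcc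
  rw [← e]
  exact hφ x y

end


/-! ## Primitive recursive simulation of machines -/

theorem Primrec.int_natCast : Primrec fun n : ℕ => (n : ℤ) :=
  Primrec.encode_iff.1 ((Primrec.nat_mul.comp (.const 2) .id).of_eq fun _ => rfl)

/-- The encoding of `ℤ` sends `n` to `2 n` and `-(n + 1)` to `2 n + 1`, so the code moves by `2`,
except from `-1` to `0`. -/
theorem Primrec.int_add_one : Primrec fun z : ℤ => z + 1 := by
  have h : Primrec fun e : ℕ => if e % 2 = 0 then e + 2 else if e = 1 then 0 else e - 2 :=
    Primrec.ite (Primrec.eq.comp (Primrec.nat_mod.comp .id (.const 2)) (.const 0))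
      (Primrec.nat_add.comp .id (.const 2)) (Primrec.ite (Primrec.eq.comp .id (.const 1)) (.const 0)
        (Primrec.nat_sub.comp .id (.const 2)))
  refine Primrec.encode_iff.1 ((h.comp Primrec.encode).of_eq fun z => ?_)
  cases z with
  | ofNat n =>
    rw [show Encodable.encode (Int.ofNat n) = 2 * n from rfl,
      show Encodable.encode (Int.ofNat n + 1) = 2 * (n + 1) from rfl]
    simp; omega
  | negSucc n =>
    rw [show Encodable.encode (Int.negSucc n) = 2 * n + 1 from rfl]
    cases n with
    | zero => rfl
    | succ n =>
      rw [show Int.negSucc (n + 1) + 1 = Int.negSucc n by omega,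
        show Encodable.encode (Int.negSucc n) = 2 * n + 1 from rfl]
      rw [if_neg (by omega), if_neg (by omega)]; omega

theorem Primrec.int_sub_one : Primrec fun z : ℤ => z - 1 := by
  have h : Primrec fun e : ℕ => if e % 2 = 1 then e + 2 else if e = 0 then 1 else e - 2 :=
    Primrec.ite (Primrec.eq.comp (Primrec.nat_mod.comp .id (.const 2)) (.const 1))
      (Primrec.nat_add.comp .id (.const 2)) (Primrec.ite (Primrec.eq.comp .id (.const 0)) (.const 1)
        (Primrec.nat_sub.comp .id (.const 2)))
  refine Primrec.encode_iff.1 ((h.comp Primrec.encode).of_eq fun z => ?_)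
  cases z with
  | ofNat n =>
    rw [show Encodable.encode (Int.ofNat n) = 2 * n from rfl]
    cases n with
    | zero => rfl
    | succ n =>
      rw [show Int.ofNat (n + 1) - 1 = Int.ofNat n by simp,
        show Encodable.encode (Int.ofNat n) = 2 * n from rfl]
      rw [if_neg (by omega), if_neg (by omega)]; omega
  | negSucc n =>
    rw [show Encodable.encode (Int.negSucc n) = 2 * n + 1 from rfl,
      show Int.negSucc n - 1 = Int.negSucc (n + 1) by omega,
      show Encodable.encode (Int.negSucc (n + 1)) = 2 * (n + 1) + 1 from rfl]
    rw [if_pos (by omega)]; omega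

theorem Primrec.int_add_toInt : Primrec₂ fun (z : ℤ) (m : HeadMove) => z + m.toInt := by
  have h : Primrec₂ fun (z : ℤ) (m : HeadMove) =>
      if m = .left then z - 1 else if m = .stay then z else z + 1 :=
    Primrec.ite (Primrec.eq.comp .snd (.const _)) (Primrec.int_sub_one.comp .fst)
      (Primrec.ite (Primrec.eq.comp .snd (.const _)) .fst (Primrec.int_add_one.comp .fst))
  refine h.of_eq fun z m => ?_
  cases m <;> simp [HeadMove.toInt, sub_eq_add_neg]

theorem PrimrecRel.ball_lt {α : Type} [Primcodable α] {R : ℕ → α → Prop} (h : PrimrecRel R)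
    {n : α → ℕ} (hn : Primrec n) : PrimrecPred fun a => ∀ i < n a, R i a :=
  (h.forall_mem_list.comp (Primrec.list_range.comp hn) .id).of_eq fun a => by simp

/-- The tape described by a list of assignments, of which the first ones take precedence. -/
def cellOf (w : List (ℤ × TapeSymbol)) : ℤ → TapeSymbol := fun z => (w.lookup z).getD none

theorem cellOf_cons (w : List (ℤ × TapeSymbol)) (z : ℤ) (s : TapeSymbol) :
    cellOf ((z, s) :: w) = Function.update (cellOf w) z s := by
  funext y
  by_cases h : y = z
  · subst h; simp [cellOf]
  · have : (y == z) = false := by simpa using h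
    simp [cellOf, List.lookup_cons, this, Function.update_of_ne h]

theorem primrec_cellOf : Primrec₂ cellOf :=
  Primrec.option_getD.comp (Primrec.listLookup.comp .snd .fst) (.const none)

/-- The assignments that describe a string on a tape. -/
def inputCells (x : BitString) : List (ℤ × TapeSymbol) :=
  (List.range x.length).map fun i : ℕ => ((i : ℤ) + 1, x[i]?)

theorem lookup_map_range' (g : ℕ → TapeSymbol) (n s : ℕ) (z : ℤ) :
    ((List.range' s n).map fun i : ℕ => ((i : ℤ) + 1, g i)).lookup z =
      if (s : ℤ) + 1 ≤ z ∧ z ≤ s + n then some (g (z - 1).toNat) else none := by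
  induction n generalizing s with
  | zero => rw [if_neg (by omega)]; simp
  | succ n ih =>
    rw [List.range'_succ, List.map_cons, List.lookup_cons]
    by_cases h : z = (s : ℤ) + 1
    · subst h
      simp
    · have : (z == (s : ℤ) + 1) = false := by simpa using h
      rw [this, ih]
      push_cast
      by_cases h' : (s : ℤ) + 1 + 1 ≤ z ∧ z ≤ s + 1 + n
      · rw [if_pos h', if_pos (by omega)]
      · rw [if_neg h', if_neg (by omega)]

theorem cellOf_inputCells (x : BitString) : cellOf (inputCells x) = tapeOf (x.map some) := by
  funext z
  rw [cellOf, inputCells, List.range_eq_range', lookup_map_range' fun i => x[i]?]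
  rw [tapeOf]
  by_cases h : 1 ≤ z
  · rw [if_pos h, List.getElem?_map]
    by_cases h' : z ≤ x.length
    · rw [if_pos (by simpa using ⟨h, h'⟩)]
      have hl : (z - 1).toNat < x.length := by omega
      rw [List.getElem?_eq_getElem hl]
      rfl
    · rw [if_neg (by push_cast; omega), List.getElem?_eq_none (by omega)]
      rfl
  · rw [if_neg h, if_neg (by push_cast; omega)]
    rfl

theorem primrec_inputCells : Primrec inputCells :=
  Primrec.list_map (Primrec.list_range.comp .list_length)
    (Primrec.pair (Primrec.int_add_one.comp (Primrec.int_natCast.comp .snd))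
      (Primrec.list_getElem?.comp .fst .snd))

/-! ### Simulation with tapes as association lists -/

/-- The states of a simulation: control state, tape, head position and actions. -/
abbrev SimState (Q A : Type) : Type := Q × List (ℤ × TapeSymbol) × ℤ × List A

/-- One step of the simulation of a machine. -/
def simStep {Q A : Type} [DecidableEq Q] (halt : Q)
    (δ : Q × TapeSymbol → A × TapeSymbol × HeadMove × Q) (c : SimState Q A) : SimState Q A :=
  if c.1 = halt then c else
    ((δ (c.1, cellOf c.2.1 c.2.2.1)).2.2.2,
      (c.2.2.1, (δ (c.1, cellOf c.2.1 c.2.2.1)).2.1) :: c.2.1,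
      c.2.2.1 + (δ (c.1, cellOf c.2.1 c.2.2.1)).2.2.1.toInt,
      c.2.2.2 ++ [(δ (c.1, cellOf c.2.1 c.2.2.1)).1])

/-- The state of the simulation after `t` steps. -/
def simRun {Q A : Type} [DecidableEq Q] (start halt : Q)
    (δ : Q × TapeSymbol → A × TapeSymbol × HeadMove × Q) (x : BitString) (t : ℕ) : SimState Q A :=
  (simStep halt δ)^[t] (start, inputCells x, 0, [])

theorem primrec_simRun {Q A : Type} [DecidableEq Q] [Finite Q] [Primcodable Q] [Primcodable A]
    (start halt : Q) (δ : Q × TapeSymbol → A × TapeSymbol × HeadMove × Q) :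
    Primrec₂ (simRun start halt δ) := by
  have hδ : Primrec δ := Primrec.dom_finite δ
  have hr : Primrec fun c : SimState Q A => δ (c.1, cellOf c.2.1 c.2.2.1) :=
    hδ.comp (Primrec.pair .fst (primrec_cellOf.comp (Primrec.fst.comp .snd)
      (Primrec.fst.comp (Primrec.snd.comp .snd))))
  have hs : Primrec (simStep halt δ) :=
    Primrec.ite (Primrec.eq.comp .fst (.const _)) .id
      (Primrec.pair (Primrec.snd.comp (Primrec.snd.comp (Primrec.snd.comp hr)))
        (Primrec.pair (Primrec.list_cons.comp (Primrec.pair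
            (Primrec.fst.comp (Primrec.snd.comp .snd)) (Primrec.fst.comp (Primrec.snd.comp hr)))
            (Primrec.fst.comp .snd))
          (Primrec.pair (Primrec.int_add_toInt.comp (Primrec.fst.comp (Primrec.snd.comp .snd))
              (Primrec.fst.comp (Primrec.snd.comp (Primrec.snd.comp hr))))
            (Primrec.list_append.comp (Primrec.snd.comp (Primrec.snd.comp .snd))
              (Primrec.list_cons.comp (Primrec.fst.comp hr) (.const []))))))
  exact Primrec.nat_iterate .snd (Primrec.pair (.const _) (Primrec.pair
    (primrec_inputCells.comp .fst) (.const _))) (hs.comp .snd)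

/-- Indexing a list beyond its end gives `none`, which is the blank; so the final blank is the last
case of a single bounded quantifier, suited to primitive recursion. -/
theorem readsFrom_iff (tape : ℤ → TapeSymbol) (a : ℤ) (y : BitString) :
    ReadsFrom tape a y ↔ ∀ i < y.length + 1, tape (a + i) = y[i]? := by
  constructor
  · rintro ⟨h₁, h₂⟩ i hi
    rcases Nat.lt_succ_iff_lt_or_eq.1 hi with h | rfl
    · rw [List.getElem?_eq_getElem h]
      exact h₁ ⟨i, h⟩
    · rw [h₂, List.getElem?_eq_none le_rfl]
  · intro h
    refine ⟨fun i => ?_, ?_⟩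
    · rw [h i (by omega), List.getElem?_eq_getElem i.2]
      rfl
    · rw [h _ (by omega), List.getElem?_eq_none le_rfl]

theorem ReadsFrom.unique {tape : ℤ → TapeSymbol} {a : ℤ} {y y' : BitString}
    (h : ReadsFrom tape a y) (h' : ReadsFrom tape a y') : y = y' := by
  rw [readsFrom_iff] at h h'
  have hl : y.length = y'.length := by
    rcases lt_trichotomy y.length y'.length with hl | hl | hl
    · have h₁ := h y.length (by omega)
      rw [h' y.length (by omega), List.getElem?_eq_none le_rfl, List.getElem?_eq_none_iff] at h₁
      omega
    · exact hl
    · have h₁ := h' y'.length (by omega)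
      rw [h y'.length (by omega), List.getElem?_eq_none le_rfl, List.getElem?_eq_none_iff] at h₁
      omega
  refine List.ext_getElem? fun i => ?_
  by_cases hi : i < y.length + 1
  · rw [← h i hi, h' i (by omega)]
  · rw [List.getElem?_eq_none (by omega), List.getElem?_eq_none (by omega)]

theorem primrec_reads {α : Type} [Primcodable α] {w : α → List (ℤ × TapeSymbol)} {k : α → ℕ}
    {y : α → BitString} (hw : Primrec w) (hk : Primrec k) (hy : Primrec y) :
    PrimrecPred fun c => ReadsFrom (cellOf (w c)) (1 + (k c : ℤ)) (y c) := by
  have h : PrimrecRel fun (i : ℕ) (c : α) =>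
      cellOf (w c) (((k c + i : ℕ) : ℤ) + 1) = (y c)[i]? :=
    Primrec.eq.comp (primrec_cellOf.comp (hw.comp .snd) (Primrec.int_add_one.comp
      (Primrec.int_natCast.comp (Primrec.nat_add.comp (hk.comp .snd) .fst))))
      (Primrec.list_getElem?.comp (hy.comp .snd) .fst)
  have h' := h.ball_lt (Primrec.succ.comp (Primrec.list_length.comp hy))
  refine h'.of_eq fun c => ?_
  rw [readsFrom_iff]
  refine forall₂_congr fun i _ => ?_
  rw [show (((k c + i : ℕ) : ℤ) + 1) = 1 + (k c : ℤ) + i by push_cast; ring]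

/-- Halting configurations are fixed, so the output does not depend on the time at which a search
finds the machine halted. -/
theorem iterate_halt_unique {α : Type*} {f : α → α} {P : α → Prop} (hf : ∀ c, P c → f c = c)
    {c : α} {t t' : ℕ} (h : P (f^[t] c)) (h' : P (f^[t'] c)) : f^[t] c = f^[t'] c := by
  have key : ∀ {t t' : ℕ}, t ≤ t' → P (f^[t] c) → f^[t] c = f^[t'] c := by
    intro t t' hle h
    induction t', hle using Nat.le_induction with
    | base => rfl
    | succ n _ ih => rw [Function.iterate_succ_apply', ← ih, hf _ h]
  rcases le_total t t' with hle | hle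
  · exact key hle h
  · exact (key hle h').symm

namespace ClassicalTM

theorem Outputs.unique {M : ClassicalTM} {x y y' : BitString} (h : M.Outputs x y)
    (h' : M.Outputs x y') : y = y' := by
  obtain ⟨t, ht, hy⟩ := h
  obtain ⟨t', ht', hy'⟩ := h'
  have := iterate_halt_unique (P := fun c : M.Config => c.state = M.halt)
    (fun c hc => by rw [step, if_pos hc]) ht ht'
  rw [this] at hy
  exact hy.unique hy'

/-- The relation "the machine outputs `y` on input `x` after `t` steps" is primitive recursive. -/
theorem exists_primrec_outputs (M : ClassicalTM) :
    ∃ P : BitString × ℕ × BitString → Prop, PrimrecPred P ∧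
      ∀ x y, M.Outputs x y ↔ ∃ t, P (x, t, y) := by
  let _ : Primcodable M.Q := .ofEquiv _ (Fintype.equivFin M.Q)
  set δ : M.Q × TapeSymbol → Unit × TapeSymbol × HeadMove × M.Q :=
    fun p => ((), M.δ p.1 p.2) with hδ
  set sim := simRun M.start M.halt δ with hsim
  have hrun : Primrec fun p : BitString × ℕ × BitString => sim p.1 p.2.1 :=
    (primrec_simRun M.start M.halt δ).comp .fst (Primrec.fst.comp .snd)
  have hinv : ∀ x t, M.step^[t] (M.init x) =
      ⟨(sim x t).1, cellOf (sim x t).2.1, (sim x t).2.2.1⟩ := by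
    intro x t
    induction t with
    | zero => simp [hsim, simRun, init, cellOf_inputCells]
    | succ t ih =>
      have e : sim x (t + 1) = simStep M.halt δ (sim x t) := by
        rw [hsim, simRun, Function.iterate_succ_apply']; rfl
      rw [Function.iterate_succ_apply', ih, e, step, simStep]
      by_cases hq : (sim x t).1 = M.halt
      · simp only [hq, if_true]
      · simp only [hq, if_false, cellOf_cons]
        rfl
  refine ⟨fun p => (sim p.1 p.2.1).1 = M.halt ∧
    ReadsFrom (cellOf (sim p.1 p.2.1).2.1) (1 + ((0 : ℕ) : ℤ)) p.2.2, ?_, fun x y => ?_⟩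
  · exact (Primrec.eq.comp (Primrec.fst.comp hrun) (.const _)).and
      (primrec_reads (Primrec.fst.comp (Primrec.snd.comp hrun)) (.const 0) (Primrec.snd.comp .snd))
  · refine exists_congr fun t => ?_
    rw [hinv]
    simp

end ClassicalTM

namespace DcqTM

theorem Outputs.unique {M : DcqTM} {x y y' : BitString} {n m m' : ℕ} {ρ : QState n}
    {σ : Matrix (Fin (2 ^ m)) (Fin (2 ^ m)) ℂ} {σ' : Matrix (Fin (2 ^ m')) (Fin (2 ^ m')) ℂ}
    (h : M.Outputs x ρ y m σ) (h' : M.Outputs x ρ y' m' σ') : m = m' ∧ HEq σ σ' := by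
  obtain ⟨t, ht, hy, ⟨s, hs, hm⟩, hσ⟩ := h
  obtain ⟨t', ht', hy', ⟨s', hs', hm'⟩, hσ'⟩ := h'
  have := iterate_halt_unique (P := fun c : M.Config => c.state = M.halt)
    (fun c hc => by rw [step, if_pos hc]) ht ht'
  rw [this] at hy hs hσ
  obtain rfl := hy.unique hy'
  obtain rfl := hs.unique hs'
  obtain rfl : m = m' := by rw [hm, hm']
  exact ⟨rfl, by rw [hσ, hσ']⟩

/-- The relation "the machine outputs `y` and a number `s` of qubits on input `x` after `t` steps"
and the sequence of the gates that it has applied are primitive recursive. -/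
theorem exists_primrec_outputs (M : DcqTM) :
    ∃ (P : BitString × ℕ × BitString × BitString → Prop)
      (g : BitString → ℕ → List (QGate × HeadMove)), PrimrecPred P ∧ Primrec₂ g ∧
      ∀ x y m σ, M.Outputs x QState.empty y m σ ↔ ∃ t s, P (x, t, y, s) ∧ m = strToNat s ∧
        σ = (quantumRun (g x t) (QTape.ofState QState.empty, 0)).1.reduced m := by
  let _ : Primcodable M.Q := .ofEquiv _ (Fintype.equivFin M.Q)
  set δ : M.Q × TapeSymbol → (QGate × HeadMove) × TapeSymbol × HeadMove × M.Q :=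
    fun p => (((M.δ p.1 p.2).1, (M.δ p.1 p.2).2.1), (M.δ p.1 p.2).2.2) with hδ
  set sim := simRun M.start M.halt δ with hsim
  have hP := primrec_simRun M.start M.halt δ
  have hrun : Primrec fun p : BitString × ℕ × BitString × BitString => sim p.1 p.2.1 :=
    hP.comp .fst (Primrec.fst.comp .snd)
  have hinv : ∀ x t, M.step^[t] (M.init x QState.empty) =
      ⟨(sim x t).1, cellOf (sim x t).2.1, (sim x t).2.2.1,
        (quantumRun (sim x t).2.2.2 (QTape.ofState QState.empty, 0)).1,
        (quantumRun (sim x t).2.2.2 (QTape.ofState QState.empty, 0)).2⟩ := by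
    intro x t
    induction t with
    -- The empty state has `0` qubits and `0` is the empty numeral, so nothing but blanks follows
    -- `x` on the initial tape.
    | zero =>
      simp [hsim, simRun, init, cellOf_inputCells, quantumRun, natToStr, tapeOf_append_none]
    | succ t ih =>
      have e : sim x (t + 1) = simStep M.halt δ (sim x t) := by
        rw [hsim, simRun, Function.iterate_succ_apply']; rfl
      rw [Function.iterate_succ_apply', ih, e, step, simStep]
      by_cases hq : (sim x t).1 = M.halt
      · simp only [hq, if_true]
      · simp only [hq, if_false, cellOf_cons, quantumRun, List.foldl_append]
        rfl
  refine ⟨fun p => (sim p.1 p.2.1).1 = M.halt ∧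
    ReadsFrom (cellOf (sim p.1 p.2.1).2.1) (1 + ((0 : ℕ) : ℤ)) p.2.2.1 ∧
    ReadsFrom (cellOf (sim p.1 p.2.1).2.1) (1 + ((p.2.2.1.length + 1 : ℕ) : ℤ)) p.2.2.2,
    fun x t => (sim x t).2.2.2, ?_, ?_, fun x y m σ => ?_⟩
  · exact (Primrec.eq.comp (Primrec.fst.comp hrun) (.const _)).and
      ((primrec_reads (Primrec.fst.comp (Primrec.snd.comp hrun)) (.const 0)
        (Primrec.fst.comp (Primrec.snd.comp .snd))).and
      (primrec_reads (Primrec.fst.comp (Primrec.snd.comp hrun))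
        (Primrec.succ.comp (Primrec.list_length.comp (Primrec.fst.comp (Primrec.snd.comp .snd))))
        (Primrec.snd.comp (Primrec.snd.comp .snd))))
  · exact Primrec.snd.comp (Primrec.snd.comp (Primrec.snd.comp hP))
  · refine exists_congr fun t => ?_
    rw [hinv]
    have e : (1 + ((y.length + 1 : ℕ) : ℤ)) = 1 + (y.length : ℤ) + 1 := by push_cast; ring
    simp only [e, Nat.cast_zero, add_zero]
    constructor
    · rintro ⟨h₁, h₂, ⟨s, h₃, h₄⟩, h₅⟩
      exact ⟨s, ⟨h₁, h₂, h₃⟩, h₄, h₅⟩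
    · rintro ⟨s, ⟨h₁, h₂, h₃⟩, h₄, h₅⟩
      exact ⟨h₁, h₂, ⟨s, h₃, h₄⟩, h₅⟩

end DcqTM

section
open scoped symmDiff ComplexConjugate

/-! ## Path sums -/

/-- Negate a cell of a basis state that is given by the list of its cells with the value `1`. -/
def toggleCell (i : ℤ) (l : List ℤ) : List ℤ := if i ∈ l then l.filter (· ≠ i) else i :: l

theorem toFinset_toggleCell (i : ℤ) (l : List ℤ) :
    (toggleCell i l).toFinset = l.toFinset ∆ {i} := by
  ext j
  unfold toggleCell
  by_cases hi : i ∈ l <;> by_cases hj : j = i <;> simp [Finset.mem_symmDiff, hi, hj]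

/-- The branches, consisting of a basis state and an exponent of the phase factor `e^{iπ/4}`, into
which a gate splits a branch.  -/
def pathStep (g : QGate) (i : ℤ) (t : List ℤ × ℕ) : List (List ℤ × ℕ) :=
  if g = .hadamard then
    [(toggleCell i t.1, t.2), (t.1, if i ∈ t.1 then t.2 + 4 else t.2)]
  else if g = .phase then [(t.1, if i ∈ t.1 then t.2 + 2 else t.2)]
  else if g = .piEighth then [(t.1, if i ∈ t.1 then t.2 + 1 else t.2)]
  else if g = .swap then
    [(if i ∈ t.1 ↔ i + 1 ∈ t.1 then t.1 else toggleCell i (toggleCell (i + 1) t.1), t.2)]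
  else if g = .cnot then [(if i ∈ t.1 then toggleCell (i + 1) t.1 else t.1, t.2)]
  else [t]

/-- The branches, the number of Hadamard gates, and the head position after a sequence of gates. -/
def pathRun (l : List (QGate × HeadMove)) : List (List ℤ × ℕ) × ℕ × ℤ :=
  l.foldl (fun c a => (c.1.flatMap (pathStep a.1 c.2.2),
    if a.1 = .hadamard then c.2.1 + 1 else c.2.1, c.2.2 + a.2.toInt)) ([([], 0)], 0, 0)

/-- The sum of the branches. -/
noncomputable def pathVec (L : List (List ℤ × ℕ)) : TapeBasis → ℂ :=
  fun a => (L.map fun t => if t.1.toFinset = a then omega8 ^ t.2 else 0).sum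

theorem omega8_sq : omega8 ^ 2 = Complex.I := by
  rw [omega8, ← Complex.exp_nat_mul]
  rw [show ((2 : ℕ) : ℂ) * (((Real.pi / 4 : ℝ) : ℂ) * Complex.I) = (Real.pi / 2 : ℂ) * Complex.I by
    push_cast; ring, Complex.exp_pi_div_two_mul_I]

theorem omega8_pow_four : omega8 ^ 4 = -1 := by
  rw [show 4 = 2 * 2 from rfl, pow_mul, omega8_sq, Complex.I_sq]

theorem omega8_pow_eight : omega8 ^ 8 = 1 := by
  rw [show 8 = 4 * 2 from rfl, pow_mul, omega8_pow_four]; norm_num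

/-- Conjugation multiplies exponents by `7`, so phases remain natural exponents in density matrices.
-/
theorem conj_omega8 : conj omega8 = omega8 ^ 7 := by
  have h := omega8_conj_mul
  have h8 := omega8_pow_eight
  linear_combination (-conj omega8) * h8 + omega8 ^ 7 * h

theorem pathVec_cons (t : List ℤ × ℕ) (L : List (List ℤ × ℕ)) :
    pathVec (t :: L) = pathVec [t] + pathVec L := by
  funext a
  simp [pathVec]

theorem pathVec_append (L L' : List (List ℤ × ℕ)) :
    pathVec (L ++ L') = pathVec L + pathVec L' := by
  funext a
  simp [pathVec]

theorem gateVec_add (i : ℤ) (G : Matrix (Bool × Bool) (Bool × Bool) ℂ) (ψ φ : TapeBasis → ℂ) :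
    gateVec i G (ψ + φ) = gateVec i G ψ + gateVec i G φ := by
  funext a
  simp [gateVec, mul_add, Finset.sum_add_distrib]

theorem gateVec_zero (i : ℤ) (G : Matrix (Bool × Bool) (Bool × Bool) ℂ) :
    gateVec i G 0 = 0 := by
  funext a
  simp [gateVec]

/-- The normalization factor of a gate in a path sum. -/
noncomputable def pathFactor (g : QGate) : ℂ :=
  if g = .hadamard then (((√2 : ℝ) : ℂ))⁻¹ else 1

theorem symmDiff_eq_iff (a b c : TapeBasis) : a ∆ b = c ↔ a = c ∆ b :=
  ⟨fun h => by rw [← h, symmDiff_cancel_right], fun h => by rw [h, symmDiff_cancel_right]⟩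

theorem gateVec_branch (g : QGate) (i : ℤ) (t : List ℤ × ℕ) :
    gateVec i g.mat (pathVec [t]) = pathFactor g • pathVec (pathStep g i t) := by
  obtain ⟨l, r⟩ := t
  funext a
  have hm : l.toFinset = a → (i ∈ l ↔ i ∈ a) := fun h => by rw [← h, List.mem_toFinset]
  cases g with
  | ident => simp [gateVec_ident, pathFactor, pathStep]
  | hadamard =>
    simp only [gateVec_hadamard, pathFactor, pathStep, if_true, Pi.smul_apply, smul_eq_mul, pathVec,
      List.map_cons, List.map_nil, List.sum_cons, List.sum_nil, add_zero, toFinset_toggleCell,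
      symmDiff_eq_iff]
    have : zSign i a * (if l.toFinset = a then omega8 ^ r else 0) =
        if l.toFinset = a then omega8 ^ (if i ∈ l then r + 4 else r) else 0 := by
      by_cases h : l.toFinset = a
      · have hm' := hm h
        by_cases hi : i ∈ a <;> simp [h, hm', hi, zSign, pow_add, omega8_pow_four]
      · simp [h]
    rw [this]
    ring
  | phase =>
    simp only [gateVec_phase, pathFactor, pathStep, pathVec, reduceCtorEq, if_false, one_smul,
      if_true, List.map_cons, List.map_nil, List.sum_cons, List.sum_nil, add_zero]
    by_cases h : l.toFinset = a
    · have hm' := hm h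
      by_cases hi : i ∈ a <;> simp [h, hm', hi, pow_add, omega8_sq, mul_comm]
    · simp [h]
  | piEighth =>
    simp only [gateVec_piEighth, pathFactor, pathStep, pathVec, reduceCtorEq, if_false, one_smul,
      if_true, List.map_cons, List.map_nil, List.sum_cons, List.sum_nil, add_zero]
    by_cases h : l.toFinset = a
    · have hm' := hm h
      by_cases hi : i ∈ a <;> simp [h, hm', hi, pow_add, mul_comm]
    · simp [h]
  | swap =>
    simp only [gateVec_swap, pathFactor, pathStep, pathVec, reduceCtorEq, if_false, one_smul,
      if_true, List.map_cons, List.map_nil, List.sum_cons, List.sum_nil, add_zero]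
    -- `gateVec` permutes the argument of the vector, whereas branches move by the inverse
    -- permutation; for an involution the two agree.
    have hss : ∀ b c, b = swapCells i c ↔ swapCells i b = c := by
      have : ∀ c, swapCells i (swapCells i c) = c := fun c => by ext j; simp [mem_swapCells]
      exact fun b c => ⟨fun h => by rw [h, this], fun h => by rw [← h, this]⟩
    have hs : swapCells i l.toFinset = (if i ∈ l ↔ i + 1 ∈ l then l
        else toggleCell i (toggleCell (i + 1) l)).toFinset := by
      ext j
      rw [mem_swapCells]
      by_cases h₁ : j = i
      · subst h₁
        rw [Equiv.swap_apply_left]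
        by_cases h : j ∈ l <;> by_cases h' : j + 1 ∈ l <;>
          simp [h, h', toFinset_toggleCell, Finset.mem_symmDiff]
      by_cases h₂ : j = i + 1
      · subst h₂
        rw [Equiv.swap_apply_right]
        by_cases h : i ∈ l <;> by_cases h' : i + 1 ∈ l <;>
          simp [h, h', toFinset_toggleCell, Finset.mem_symmDiff]
      rw [Equiv.swap_apply_of_ne_of_ne h₁ h₂]
      split_ifs <;> simp [toFinset_toggleCell, Finset.mem_symmDiff, h₁, h₂]
    exact if_congr ((hss _ _).trans (by rw [hs])) rfl rfl
  | cnot =>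
    simp only [gateVec_cnot, pathFactor, pathStep, pathVec, reduceCtorEq, if_false, one_smul,
      if_true, List.map_cons, List.map_nil, List.sum_cons, List.sum_nil, add_zero]
    have hss : ∀ b c, b = cnotCells i (i + 1) c ↔ cnotCells i (i + 1) b = c := by
      have : ∀ c, cnotCells i (i + 1) (cnotCells i (i + 1) c) = c := fun c => by
        unfold cnotCells
        by_cases h : i ∈ c
        · simp only [h, if_true]
          rw [if_pos (by simp [Finset.mem_symmDiff, h]), symmDiff_cancel_right]
        · simp [h]
      exact fun b c => ⟨fun h => by rw [h, this], fun h => by rw [← h, this]⟩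
    have hs : cnotCells i (i + 1) l.toFinset =
        (if i ∈ l then toggleCell (i + 1) l else l).toFinset := by
      by_cases h : i ∈ l <;> simp [cnotCells, h, toFinset_toggleCell]
    exact if_congr ((hss _ _).trans (by rw [hs])) rfl rfl

theorem gateVec_pathVec (g : QGate) (i : ℤ) (L : List (List ℤ × ℕ)) :
    gateVec i g.mat (pathVec L) = pathFactor g • pathVec (L.flatMap (pathStep g i)) := by
  induction L with
  | nil =>
    rw [show pathVec [] = 0 by funext a; simp [pathVec], gateVec_zero, List.flatMap_nil,
      show pathVec [] = 0 by funext a; simp [pathVec], smul_zero]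
  | cons t L ih =>
    rw [pathVec_cons, gateVec_add, ih, gateVec_branch, List.flatMap_cons, pathVec_append, smul_add]

theorem vecRun_eq_pathRun (l : List (QGate × HeadMove)) :
    vecRun l (vacuum, 0) =
      ((((√2 : ℝ) : ℂ))⁻¹ ^ (pathRun l).2.1 • pathVec (pathRun l).1, (pathRun l).2.2) := by
  induction l using List.reverseRecOn with
  | nil =>
    refine Prod.ext (funext fun a => ?_) rfl
    simp [vecRun, pathRun, pathVec, vacuum, Pi.single_apply, eq_comm]
  | append_singleton l a ih =>
    rw [vecRun_append, ih]
    simp only [pathRun, List.foldl_append, List.foldl_cons, List.foldl_nil, vecRun]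
    rw [gateVec_smul, gateVec_pathVec, smul_smul]
    congr 2
    unfold pathFactor
    split_ifs
    · rw [pow_succ]
    · rw [mul_one]

/-! ### Density matrices as sums over pairs of branches -/

/-- The cells `1, …, m` of a basis state spell the index `x`. -/
def Spells (m x : ℕ) (l : List ℤ) : Prop :=
  ∀ i < m, ((i : ℤ) + 1 ∈ l ↔ x.testBit (m - (i + 1)) = true)

/-- The branches `t` and `t'` contribute to the entry `(x, y)` of the reduced density matrix. -/
def Contributes (m x y : ℕ) (l l' : List ℤ) : Prop :=
  Spells m x l ∧ Spells m y l' ∧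
    ∀ z ∈ l ++ l', (∃ i < m, z = (i : ℤ) + 1) ∨ (z ∈ l ∧ z ∈ l')

theorem spells_iff {m : ℕ} {x : Fin (2 ^ m)} {l : List ℤ} :
    Spells m x l ↔ l.toFinset ∩ Finset.Icc 1 (m : ℤ) = basisCells m x := by
  rw [Finset.ext_iff]
  simp only [Finset.mem_inter, List.mem_toFinset, basisCells, Finset.mem_filter, Finset.mem_Icc]
  constructor
  · intro h z
    by_cases hz : 1 ≤ z ∧ z ≤ m
    · have := h (z - 1).toNat (by omega)
      rw [show ((z - 1).toNat : ℤ) + 1 = z by omega, show (z - 1).toNat + 1 = z.toNat by omega]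
        at this
      simp [hz, this]
    · simp [hz]
  · intro h i hi
    have := h ((i : ℤ) + 1)
    rw [show ((i : ℤ) + 1).toNat = i + 1 by omega] at this
    have h₁ : 1 ≤ (i : ℤ) + 1 ∧ (i : ℤ) + 1 ≤ m := by omega
    simpa [h₁] using this

/-- A pair of branches is seen by at most one state `e` of the environment, which can be read off
from the first branch. This turns the partial trace into a sum over pairs. -/
theorem contributes_iff {m : ℕ} {x y : Fin (2 ^ m)} {l l' : List ℤ} {e : TapeBasis}
    (he : Disjoint e (Finset.Icc (1 : ℤ) m)) :
    (l.toFinset = basisCells m x ∪ e ∧ l'.toFinset = basisCells m y ∪ e) ↔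
      e = l.toFinset \ Finset.Icc (1 : ℤ) m ∧ Contributes m x y l l' := by
  have hI : ∀ z : ℤ, (∃ i < m, z = (i : ℤ) + 1) ↔ z ∈ Finset.Icc 1 (m : ℤ) := by
    intro z
    rw [Finset.mem_Icc]
    refine ⟨?_, fun h => ⟨(z - 1).toNat, by omega, by omega⟩⟩
    rintro ⟨i, hi, rfl⟩
    omega
  rw [Contributes, spells_iff, spells_iff]
  simp only [hI, List.mem_append]
  rw [Finset.disjoint_left] at he
  have hx := basisCells_subset m x
  have hy := basisCells_subset m y
  generalize basisCells m x = bx at *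
  generalize basisCells m y = bY at *
  generalize Finset.Icc 1 (m : ℤ) = I at *
  simp only [Finset.ext_iff, Finset.mem_union, Finset.mem_inter, Finset.mem_sdiff,
    List.mem_toFinset]
  constructor
  · rintro ⟨h, h'⟩
    refine ⟨fun z => ?_, fun z => ?_, fun z => ?_, fun z => ?_⟩
    all_goals
      have h₁ := h z; have h₂ := h' z; have h₃ := @he z; have h₄ := @hx z; have h₅ := @hy z
      tauto
  · rintro ⟨h, h', hby, hout⟩
    refine ⟨fun z => ?_, fun z => ?_⟩
    all_goals
      have h₁ := h z; have h₂ := h' z; have h₃ := @he z; have h₄ := @hx z; have h₅ := @hy z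
      have h₆ := hby z; have h₇ := hout z
      clear h h' hby hout he hx hy hI
      grind

open Classical in
/-- The exponents of the phase factors whose sum is an entry of the reduced density matrix, up to
normalization. -/
noncomputable def pathPhases (L : List (List ℤ × ℕ)) (m x y : ℕ) : List ℕ :=
  L.flatMap fun t => (L.filter fun t' => Contributes m x y t.1 t'.1).map fun t' => t.2 + 7 * t'.2

theorem sum_listSum {ι α : Type*} (E : Finset ι) (L : List α) (f : ι → α → ℂ) :
    ∑ e ∈ E, (L.map (f e)).sum = (L.map fun t => ∑ e ∈ E, f e t).sum := by
  induction L with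
  | nil => simp
  | cons t L ih => simp [Finset.sum_add_distrib, ih]

theorem sum_map_filter_eq {α : Type*} (L : List α) (p : α → Bool) (f : α → ℂ) :
    ((L.filter p).map f).sum = (L.map fun t => if p t = true then f t else 0).sum := by
  induction L with
  | nil => simp
  | cons t L ih => by_cases h : p t = true <;> simp [h, ih]

/-- The normalization `2^{-h/2}` enters twice and becomes rational; apart from it, only a sum of
eighth roots of unity is left. -/
theorem reduced_pathVec (L : List (List ℤ × ℕ)) (h m : ℕ) (x y : Fin (2 ^ m)) :
    (pureTape ((((√2 : ℝ) : ℂ))⁻¹ ^ h • pathVec L)).reduced m x y =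
      (1 / 2) ^ h * ((pathPhases L m x y).map (omega8 ^ ·)).sum := by
  set I := Finset.Icc (1 : ℤ) m with hI
  set E : Finset TapeBasis := (L.map fun t => t.1.toFinset \ I).toFinset with hE
  have hEI : ∀ e ∈ E, Disjoint e I := by
    intro e he
    rw [hE, List.mem_toFinset, List.mem_map] at he
    obtain ⟨t, _, rfl⟩ := he
    exact Finset.sdiff_disjoint
  have h₁ : (pureTape ((((√2 : ℝ) : ℂ))⁻¹ ^ h • pathVec L)).reduced m x y =
      ∑ e ∈ E, (1 / 2) ^ h * (pathVec L (basisCells m x ∪ e) *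
        conj (pathVec L (basisCells m y ∪ e))) := by
    have hc : ∀ e, pureTape ((((√2 : ℝ) : ℂ))⁻¹ ^ h • pathVec L) (basisCells m x ∪ e)
        (basisCells m y ∪ e) = (1 / 2) ^ h * (pathVec L (basisCells m x ∪ e) *
        conj (pathVec L (basisCells m y ∪ e))) := by
      intro e
      have : ((((√2 : ℝ) : ℂ))⁻¹ ^ h) * ((((√2 : ℝ) : ℂ))⁻¹ ^ h) = (1 / 2) ^ h := by
        rw [← mul_pow, ← mul_inv, sqrt_two_sq]; norm_num
      simp only [pureTape, Pi.smul_apply, smul_eq_mul, star_mul', star_pow, star_inv₀]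
      rw [← this, show star ((√2 : ℝ) : ℂ) = ((√2 : ℝ) : ℂ) from Complex.conj_ofReal _]
      simp only [RCLike.star_def]
      ring
    rw [QTape.reduced]
    simp only [hc]
    refine finsum_mem_eq_sum_of_inter_support_eq
      (s := {e : TapeBasis | Disjoint e (Finset.Icc (1 : ℤ) m)}) _ ?_
    ext e
    simp only [Set.mem_inter_iff, Set.mem_ofPred_eq, Finset.mem_coe, and_congr_left_iff,
      Function.mem_support]
    intro hne
    refine ⟨fun hd => ?_, hEI e⟩
    have hne' : pathVec L (basisCells m x ∪ e) ≠ 0 := fun h0 => hne (by rw [h0]; simp)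
    have : ∃ t ∈ L, t.1.toFinset = basisCells m x ∪ e := by
      by_contra! hcon
      refine hne' (List.sum_eq_zero fun z hz => ?_)
      obtain ⟨t, ht, rfl⟩ := List.mem_map.1 hz
      rw [if_neg (hcon t ht)]
    obtain ⟨t, ht, hte⟩ := this
    rw [hE, List.mem_toFinset, List.mem_map]
    refine ⟨t, ht, ?_⟩
    rw [hte, Finset.union_sdiff_distrib, Finset.sdiff_eq_empty_iff_subset.2 (basisCells_subset m x),
      Finset.empty_union, Finset.sdiff_eq_self_of_disjoint hd]
  rw [h₁, ← Finset.mul_sum]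
  congr 1
  have h₂ : ∀ e, pathVec L (basisCells m x ∪ e) * conj (pathVec L (basisCells m y ∪ e)) =
      (L.map fun t => (L.map fun t' => if t.1.toFinset = basisCells m x ∪ e ∧
        t'.1.toFinset = basisCells m y ∪ e then omega8 ^ (t.2 + 7 * t'.2) else 0).sum).sum := by
    intro e
    simp only [pathVec]
    rw [← List.sum_map_mul_right]
    congr 1
    refine List.map_congr_left fun t _ => ?_
    rw [map_list_sum, List.map_map, ← List.sum_map_mul_left]
    congr 1
    refine List.map_congr_left fun t' _ => ?_
    by_cases h : t.1.toFinset = basisCells m x ∪ e <;>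
      by_cases h' : t'.1.toFinset = basisCells m y ∪ e <;>
      simp [h, h', pow_add, pow_mul, conj_omega8]
  simp only [h₂]
  rw [sum_listSum, pathPhases, List.map_flatMap, List.flatMap_def, List.sum_flatten, List.map_map]
  congr 1
  refine List.map_congr_left fun t ht => ?_
  rw [sum_listSum]
  simp only [Function.comp_apply, List.map_map]
  rw [sum_map_filter_eq]
  congr 1
  refine List.map_congr_left fun t' _ => ?_
  classical
  have h₃ : ∀ e ∈ E, (if t.1.toFinset = basisCells m x ∪ e ∧ t'.1.toFinset = basisCells m y ∪ e
      then omega8 ^ (t.2 + 7 * t'.2) else 0) = if e = t.1.toFinset \ I then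
        (if Contributes m x y t.1 t'.1 then omega8 ^ (t.2 + 7 * t'.2) else 0) else 0 := by
    intro e he
    rw [← ite_and]
    exact if_congr (contributes_iff (hEI e he)) rfl rfl
  rw [Finset.sum_congr rfl h₃, Finset.sum_ite_eq', if_pos]
  · simp
  · rw [hE, List.mem_toFinset, List.mem_map]
    exact ⟨t, ht, rfl⟩

end


/-! ## Path sums are primitive recursive -/

theorem Primrec.nat_pow' : Primrec₂ ((· ^ ·) : ℕ → ℕ → ℕ) :=
  Primrec₂.unpaired'.1 Nat.Primrec.pow

theorem Primrec.nat_testBit : Primrec₂ Nat.testBit := by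
  have h : Primrec₂ fun x i : ℕ => decide (x / 2 ^ i % 2 = 1) :=
    (Primrec.eq.comp (Primrec.nat_mod.comp (Primrec.nat_div.comp .fst
      (Primrec.nat_pow'.comp (.const 2) .snd)) (.const 2)) (.const 1)).decide
  exact h.of_eq fun x i => Nat.testBit_eq_decide_div_mod_eq.symm

theorem PrimrecRel.list_mem {α : Type} [Primcodable α] :
    PrimrecRel fun (a : α) (l : List α) => a ∈ l := by
  classical
  have h : PrimrecRel fun (l : List α) (a : α) => ∃ b ∈ l, b = a :=
    (Primrec.eq (α := α)).exists_mem_list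
  exact (h.swap).of_eq fun a l => by simp [Function.swap]

theorem PrimrecPred.iff {α : Type} [Primcodable α] {p q : α → Prop} (hp : PrimrecPred p)
    (hq : PrimrecPred q) : PrimrecPred fun a => p a ↔ q a :=
  ((hp.and hq).or (hp.not.and hq.not)).of_eq fun a => by tauto

theorem primrec_toggleCell : Primrec₂ toggleCell :=
  Primrec.ite (PrimrecRel.list_mem.comp .fst .snd)
    ((PrimrecRel.listFilter (R := fun a b : ℤ => a ≠ b) (Primrec.eq.not)).comp .snd .fst)
    (Primrec.list_cons.comp .fst .snd)

theorem primrec_pathStep : Primrec fun p : (QGate × ℤ) × List ℤ × ℕ => pathStep p.1.1 p.1.2 p.2 := by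
  have hg : ∀ g, PrimrecPred fun p : (QGate × ℤ) × List ℤ × ℕ => p.1.1 = g := fun g =>
    Primrec.eq.comp (Primrec.fst.comp .fst) (.const g)
  have hi : Primrec fun p : (QGate × ℤ) × List ℤ × ℕ => p.1.2 := Primrec.snd.comp .fst
  have hl : Primrec fun p : (QGate × ℤ) × List ℤ × ℕ => p.2.1 := Primrec.fst.comp .snd
  have hr : Primrec fun p : (QGate × ℤ) × List ℤ × ℕ => p.2.2 := Primrec.snd.comp .snd
  have hi' := Primrec.int_add_one.comp hi
  have hm := PrimrecRel.list_mem.comp hi hl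
  have hm' := PrimrecRel.list_mem.comp hi' hl
  have one : ∀ {f : (QGate × ℤ) × List ℤ × ℕ → List ℤ × ℕ}, Primrec f → Primrec fun p => [f p] :=
    fun h => Primrec.list_cons.comp h (.const [])
  have ph : ∀ k : ℕ, Primrec fun p : (QGate × ℤ) × List ℤ × ℕ =>
      if p.1.2 ∈ p.2.1 then p.2.2 + k else p.2.2 := fun k =>
    Primrec.ite hm (Primrec.nat_add.comp hr (.const k)) hr
  exact Primrec.ite (hg _)
      (Primrec.list_cons.comp (Primrec.pair (primrec_toggleCell.comp hi hl) hr)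
        (one (Primrec.pair hl (ph 4))))
    (Primrec.ite (hg _) (one (Primrec.pair hl (ph 2)))
    (Primrec.ite (hg _) (one (Primrec.pair hl (ph 1)))
    (Primrec.ite (hg _) (one (Primrec.pair (Primrec.ite (hm.iff hm') hl
        (primrec_toggleCell.comp hi (primrec_toggleCell.comp hi' hl))) hr))
    (Primrec.ite (hg _) (one (Primrec.pair (Primrec.ite hm
        (primrec_toggleCell.comp hi' hl) hl) hr))
    (one .snd)))))

theorem primrec_pathRun : Primrec pathRun := by
  refine Primrec.list_foldl (f := fun l : List (QGate × HeadMove) => l)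
    (g := fun _ => (([([], 0)], 0, 0) : List (List ℤ × ℕ) × ℕ × ℤ))
    (h := fun _ (p : (List (List ℤ × ℕ) × ℕ × ℤ) × QGate × HeadMove) =>
      (p.1.1.flatMap (pathStep p.2.1 p.1.2.2),
        if p.2.1 = .hadamard then p.1.2.1 + 1 else p.1.2.1, p.1.2.2 + p.2.2.toInt))
    .id (.const _) ?_
  have hc : Primrec fun q : List (QGate × HeadMove) ×
      ((List (List ℤ × ℕ) × ℕ × ℤ) × QGate × HeadMove) => q.2.1 := Primrec.fst.comp .snd
  have ha : Primrec fun q : List (QGate × HeadMove) ×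
      ((List (List ℤ × ℕ) × ℕ × ℤ) × QGate × HeadMove) => q.2.2 := Primrec.snd.comp .snd
  refine Primrec.pair (Primrec.list_flatMap (Primrec.fst.comp hc) ?_)
    (Primrec.pair (Primrec.ite (Primrec.eq.comp (Primrec.fst.comp ha) (.const _))
      (Primrec.succ.comp (Primrec.fst.comp (Primrec.snd.comp hc)))
      (Primrec.fst.comp (Primrec.snd.comp hc)))
      (Primrec.int_add_toInt.comp (Primrec.snd.comp (Primrec.snd.comp hc)) (Primrec.snd.comp ha)))
  exact primrec_pathStep.comp (Primrec.pair (Primrec.pair (Primrec.fst.comp (ha.comp .fst))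
    (Primrec.snd.comp (Primrec.snd.comp (hc.comp .fst)))) .snd)

theorem primrec_spells {α : Type} [Primcodable α] {m x : α → ℕ} {l : α → List ℤ} (hm : Primrec m)
    (hx : Primrec x) (hl : Primrec l) : PrimrecPred fun a => Spells (m a) (x a) (l a) := by
  refine PrimrecRel.ball_lt (R := fun i a => ((i : ℤ) + 1 ∈ l a ↔
    (x a).testBit (m a - (i + 1)) = true)) ?_ hm
  exact PrimrecPred.iff (PrimrecRel.list_mem.comp (Primrec.int_add_one.comp
    (Primrec.int_natCast.comp .fst)) (hl.comp .snd))
    (Primrec.eq.comp (Primrec.nat_testBit.comp (hx.comp .snd)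
      (Primrec.nat_sub.comp (hm.comp .snd) (Primrec.succ.comp .fst))) (.const true))

theorem primrec_contributes {α : Type} [Primcodable α] {m x y : α → ℕ} {l l' : α → List ℤ}
    (hm : Primrec m) (hx : Primrec x) (hy : Primrec y) (hl : Primrec l) (hl' : Primrec l') :
    PrimrecPred fun a => Contributes (m a) (x a) (y a) (l a) (l' a) := by
  refine (primrec_spells hm hx hl).and ((primrec_spells hm hy hl').and ?_)
  have h : PrimrecRel fun (z : ℤ) (a : α) => (∃ i < m a, z = (i : ℤ) + 1) ∨ (z ∈ l a ∧ z ∈ l' a) := by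
    refine PrimrecPred.or ?_ ((PrimrecRel.list_mem.comp .fst (hl.comp .snd)).and
      (PrimrecRel.list_mem.comp .fst (hl'.comp .snd)))
    have h₁ : PrimrecRel fun (i : ℕ) (p : ℤ × α) => p.1 ≠ (i : ℤ) + 1 :=
      PrimrecPred.not (Primrec.eq.comp (Primrec.fst.comp .snd)
        (Primrec.int_add_one.comp (Primrec.int_natCast.comp .fst)))
    exact (h₁.ball_lt (hm.comp .snd)).not.of_eq fun p => by push Not; rfl
  exact (h.forall_mem_list.comp (Primrec.list_append.comp hl hl') .id).of_eq fun a => by simp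

theorem primrec_pathPhases {α : Type} [Primcodable α] {L : α → List (List ℤ × ℕ)} {m x y : α → ℕ}
    (hL : Primrec L) (hm : Primrec m) (hx : Primrec x) (hy : Primrec y) :
    Primrec fun a => pathPhases (L a) (m a) (x a) (y a) := by
  classical
  refine Primrec.list_flatMap hL ?_
  have hR : PrimrecRel fun (t' : List ℤ × ℕ) (p : α × List ℤ × ℕ) =>
      Contributes (m p.1) (x p.1) (y p.1) p.2.1 t'.1 :=
    primrec_contributes (hm.comp (Primrec.fst.comp .snd)) (hx.comp (Primrec.fst.comp .snd))
      (hy.comp (Primrec.fst.comp .snd)) (Primrec.fst.comp (Primrec.snd.comp .snd))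
      (Primrec.fst.comp .fst)
  refine Primrec.list_map ((hR.listFilter.comp (hL.comp .fst) .id).of_eq fun p => ?_)
    (Primrec.nat_add.comp (Primrec.snd.comp (Primrec.snd.comp .fst))
      (Primrec.nat_mul.comp (.const 7) (Primrec.snd.comp .snd)))
  refine List.filter_congr fun t _ => ?_
  simp


/-! ## Codes of numbers and arrays -/

theorem primrec_natToStr : Primrec natToStr := by
  set f : ℕ × BitString → ℕ × BitString :=
    fun c => if c.1 = 0 then c else (c.1 / 2, c.2 ++ [decide (c.1 % 2 = 1)]) with hf
  have hfp : Primrec f :=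
    Primrec.ite (Primrec.eq.comp .fst (.const 0)) .id
      (Primrec.pair (Primrec.nat_div.comp .fst (.const 2)) (Primrec.list_append.comp .snd
        (Primrec.list_cons.comp (Primrec.eq.comp (Primrec.nat_mod.comp .fst (.const 2))
          (.const 1)).decide (.const []))))
  -- `n` halvings are enough to reach `0`, which `f` fixes, so surplus rounds do not matter.
  have key : ∀ k n, n ≤ k → ∀ acc, (f^[k] (n, acc)).2 = acc ++ n.bits := by
    intro k
    induction k with
    | zero => intro n hn acc; obtain rfl := Nat.le_zero.1 hn; simp
    | succ k ih =>
      intro n hn acc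
      rw [Function.iterate_succ_apply]
      by_cases h0 : n = 0
      · rw [show f (n, acc) = (n, acc) by simp [hf, h0]]
        exact ih n (by omega) acc
      · rw [show f (n, acc) = (n / 2, acc ++ [decide (n % 2 = 1)]) by simp [hf, h0],
          ih _ (by omega), List.append_assoc]
        congr 1
        have h1 := Nat.bit_bodd_div2 n
        conv_rhs => rw [← h1, Nat.bits_append_bit _ _ (fun h2 => by
          by_contra hb
          rw [h2, Bool.not_eq_true _ |>.mp hb] at h1
          exact h0 h1.symm)]
        rw [Nat.div2_val, List.singleton_append]
        congr 1
        rw [Nat.mod_two_of_bodd]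
        cases n.bodd <;> simp
  have h : Primrec fun n : ℕ => (f^[n] (n, [])).2 :=
    Primrec.snd.comp (Primrec.nat_iterate .id (Primrec.pair .id (.const [])) (hfp.comp .snd))
  exact h.of_eq fun n => by rw [key n n le_rfl, List.nil_append]; rfl

theorem primrec_strToNat : Primrec strToNat := by
  have h : Primrec₂ fun (_ : BitString) (p : Bool × ℕ) => (2 * p.2 + if p.1 = true then 1 else 0) :=
    Primrec.nat_add.comp (Primrec.nat_mul.comp (.const 2) (Primrec.snd.comp .snd))
      (Primrec.ite (Primrec.eq.comp (Primrec.fst.comp .snd) (.const true)) (.const 1) (.const 0))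
  refine (Primrec.list_foldr .id (.const 0) h).of_eq fun s => ?_
  rw [strToNat, id]
  congr 1
  funext b n
  rw [Nat.bit_val]
  cases b <;> rfl

theorem primrec_selfDelim : Primrec selfDelim := by
  have h : Primrec fun x : BitString => (List.range x.length).map (fun _ => true) ++ false :: x :=
    Primrec.list_append.comp (Primrec.list_map (Primrec.list_range.comp .list_length) (.const true))
      (Primrec.list_cons.comp (.const false) .id)
  exact h.of_eq fun x => by simp [selfDelim]

theorem primrec_strPair : Primrec₂ strPair :=
  Primrec.list_append.comp (primrec_selfDelim.comp .fst) .snd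

theorem primrec_strTuple : Primrec strTuple :=
  Primrec.list_flatMap .id (primrec_selfDelim.comp .snd)

/-- The first `0` ends the unary length, which tells where `x` ends. -/
theorem selfDelim_append_inj {x x' u u' : BitString} (h : selfDelim x ++ u = selfDelim x' ++ u') :
    x = x' ∧ u = u' := by
  have key : ∀ (a b : ℕ) (u v : BitString), List.replicate a true ++ false :: u =
      List.replicate b true ++ false :: v → a = b ∧ u = v := by
    intro a
    induction a with
    | zero =>
      intro b u v h
      cases b with
      | zero => simpa using h
      | succ b => simp [List.replicate_succ] at h
    | succ a ih =>
      intro b u v h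
      cases b with
      | zero => simp [List.replicate_succ] at h
      | succ b =>
        simp only [List.replicate_succ, List.cons_append, List.cons.injEq, true_and] at h
        obtain ⟨h₁, h₂⟩ := ih _ _ _ h
        exact ⟨by rw [h₁], h₂⟩
  simp only [selfDelim, List.append_assoc, List.cons_append] at h
  obtain ⟨h₁, h₂⟩ := key _ _ _ _ h
  exact List.append_inj h₂ h₁

theorem natToStr_injective : Function.Injective natToStr :=
  Function.LeftInverse.injective strToNat_natToStr

theorem strPair_injective {x x' y y' : BitString} (h : strPair x y = strPair x' y') :
    x = x' ∧ y = y' := selfDelim_append_inj h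

theorem strTuple_injective : Function.Injective strTuple := by
  have hne : ∀ x u, selfDelim x ++ u ≠ [] := fun x u => by simp [selfDelim]
  intro l
  induction l with
  | nil =>
    intro l' h
    cases l' with
    | nil => rfl
    | cons x l' => exact absurd h.symm (hne _ _)
  | cons x l ih =>
    intro l' h
    cases l' with
    | nil => exact absurd h (hne _ _)
    | cons x' l' =>
      obtain ⟨h₁, h₂⟩ := selfDelim_append_inj h
      rw [h₁, ih h₂]

/-- The data that represent a rational number: sign, numerator and denominator. -/
abbrev RatCode : Type := Bool × ℕ × ℕ

/-- The string of a rational number that is given by its data. -/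
def RatCode.toStr (c : RatCode) : BitString := strTuple [[c.1], natToStr c.2.1, natToStr c.2.2]

theorem RatCode.toStr_injective : Function.Injective RatCode.toStr := by
  rintro ⟨s, a, d⟩ ⟨s', a', d'⟩ h
  have := strTuple_injective h
  simp only [List.cons.injEq, and_true] at this
  obtain ⟨h₁, h₂, h₃⟩ := this
  rw [h₁, natToStr_injective h₂, natToStr_injective h₃]

/-- The data of a rational number. -/
def ratCode (q : ℚ) : RatCode := (decide (q < 0), q.num.natAbs, q.den)

/-- The string of an array of complex numbers. -/
def rowsToStr (rows : List (List (RatCode × RatCode))) : BitString :=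
  strTuple (rows.map fun r => strTuple (r.map fun e => strTuple [e.1.toStr, e.2.toStr]))

theorem rowsToStr_injective : Function.Injective rowsToStr := by
  intro r r' h
  refine List.map_injective_iff.2 (fun l l' h => ?_) (strTuple_injective h)
  refine List.map_injective_iff.2 (fun e e' h => ?_) (strTuple_injective h)
  have := strTuple_injective h
  simp only [List.cons.injEq, and_true] at this
  exact Prod.ext (RatCode.toStr_injective this.1) (RatCode.toStr_injective this.2)

theorem rowsToStr_ofFn {N : ℕ} (A : Matrix (Fin N) (Fin N) (ℚ × ℚ)) :
    rowsToStr (List.ofFn fun i => List.ofFn fun j => (ratCode (A i j).1, ratCode (A i j).2)) =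
      matToStr A := by
  simp only [rowsToStr, matToStr, List.map_ofFn]
  congr 2
  funext i
  simp only [Function.comp_apply, List.map_ofFn]
  rfl

theorem primrec_ratCode_toStr : Primrec RatCode.toStr :=
  primrec_strTuple.comp (Primrec.list_cons.comp (Primrec.list_cons.comp .fst (.const []))
    (Primrec.list_cons.comp (primrec_natToStr.comp (Primrec.fst.comp .snd))
      (Primrec.list_cons.comp (primrec_natToStr.comp (Primrec.snd.comp .snd)) (.const []))))

theorem primrec_rowsToStr : Primrec rowsToStr :=
  primrec_strTuple.comp (Primrec.list_map .id (primrec_strTuple.comp (Primrec.list_map .snd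
    (primrec_strTuple.comp (Primrec.list_cons.comp
      (primrec_ratCode_toStr.comp (Primrec.fst.comp .snd))
      (Primrec.list_cons.comp (primrec_ratCode_toStr.comp (Primrec.snd.comp .snd)) (.const [])))))))

/-! ### Fractions with natural number data -/

/-- Fractions `(p - q) / d` of natural numbers `p`, `q`, `d`. -/
abbrev Frac : Type := ℕ × ℕ × ℕ

noncomputable def Frac.val (f : Frac) : ℝ := ((f.1 : ℝ) - f.2.1) / f.2.2

/-- The fraction of a rational number that is given by its data. -/
def RatCode.toFrac (c : RatCode) : Frac :=
  (if c.1 = true then 0 else c.2.1, if c.1 = true then c.2.1 else 0, c.2.2)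

theorem val_toFrac_ratCode (q : ℚ) : (ratCode q).toFrac.val = q := by
  have h : (q : ℝ) = (q.num : ℝ) / q.den := by exact_mod_cast (Rat.num_div_den q).symm
  rw [h]
  by_cases hq : q < 0
  · have hn : q.num < 0 := Rat.num_neg.2 hq
    have : ((q.num.natAbs : ℤ) : ℝ) = -(q.num : ℝ) := by
      rw [Int.ofNat_natAbs_of_nonpos hn.le]; push_cast; rfl
    rw [Int.cast_natCast] at this
    simp [ratCode, RatCode.toFrac, Frac.val, hq, this]
  · have hn : 0 ≤ q.num := Rat.num_nonneg.2 (not_lt.1 hq)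
    have : ((q.num.natAbs : ℤ) : ℝ) = (q.num : ℝ) := by
      rw [Int.natAbs_of_nonneg hn]
    rw [Int.cast_natCast] at this
    simp [ratCode, RatCode.toFrac, Frac.val, hq, this]

theorem den_ratCode_pos (q : ℚ) : 0 < (ratCode q).toFrac.2.2 := q.den_pos

/-- The data of a fraction, if it is in lowest terms. -/
def Frac.toCode (f : Frac) : RatCode :=
  (decide (f.1 < f.2.1), if f.1 < f.2.1 then f.2.1 - f.1 else f.1 - f.2.1, f.2.2)

/-- The numerator is odd and the denominator is a power of two, so the fraction is in lowest terms,
and its code can be written down without a greatest common divisor. -/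
theorem ratCode_of_dyadic (P Q k : ℕ) :
    ratCode (((2 * P + 1 : ℕ) - (2 * Q : ℕ) : ℤ) / ((2 ^ k : ℕ) : ℤ) : ℚ) =
      Frac.toCode (2 * P + 1, 2 * Q, 2 ^ k) := by
  set z : ℤ := ((2 * P + 1 : ℕ) - (2 * Q : ℕ) : ℤ) with hz
  have hz' : z = 2 * P + 1 - 2 * Q := by rw [hz]; push_cast; ring
  have hpos : (0 : ℤ) < ((2 ^ k : ℕ) : ℤ) := by positivity
  have hc : Nat.Coprime z.natAbs ((2 ^ k : ℕ) : ℤ).natAbs := by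
    rw [Int.natAbs_natCast]
    refine Nat.Coprime.pow_right k ?_
    rw [Nat.coprime_two_right, Nat.odd_iff]
    omega
  have hnum := Rat.num_div_eq_of_coprime hpos hc
  have hden := Rat.den_div_eq_of_coprime hpos hc
  have hneg : ((z : ℚ) / (((2 ^ k : ℕ) : ℤ) : ℚ) < 0) ↔ 2 * P + 1 < 2 * Q := by
    rw [← Rat.num_neg, hnum]
    omega
  have hden' : ((z : ℚ) / (((2 ^ k : ℕ) : ℤ) : ℚ)).den = 2 ^ k := by exact_mod_cast hden
  rw [ratCode, hnum, hden', Frac.toCode]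
  refine Prod.ext (decide_eq_decide.2 hneg) (Prod.ext ?_ rfl)
  simp only
  split_ifs <;> omega

theorem primrec_toFrac : Primrec RatCode.toFrac := by
  have h : PrimrecPred fun c : RatCode => c.1 = true := Primrec.eq.comp .fst (.const true)
  exact Primrec.pair (Primrec.ite h (.const 0) (Primrec.fst.comp .snd))
    (Primrec.pair (Primrec.ite h (Primrec.fst.comp .snd) (.const 0)) (Primrec.snd.comp .snd))

theorem primrec_toCode : Primrec Frac.toCode := by
  have h : PrimrecPred fun f : Frac => f.1 < f.2.1 :=
    Primrec.nat_lt.comp .fst (Primrec.fst.comp .snd)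
  exact Primrec.pair h.decide (Primrec.pair (Primrec.ite h
    (Primrec.nat_sub.comp (Primrec.fst.comp .snd) .fst)
    (Primrec.nat_sub.comp .fst (Primrec.fst.comp .snd))) (Primrec.snd.comp .snd))

/-- The fractions `f` and `g` differ by at most `3 / K`. -/
def Frac.Near (K : ℕ) (f g : Frac) : Prop :=
  K * (f.1 * g.2.2 + g.2.1 * f.2.2) ≤ 3 * (f.2.2 * g.2.2) + K * (f.2.1 * g.2.2 + g.1 * f.2.2) ∧
    K * (f.2.1 * g.2.2 + g.1 * f.2.2) ≤ 3 * (f.2.2 * g.2.2) + K * (f.1 * g.2.2 + g.2.1 * f.2.2)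

/-- `Near` is the inequality after cross-multiplication, with negative terms moved to the other
side, so that natural arithmetic decides it. -/
theorem Frac.near_iff {K : ℕ} (hK : 0 < K) {f g : Frac} (hf : 0 < f.2.2) (hg : 0 < g.2.2) :
    f.Near K g ↔ |f.val - g.val| ≤ 3 / K := by
  obtain ⟨p, q, d⟩ := f
  obtain ⟨p', q', d'⟩ := g
  simp only [Frac.Near, Frac.val] at *
  have hd : (0 : ℝ) < d := by exact_mod_cast hf
  have hd' : (0 : ℝ) < d' := by exact_mod_cast hg
  have hK' : (0 : ℝ) < K := by exact_mod_cast hK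
  have e : ((p : ℝ) - q) / d - ((p' : ℝ) - q') / d' =
      ((p * d' + q' * d) - (q * d' + p' * d)) / (d * d') := by
    field_simp
    ring
  rw [e, abs_div, abs_of_pos (mul_pos hd hd'), div_le_div_iff₀ (mul_pos hd hd') hK',
    show ∀ x : ℝ, |x| * K = |x * K| from fun x => by rw [abs_mul, abs_of_pos hK'], abs_le,
    ← Nat.cast_le (α := ℝ), ← Nat.cast_le (α := ℝ)]
  push_cast
  constructor
  · rintro ⟨h₁, h₂⟩
    constructor <;> nlinarith [h₁, h₂]
  · rintro ⟨h₁, h₂⟩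
    constructor <;> nlinarith [h₁, h₂]

theorem primrec_near {α : Type} [Primcodable α] {K : α → ℕ} {f g : α → Frac} (hK : Primrec K)
    (hf : Primrec f) (hg : Primrec g) : PrimrecPred fun a => (f a).Near (K a) (g a) := by
  have p := Primrec.fst.comp hf
  have q := Primrec.fst.comp (Primrec.snd.comp hf)
  have d := Primrec.snd.comp (Primrec.snd.comp hf)
  have p' := Primrec.fst.comp hg
  have q' := Primrec.fst.comp (Primrec.snd.comp hg)
  have d' := Primrec.snd.comp (Primrec.snd.comp hg)
  have x := Primrec.nat_mul.comp hK (Primrec.nat_add.comp (Primrec.nat_mul.comp p d')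
    (Primrec.nat_mul.comp q' d))
  have y := Primrec.nat_mul.comp hK (Primrec.nat_add.comp (Primrec.nat_mul.comp q d')
    (Primrec.nat_mul.comp p' d))
  have z := Primrec.nat_mul.comp (.const 3) (Primrec.nat_mul.comp d d')
  exact (Primrec.nat_le.comp x (Primrec.nat_add.comp z y)).and
    (Primrec.nat_le.comp y (Primrec.nat_add.comp z x))

section
open scoped ComplexConjugate

/-! ## Rational approximations of density matrices -/

/-- Approximation of the positive part of `2 ^ M * cos (s π / 4)`. -/
def cosApprox (M s : ℕ) : ℕ :=
  if s % 8 = 0 then 2 ^ M else if s % 8 = 1 ∨ s % 8 = 7 then Nat.sqrt (4 ^ M / 2) else 0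

theorem abs_sqrt_sub_le (M : ℕ) :
    |2 ^ M * (√2 / 2) - (Nat.sqrt (4 ^ M / 2) : ℝ)| ≤ 1 := by
  set k := 4 ^ M / 2 with hk
  have h₁ : (Nat.sqrt k) ^ 2 ≤ k := Nat.sqrt_le' k
  have h₂ : k < (Nat.sqrt k + 1) ^ 2 := Nat.lt_succ_sqrt' k
  have h₃ : 2 * k ≤ 4 ^ M ∧ 4 ^ M < 2 * (k + 1) := by omega
  have h₄ : (2 * (Nat.sqrt k : ℝ) ^ 2) ≤ 4 ^ M := by
    have : 2 * (Nat.sqrt k) ^ 2 ≤ 4 ^ M := by omega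
    exact_mod_cast this
  have h₅ : (4 : ℝ) ^ M ≤ 2 * ((Nat.sqrt k : ℝ) + 1) ^ 2 := by
    have : 4 ^ M ≤ 2 * (Nat.sqrt k + 1) ^ 2 := by omega
    exact_mod_cast this
  have hs : (2 ^ M * (√2 / 2)) ^ 2 * 2 = (4 : ℝ) ^ M := by
    rw [mul_pow, div_pow, Real.sq_sqrt (by norm_num), ← pow_mul, mul_comm M 2, pow_mul]
    norm_num
    ring
  have hp : (0 : ℝ) ≤ 2 ^ M * (√2 / 2) := by positivity
  have hn : (0 : ℝ) ≤ Nat.sqrt k := Nat.cast_nonneg _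
  have h₆ : (Nat.sqrt k : ℝ) ≤ 2 ^ M * (√2 / 2) :=
    le_of_sq_le_sq (by linarith) hp
  have h₇ : 2 ^ M * (√2 / 2) ≤ (Nat.sqrt k : ℝ) + 1 :=
    le_of_sq_le_sq (by linarith) (by linarith)
  rw [abs_le]
  constructor <;> linarith

theorem omega8_pow_mod (s : ℕ) : omega8 ^ s = omega8 ^ (s % 8) := by
  conv_lhs => rw [← Nat.mod_add_div s 8, pow_add, pow_mul, omega8_pow_eight, one_pow, mul_one]

theorem cosApprox_mod (M s : ℕ) : cosApprox M s = cosApprox M (s % 8) := by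
  simp [cosApprox]

/-- The shift by `4` is a change of sign, so the two terms approximate the positive and the negative
part of the cosine. -/
theorem abs_re_omega8_sub_le (M s : ℕ) :
    |2 ^ M * (omega8 ^ s).re - ((cosApprox M s : ℝ) - cosApprox M (s + 4))| ≤ 1 := by
  have h2 := abs_sqrt_sub_le M
  have hre : omega8.re = √2 / 2 := by rw [omega8_eq]; simp
  have him : omega8.im = √2 / 2 := by rw [omega8_eq]; simp
  have h3 : (omega8 ^ 3).re = -(√2 / 2) := by
    rw [show 3 = 2 + 1 from rfl, pow_succ, omega8_sq, Complex.I_mul_re, him]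
  rw [omega8_pow_mod, cosApprox_mod M s, cosApprox_mod M (s + 4), Nat.add_mod]
  have : s % 8 < 8 := Nat.mod_lt _ (by norm_num)
  generalize s % 8 = r at *
  interval_cases r
  · simp [cosApprox]
  · simpa [cosApprox, hre] using h2
  · simp [cosApprox, omega8_sq]
  · rw [h3]
    rw [← abs_neg] at h2
    refine (le_of_eq ?_).trans h2
    congr 1
    simp [cosApprox]
    ring
  · simp [cosApprox, omega8_pow_four]
  · rw [show 5 = 4 + 1 from rfl, pow_add, omega8_pow_four, pow_one]
    rw [← abs_neg] at h2
    refine (le_of_eq ?_).trans h2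
    congr 1
    simp [cosApprox, hre]
    ring
  · rw [show 6 = 4 + 2 from rfl, pow_add, omega8_pow_four, omega8_sq]
    simp [cosApprox]
  · rw [show 7 = 4 + 3 from rfl, pow_add, omega8_pow_four, neg_one_mul, Complex.neg_re, h3, neg_neg]
    simpa [cosApprox] using h2

/-- The sum of the approximations for the list `E` of exponents, with the phase shift `k`. -/
def phaseSum (M k : ℕ) (E : List ℕ) : ℕ := (E.map fun s => cosApprox M (s + k)).sum

theorem abs_re_sum_sub_le (M k : ℕ) (E : List ℕ) :
    |2 ^ M * (E.map fun s => omega8 ^ (s + k)).sum.re - ((phaseSum M k E : ℝ) - phaseSum M (k + 4) E)|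
      ≤ E.length := by
  induction E with
  | nil => simp [phaseSum]
  | cons s E ih =>
    have h := abs_re_omega8_sub_le M (s + k)
    simp only [phaseSum, List.map_cons, List.sum_cons, Complex.add_re, Nat.cast_add,
      List.length_cons, Nat.cast_one] at ih ⊢
    rw [← add_assoc s k 4]
    rw [abs_le] at *
    constructor <;> linarith

/-- A fraction that approximates `2⁻ʰ` times the real part of the sum of the phase factors. -/
def approxFrac (j h k : ℕ) (E : List ℕ) : Frac :=
  (2 * phaseSum (E.length + j + 1) k E + 1, 2 * phaseSum (E.length + j + 1) (k + 4) E,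
    2 ^ (E.length + j + 1 + h + 1))

/-- Each of the `n` phases is scaled by `2^(n + j + 1)` and rounded with an error of at most `1`.
Doubling the numerator and adding `1`, which makes it odd, leaves a total error of at most `(2 n +
1) / 2^(n + j + h + 2)`. -/
theorem abs_sub_approxFrac_le (j h k : ℕ) (E : List ℕ) :
    |((1 / 2) ^ h * (E.map fun s => omega8 ^ (s + k)).sum).re - (approxFrac j h k E).val| ≤
      1 / 2 ^ j := by
  have h₁ := abs_re_sum_sub_le (E.length + j + 1) k E
  have h₂ : (E.length : ℝ) ≤ 2 ^ E.length := by exact_mod_cast Nat.lt_two_pow_self.le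
  have h₃ : ((1 / 2) ^ h * (E.map fun s => omega8 ^ (s + k)).sum).re =
      (1 / 2) ^ h * (E.map fun s => omega8 ^ (s + k)).sum.re := by
    rw [show ((1 / 2 : ℂ) ^ h) = (((1 / 2 : ℝ) ^ h : ℝ) : ℂ) by push_cast; rfl,
      Complex.re_ofReal_mul]
  rw [h₃]
  simp only [approxFrac, Frac.val]
  generalize (E.map fun s => omega8 ^ (s + k)).sum.re = S at *
  generalize phaseSum (E.length + j + 1) k E = P at *
  generalize phaseSum (E.length + j + 1) (k + 4) E = Q at *
  generalize E.length = n at *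
  push_cast
  have hH : (0 : ℝ) < 2 ^ h := by positivity
  have hH1 : (1 : ℝ) ≤ 2 ^ h := one_le_pow₀ (by norm_num)
  have hN : (0 : ℝ) < 2 ^ n := by positivity
  have hN1 : (1 : ℝ) ≤ 2 ^ n := one_le_pow₀ (by norm_num)
  have hJ : (0 : ℝ) < 2 ^ j := by positivity
  have e : (1 / 2 : ℝ) ^ h * S - (2 * P + 1 - 2 * Q) / 2 ^ (n + j + 1 + h + 1) =
      (2 * (2 ^ (n + j + 1) * S - (P - Q)) - 1) / (4 * (2 ^ n * 2 ^ j * 2 ^ h)) := by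
    rw [one_div, inv_pow]
    simp only [pow_add, pow_one]
    field_simp
    ring
  rw [e, abs_div, abs_of_pos (show (0 : ℝ) < 4 * (2 ^ n * 2 ^ j * 2 ^ h) by positivity),
    div_le_div_iff₀ (by positivity) hJ]
  have h₄ : |2 * (2 ^ (n + j + 1) * S - ((P : ℝ) - Q)) - 1| ≤ 2 * 2 ^ n + 1 := by
    rw [abs_le] at h₁ ⊢
    constructor <;> linarith
  have h₅ : (2 : ℝ) * 2 ^ n + 1 ≤ 4 * (2 ^ n * 2 ^ h) := by nlinarith
  calc _ ≤ (2 * 2 ^ n + 1) * (2 : ℝ) ^ j := mul_le_mul_of_nonneg_right h₄ hJ.le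
    _ ≤ 4 * (2 ^ n * 2 ^ h) * 2 ^ j := mul_le_mul_of_nonneg_right h₅ hJ.le
    _ = _ := by ring

/-- Approximations of the real and the imaginary part of an entry of the reduced density matrix
after a sequence of gates. -/
noncomputable def entryFrac (l : List (QGate × HeadMove)) (j m x y : ℕ) : Frac × Frac :=
  (approxFrac j (pathRun l).2.1 0 (pathPhases (pathRun l).1 m x y),
    approxFrac j (pathRun l).2.1 6 (pathPhases (pathRun l).1 m x y))

theorem abs_sub_entryFrac_le (l : List (QGate × HeadMove)) (j m : ℕ) (x y : Fin (2 ^ m)) :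
    |((quantumRun l (QTape.ofState QState.empty, 0)).1.reduced m x y).re -
        (entryFrac l j m x y).1.val| ≤ 1 / 2 ^ j ∧
      |((quantumRun l (QTape.ofState QState.empty, 0)).1.reduced m x y).im -
        (entryFrac l j m x y).2.val| ≤ 1 / 2 ^ j := by
  rw [ofState_empty, quantumRun_pureTape, vecRun_eq_pathRun, reduced_pathVec]
  refine ⟨abs_sub_approxFrac_le j _ 0 _, ?_⟩
  -- The phase shift by `6` multiplies by `-i`, and so makes the imaginary part a real part.
  refine (le_of_eq ?_).trans
    (abs_sub_approxFrac_le j (pathRun l).2.1 6 (pathPhases (pathRun l).1 m x y))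
  congr 2
  have e : ∀ E : List ℕ, (E.map fun s => omega8 ^ (s + 6)).sum =
      -Complex.I * (E.map (omega8 ^ ·)).sum := by
    intro E
    rw [← List.sum_map_mul_left]
    congr 1
    refine List.map_congr_left fun s _ => ?_
    rw [pow_add, show 6 = 4 + 2 from rfl, pow_add, omega8_pow_four, omega8_sq]
    ring
  rw [e, mul_left_comm, neg_mul, Complex.neg_re, Complex.I_mul_re, neg_neg]

theorem den_entryFrac_pos (l : List (QGate × HeadMove)) (j m x y : ℕ) :
    0 < (entryFrac l j m x y).1.2.2 ∧ 0 < (entryFrac l j m x y).2.2.2 :=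
  ⟨Nat.two_pow_pos _, Nat.two_pow_pos _⟩

theorem exists_ratCode_approxFrac (j h k : ℕ) (E : List ℕ) :
    ∃ q : ℚ, ratCode q = (approxFrac j h k E).toCode ∧ (q : ℝ) = (approxFrac j h k E).val := by
  refine ⟨_, ratCode_of_dyadic _ _ _, ?_⟩
  simp only [approxFrac, Frac.val]
  push_cast
  rfl

theorem primrec_cosApprox : Primrec₂ cosApprox := by
  have h : Primrec fun p : ℕ × ℕ => p.2 % 8 := Primrec.nat_mod.comp .snd (.const 8)
  exact Primrec.ite (Primrec.eq.comp h (.const 0)) (Primrec.nat_pow'.comp (.const 2) .fst)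
    (Primrec.ite ((Primrec.eq.comp h (.const 1)).or (Primrec.eq.comp h (.const 7)))
      (Primrec.nat_sqrt.comp (Primrec.nat_div.comp (Primrec.nat_pow'.comp (.const 4) .fst)
        (.const 2))) (.const 0))

theorem primrec_list_sum : Primrec (List.sum : List ℕ → ℕ) :=
  (Primrec.list_foldr (h := fun _ p => p.1 + p.2) .id (.const 0)
    (Primrec.nat_add.comp (Primrec.fst.comp .snd) (Primrec.snd.comp .snd))).of_eq fun l => by
      rw [List.sum_eq_foldr]; rfl

theorem primrec_phaseSum {α : Type} [Primcodable α] {M : α → ℕ} {E : α → List ℕ} (hM : Primrec M)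
    (k : ℕ) (hE : Primrec E) : Primrec fun a => phaseSum (M a) k (E a) :=
  primrec_list_sum.comp (Primrec.list_map hE (primrec_cosApprox.comp (hM.comp .fst)
    (Primrec.nat_add.comp .snd (.const k))))

theorem primrec_approxFrac {α : Type} [Primcodable α] {j h : α → ℕ} {E : α → List ℕ}
    (hj : Primrec j) (hh : Primrec h) (k : ℕ) (hE : Primrec E) :
    Primrec fun a => approxFrac (j a) (h a) k (E a) := by
  have hM : Primrec fun a => (E a).length + j a + 1 :=
    Primrec.succ.comp (Primrec.nat_add.comp (Primrec.list_length.comp hE) hj)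
  exact Primrec.pair (Primrec.succ.comp (Primrec.nat_mul.comp (.const 2)
      (primrec_phaseSum hM k hE)))
    (Primrec.pair (Primrec.nat_mul.comp (.const 2) (primrec_phaseSum hM (k + 4) hE))
      (Primrec.nat_pow'.comp (.const 2) (Primrec.succ.comp (Primrec.nat_add.comp hM hh))))

theorem primrec_entryFrac {α : Type} [Primcodable α] {l : α → List (QGate × HeadMove)}
    {j m x y : α → ℕ} (hl : Primrec l) (hj : Primrec j) (hm : Primrec m) (hx : Primrec x)
    (hy : Primrec y) : Primrec fun a => entryFrac (l a) (j a) (m a) (x a) (y a) := by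
  have hL := primrec_pathRun.comp hl
  have hE := primrec_pathPhases (Primrec.fst.comp hL) hm hx hy
  have hh := Primrec.fst.comp (Primrec.snd.comp hL)
  exact Primrec.pair (primrec_approxFrac hj hh 0 hE) (primrec_approxFrac hj hh 6 hE)

end

section
open scoped ComplexConjugate

/-! ## Trace distance and entries -/

theorem sum_eigenvalues_conjTranspose_mul_self {N : ℕ} (A : Matrix (Fin N) (Fin N) ℂ) :
    ∑ i, (Matrix.isHermitian_conjTranspose_mul_self A).eigenvalues i = ∑ i, ∑ j, ‖A i j‖ ^ 2 := by
  have h₁ := (Matrix.isHermitian_conjTranspose_mul_self A).trace_eq_sum_eigenvalues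
  have h₂ : (A.conjTranspose * A).trace = ((∑ i, ∑ j, ‖A i j‖ ^ 2 : ℝ) : ℂ) := by
    rw [Matrix.trace, Finset.sum_comm]
    push_cast
    refine Finset.sum_congr rfl fun j _ => ?_
    rw [Matrix.diag_apply, Matrix.mul_apply]
    refine Finset.sum_congr rfl fun i _ => ?_
    rw [Matrix.conjTranspose_apply, ← Complex.conj_mul']
    rfl
  rw [h₂] at h₁
  refine Complex.ofReal_injective (Eq.trans ?_ h₁.symm)
  push_cast
  rfl

/-- An entry is bounded by the Frobenius norm, the `ℓ²` norm of the singular values, and this by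
their `ℓ¹` norm. -/
theorem norm_entry_le_traceDist {N : ℕ} (A B : Matrix (Fin N) (Fin N) ℂ) (x y : Fin N) :
    ‖A x y - B x y‖ ≤ 2 * traceDist A B := by
  have h := sum_eigenvalues_conjTranspose_mul_self (A - B)
  set e := (Matrix.isHermitian_conjTranspose_mul_self (A - B)).eigenvalues with he
  have hpos : ∀ i, 0 ≤ e i := Matrix.eigenvalues_conjTranspose_mul_self_nonneg (A - B)
  have hD : 2 * traceDist A B = ∑ i, √(e i) := by rw [traceDist]; ring
  rw [hD]
  have h₁ : ‖A x y - B x y‖ ^ 2 ≤ ∑ i, e i := by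
    rw [h]
    calc ‖A x y - B x y‖ ^ 2 = ‖(A - B) x y‖ ^ 2 := rfl
      _ ≤ ∑ j, ‖(A - B) x j‖ ^ 2 := Finset.single_le_sum (f := fun j => ‖(A - B) x j‖ ^ 2)
        (fun _ _ => by positivity) (Finset.mem_univ y)
      _ ≤ _ := Finset.single_le_sum (f := fun i => ∑ j, ‖(A - B) i j‖ ^ 2)
        (fun _ _ => by positivity) (Finset.mem_univ x)
  have h₂ : ∑ i, e i ≤ (∑ i, √(e i)) ^ 2 := by
    calc ∑ i, e i = ∑ i, √(e i) ^ 2 := Finset.sum_congr rfl fun i _ => (Real.sq_sqrt (hpos i)).symm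
      _ ≤ _ := Finset.sum_sq_le_sq_sum_of_nonneg fun i _ => Real.sqrt_nonneg _
  exact le_of_sq_le_sq (h₁.trans h₂) (Finset.sum_nonneg fun i _ => Real.sqrt_nonneg _)

/-- Each of the `N` singular values is at most the Frobenius norm, which is at most `N δ`. -/
theorem traceDist_le_of_entries {N : ℕ} {A B : Matrix (Fin N) (Fin N) ℂ} {δ : ℝ} (hδ : 0 ≤ δ)
    (h : ∀ x y, ‖A x y - B x y‖ ≤ δ) : traceDist A B ≤ N ^ 2 * δ / 2 := by
  have h₁ := sum_eigenvalues_conjTranspose_mul_self (A - B)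
  rw [traceDist]
  set e := (Matrix.isHermitian_conjTranspose_mul_self (A - B)).eigenvalues with he
  have hpos : ∀ i, 0 ≤ e i := Matrix.eigenvalues_conjTranspose_mul_self_nonneg (A - B)
  have h₂ : ∑ i, ∑ j, ‖(A - B) i j‖ ^ 2 ≤ (N * δ) ^ 2 := by
    calc ∑ i, ∑ j, ‖(A - B) i j‖ ^ 2 ≤ ∑ _i : Fin N, ∑ _j : Fin N, δ ^ 2 :=
          Finset.sum_le_sum fun i _ => Finset.sum_le_sum fun j _ =>
            pow_le_pow_left₀ (norm_nonneg _) (h i j) 2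
      _ = (N * δ) ^ 2 := by simp; ring
  have h₃ : ∀ i, √(e i) ≤ N * δ := by
    intro i
    refine Real.sqrt_le_iff.2 ⟨by positivity, ?_⟩
    exact (Finset.single_le_sum (fun i _ => hpos i) (Finset.mem_univ i)).trans (h₁.trans_le h₂)
  have h₄ : ∑ i, √(e i) ≤ N * (N * δ) := by
    calc ∑ i, √(e i) ≤ ∑ _i : Fin N, (N * δ) := Finset.sum_le_sum fun i _ => h₃ i
      _ = N * (N * δ) := by simp
  nlinarith

end


/-! ## Simulations -/

theorem ofFn_eq_map_range {α : Type*} {N : ℕ} (f : ℕ → α) :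
    (List.ofFn fun i : Fin N => f i) = (List.range N).map f := by
  refine List.ext_getElem (by simp) fun i h₁ h₂ => by simp

theorem getD_ofFn {α : Type*} {N : ℕ} (f : Fin N → α) (x : Fin N) (d : α) :
    (List.ofFn f).getD x d = f x := by
  simp [List.getD]

theorem two_mul_le_two_pow (k : ℕ) : 2 * (k : ℝ) ≤ 2 ^ (2 * k) := by
  exact_mod_cast (Nat.lt_two_pow_self (n := 2 * k)).le

/-- The entries of a state can be computed from approximations of the state by a dcq-TM. -/
theorem ClassicalTM.exists_of_dcq (U : DcqTM) : ∃ T : ClassicalTM, ∀ (n : ℕ) (ρ : QState n)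
    (p : BitString),
    (∀ k : ℕ, 1 ≤ k → ∃ (y : BitString) (σ : Matrix (Fin (2 ^ n)) (Fin (2 ^ n)) ℂ),
      U.Outputs (strPair p (natToStr k)) QState.empty y n σ ∧ traceDist σ ρ.mat ≤ 1 / (k : ℝ)) →
    ∀ k : ℕ, 1 ≤ k → ∃ B : Matrix (Fin (2 ^ n)) (Fin (2 ^ n)) (ℚ × ℚ),
      T.Outputs (strPair p (natToStr k)) (matToStr B) ∧
      ∀ i j, |(ρ.mat i j).re - ((B i j).1 : ℝ)| ≤ 1 / (k : ℝ) ∧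
        |(ρ.mat i j).im - ((B i j).2 : ℝ)| ≤ 1 / (k : ℝ) := by
  obtain ⟨P, g, hP, hg, hU⟩ := U.exists_primrec_outputs
  let R : BitString → (BitString × ℕ) × ℕ × BitString × BitString → Prop := fun z c =>
    z = strPair c.1.1 (natToStr c.1.2) ∧
      P (strPair c.1.1 (natToStr (4 * c.1.2)), c.2.1, c.2.2.1, c.2.2.2)
  let gates : (BitString × ℕ) × ℕ × BitString × BitString → List (QGate × HeadMove) := fun c =>
    g (strPair c.1.1 (natToStr (4 * c.1.2))) c.2.1
  let o : (BitString × ℕ) × ℕ × BitString × BitString → BitString := fun c =>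
    rowsToStr ((List.range (2 ^ strToNat c.2.2.2)).map fun x =>
      (List.range (2 ^ strToNat c.2.2.2)).map fun y =>
        ((entryFrac (gates c) (2 * c.1.2) (strToNat c.2.2.2) x y).1.toCode,
          (entryFrac (gates c) (2 * c.1.2) (strToNat c.2.2.2) x y).2.toCode))
  have hin : Primrec fun c : (BitString × ℕ) × ℕ × BitString × BitString =>
      strPair c.1.1 (natToStr (4 * c.1.2)) :=
    primrec_strPair.comp (Primrec.fst.comp .fst) (primrec_natToStr.comp
      (Primrec.nat_mul.comp (.const 4) (Primrec.snd.comp .fst)))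
  have hR : PrimrecRel R :=
    (Primrec.eq.comp .fst (primrec_strPair.comp (Primrec.fst.comp (Primrec.fst.comp .snd))
      (primrec_natToStr.comp (Primrec.snd.comp (Primrec.fst.comp .snd))))).and
    (hP.comp (Primrec.pair (hin.comp .snd) (Primrec.snd.comp .snd)))
  have hgates : Primrec gates := hg.comp hin (Primrec.fst.comp .snd)
  have hn : Primrec fun c : (BitString × ℕ) × ℕ × BitString × BitString => strToNat c.2.2.2 :=
    primrec_strToNat.comp (Primrec.snd.comp (Primrec.snd.comp .snd))
  have hrange := Primrec.list_range.comp (Primrec.nat_pow'.comp (.const 2) hn)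
  have ho : Primrec o := by
    refine primrec_rowsToStr.comp (Primrec.list_map hrange
      (Primrec.list_map (hrange.comp .fst) ?_))
    have he : Primrec fun q : (((BitString × ℕ) × ℕ × BitString × BitString) × ℕ) × ℕ =>
        entryFrac (gates q.1.1) (2 * q.1.1.1.2) (strToNat q.1.1.2.2.2) q.1.2 q.2 :=
      primrec_entryFrac (hgates.comp (Primrec.fst.comp .fst))
        (Primrec.nat_mul.comp (.const 2) (Primrec.snd.comp (Primrec.fst.comp
          (Primrec.fst.comp .fst)))) (hn.comp (Primrec.fst.comp .fst)) (Primrec.snd.comp .fst) .snd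
    exact Primrec.pair (primrec_toCode.comp (Primrec.fst.comp he))
      (primrec_toCode.comp (Primrec.snd.comp he))
  obtain ⟨T, hT⟩ := ClassicalTM.exists_of_primrec hR ho
  refine ⟨T, fun n ρ p hp k hk => ?_⟩
  -- Trace distance `1 / (4 k)` means an error of at most `1 / (2 k)` in each entry; rounding with
  -- `j = 2 k` adds at most `2^(-2 k) ≤ 1 / (2 k)`.
  obtain ⟨y, σ, hout, hdist⟩ := hp (4 * k) (by omega)
  obtain ⟨t, s, h₁, h₂, h₃⟩ := (hU _ _ _ _).1 hout
  obtain ⟨⟨⟨p', k'⟩, t', y', s'⟩, ⟨hz, hP'⟩, hTo⟩ :=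
    hT (strPair p (natToStr k)) ⟨((p, k), t, y, s), rfl, h₁⟩
  obtain ⟨rfl, hk'⟩ := strPair_injective hz
  obtain rfl := natToStr_injective hk'
  -- The search may have found another halting time than `t`; determinism identifies its output with
  -- `σ`.
  obtain ⟨hnn, hσ⟩ := hout.unique ((hU _ _ _ _).2 ⟨t', s', hP', rfl, rfl⟩)
  subst hnn
  rw [heq_iff_eq] at hσ
  choose q₁ hq₁ hq₁' using fun x y : Fin (2 ^ strToNat s') => exists_ratCode_approxFrac (2 * k)
    (pathRun (gates ((p, k), t', y', s'))).2.1 0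
    (pathPhases (pathRun (gates ((p, k), t', y', s'))).1 (strToNat s') x y)
  choose q₂ hq₂ hq₂' using fun x y : Fin (2 ^ strToNat s') => exists_ratCode_approxFrac (2 * k)
    (pathRun (gates ((p, k), t', y', s'))).2.1 6
    (pathPhases (pathRun (gates ((p, k), t', y', s'))).1 (strToNat s') x y)
  refine ⟨Matrix.of fun x y => (q₁ x y, q₂ x y), ?_, fun x y => ?_⟩
  · rw [← rowsToStr_ofFn]
    simp only [Matrix.of_apply, hq₁, hq₂]
    convert hTo using 1
    simp only [o]
    rw [← ofFn_eq_map_range]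
    simp only [← ofFn_eq_map_range]
    rfl
  · have hk0 : (0 : ℝ) < k := by exact_mod_cast hk
    have h₄ := norm_entry_le_traceDist σ ρ.mat x y
    have h₅ : ‖σ x y - ρ.mat x y‖ ≤ 1 / (2 * k) := by
      refine h₄.trans ((mul_le_mul_of_nonneg_left hdist (by norm_num)).trans (le_of_eq ?_))
      push_cast
      field_simp
      norm_num
    have h₆ := abs_sub_entryFrac_le (gates ((p, k), t', y', s')) (2 * k) (strToNat s') x y
    rw [show (quantumRun (gates ((p, k), t', y', s')) (QTape.ofState QState.empty, 0)).1.reduced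
      (strToNat s') = σ from hσ.symm] at h₆
    have h₇ : (1 : ℝ) / 2 ^ (2 * k) ≤ 1 / (2 * k) :=
      one_div_le_one_div_of_le (by positivity) (two_mul_le_two_pow k)
    have h₈ : (1 : ℝ) / (2 * k) + 1 / (2 * k) = 1 / k := by field_simp; norm_num
    have hre := (Complex.abs_re_le_norm (σ x y - ρ.mat x y)).trans h₅
    have him := (Complex.abs_im_le_norm (σ x y - ρ.mat x y)).trans h₅
    rw [Complex.sub_re] at hre
    rw [Complex.sub_im] at him
    simp only [Matrix.of_apply, hq₁', hq₂']
    change |_ - (entryFrac (gates ((p, k), t', y', s')) (2 * k) (strToNat s') x y).1.val| ≤ _ ∧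
      |_ - (entryFrac (gates ((p, k), t', y', s')) (2 * k) (strToNat s') x y).2.val| ≤ _
    obtain ⟨h₆, h₆'⟩ := h₆
    rw [abs_le] at *
    rw [abs_le]
    refine ⟨⟨?_, ?_⟩, ?_, ?_⟩ <;> linarith

theorem Frac.Near.abs_sub_le {K : ℕ} (hK : 0 < K) {f : Frac} {q : ℚ} (hf : 0 < f.2.2)
    (h : f.Near K (ratCode q).toFrac) : |f.val - q| ≤ 3 / K := by
  rw [Frac.near_iff hK hf (den_ratCode_pos q), val_toFrac_ratCode] at h
  exact h

/-- A state can be prepared from approximations of its entries by a classical machine. -/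
theorem DcqTM.exists_of_classical (V : ClassicalTM) : ∃ T : DcqTM, ∀ (n : ℕ) (ρ : QState n)
    (p : BitString),
    (∀ k : ℕ, 1 ≤ k → ∃ B : Matrix (Fin (2 ^ n)) (Fin (2 ^ n)) (ℚ × ℚ),
      V.Outputs (strPair p (natToStr k)) (matToStr B) ∧
      ∀ i j, |(ρ.mat i j).re - ((B i j).1 : ℝ)| ≤ 1 / (k : ℝ) ∧
        |(ρ.mat i j).im - ((B i j).2 : ℝ)| ≤ 1 / (k : ℝ)) →
    ∀ k : ℕ, 1 ≤ k → ∃ (y : BitString) (σ : Matrix (Fin (2 ^ n)) (Fin (2 ^ n)) ℂ),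
      T.Outputs (strPair p (natToStr k)) QState.empty y n σ ∧
        traceDist σ ρ.mat ≤ 1 / (k : ℝ) := by
  obtain ⟨P, hP, hV⟩ := V.exists_primrec_outputs
  let Γ : Type := (BitString × ℕ) × (ℕ × ℕ × ℕ) × List (List (RatCode × RatCode)) ×
    List (QGate × HeadMove)
  let entry : List (List (RatCode × RatCode)) → ℕ → ℕ → RatCode × RatCode := fun rows x y =>
    (rows.getD x []).getD y ((false, 0, 0), (false, 0, 0))
  let near : ℕ → ℕ → Γ → Prop := fun x y c =>
    (entryFrac c.2.2.2 c.2.1.2.1 c.2.1.2.2 x y).1.Near c.2.1.2.1 (entry c.2.2.1 x y).1.toFrac ∧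
    (entryFrac c.2.2.2 c.2.1.2.1 c.2.1.2.2 x y).2.Near c.2.1.2.1 (entry c.2.2.1 x y).2.toFrac
  -- A witness consists of the input `(p, k)`, a running time of `V`, a precision `K`, the number of
  -- qubits, the array, and the gates. The number of qubits is not part of the input; the number of
  -- rows of the array determines it.
  let R : BitString → Γ → Prop := fun z c =>
    z = strPair c.1.1 (natToStr c.1.2) ∧
      P (strPair c.1.1 (natToStr c.2.1.2.1), c.2.1.1, rowsToStr c.2.2.1) ∧
      c.2.2.1.length = 2 ^ c.2.1.2.2 ∧ 5 * c.1.2 * 4 ^ c.2.1.2.2 ≤ c.2.1.2.1 ∧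
      ∀ x < 2 ^ c.2.1.2.2, ∀ y < 2 ^ c.2.1.2.2, near x y c
  have hp : Primrec fun c : Γ => c.1.1 := Primrec.fst.comp .fst
  have hk : Primrec fun c : Γ => c.1.2 := Primrec.snd.comp .fst
  have ht : Primrec fun c : Γ => c.2.1.1 := Primrec.fst.comp (Primrec.fst.comp .snd)
  have hK : Primrec fun c : Γ => c.2.1.2.1 :=
    Primrec.fst.comp (Primrec.snd.comp (Primrec.fst.comp .snd))
  have hn : Primrec fun c : Γ => c.2.1.2.2 :=
    Primrec.snd.comp (Primrec.snd.comp (Primrec.fst.comp .snd))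
  have hrows : Primrec fun c : Γ => c.2.2.1 := Primrec.fst.comp (Primrec.snd.comp .snd)
  have hgates : Primrec fun c : Γ => c.2.2.2 := Primrec.snd.comp (Primrec.snd.comp .snd)
  have hN : Primrec fun c : Γ => 2 ^ c.2.1.2.2 := Primrec.nat_pow'.comp (.const 2) hn
  have hnear : PrimrecRel fun (y : ℕ) (q : ℕ × Γ) => near q.1 y q.2 := by
    have c : Primrec fun q : ℕ × ℕ × Γ => q.2.2 := Primrec.snd.comp .snd
    have he : Primrec fun q : ℕ × ℕ × Γ =>
        entryFrac q.2.2.2.2.2 q.2.2.2.1.2.1 q.2.2.2.1.2.2 q.2.1 q.1 :=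
      primrec_entryFrac (hgates.comp c) (hK.comp c) (hn.comp c) (Primrec.fst.comp .snd) .fst
    have hr : Primrec fun q : ℕ × ℕ × Γ => entry q.2.2.2.2.1 q.2.1 q.1 :=
      (Primrec.list_getD _).comp ((Primrec.list_getD _).comp (hrows.comp c)
        (Primrec.fst.comp .snd)) .fst
    exact (primrec_near (hK.comp c) (Primrec.fst.comp he)
      (primrec_toFrac.comp (Primrec.fst.comp hr))).and (primrec_near (hK.comp c)
        (Primrec.snd.comp he) (primrec_toFrac.comp (Primrec.snd.comp hr)))
  have hall : PrimrecPred fun c : Γ =>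
      ∀ x < 2 ^ c.2.1.2.2, ∀ y < 2 ^ c.2.1.2.2, near x y c :=
    PrimrecRel.ball_lt (R := fun (x : ℕ) (c : Γ) => ∀ y < 2 ^ c.2.1.2.2, near x y c)
      (hnear.ball_lt (hN.comp .snd)) hN
  have hcheck : PrimrecPred fun c : Γ =>
      P (strPair c.1.1 (natToStr c.2.1.2.1), c.2.1.1, rowsToStr c.2.2.1) ∧
      c.2.2.1.length = 2 ^ c.2.1.2.2 ∧ 5 * c.1.2 * 4 ^ c.2.1.2.2 ≤ c.2.1.2.1 ∧
      ∀ x < 2 ^ c.2.1.2.2, ∀ y < 2 ^ c.2.1.2.2, near x y c :=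
    (hP.comp (Primrec.pair (primrec_strPair.comp hp (primrec_natToStr.comp hK))
        (Primrec.pair ht (primrec_rowsToStr.comp hrows)))).and
      ((Primrec.eq.comp (Primrec.list_length.comp hrows) hN).and
      ((Primrec.nat_le.comp (Primrec.nat_mul.comp (Primrec.nat_mul.comp (.const 5) hk)
        (Primrec.nat_pow'.comp (.const 4) hn)) hK).and hall))
  have hR : PrimrecRel R :=
    (Primrec.eq.comp .fst (primrec_strPair.comp (hp.comp .snd)
      (primrec_natToStr.comp (hk.comp .snd)))).and (hcheck.comp Primrec.snd)
  obtain ⟨T, hT⟩ := DcqTM.exists_of_primrec hR hgates (primrec_natToStr.comp hn)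
  refine ⟨T, fun n ρ p hprog k hk => ?_⟩
  -- Three errors of at most `1 / K` make up the tolerance `3 / K` of `Near`: the preparation of the
  -- state, the array of `V`, and the rounding of the computed entries.
  have ex : ∃ c, R (strPair p (natToStr k)) c := by
    have hKpos : 1 ≤ 5 * k * 4 ^ n := Nat.succ_le_of_lt (by positivity)
    generalize hKdef : 5 * k * 4 ^ n = K at hKpos
    have hK0 : (0 : ℝ) < K := by exact_mod_cast hKpos
    obtain ⟨B, hB, hBρ⟩ := hprog K hKpos
    obtain ⟨t, ht⟩ := (hV _ _).1 hB
    obtain ⟨l, hl⟩ := exists_quantumRun_near ρ (show (0 : ℝ) < 1 / K by positivity)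
    refine ⟨((p, k), (t, K, n), List.ofFn fun i => List.ofFn fun j =>
      (ratCode (B i j).1, ratCode (B i j).2), l), rfl, ?_, by simp, hKdef.le, fun x hx y hy => ?_⟩
    · rw [rowsToStr_ofFn]; exact ht
    · have e : entry (List.ofFn fun i => List.ofFn fun j =>
          (ratCode (B i j).1, ratCode (B i j).2)) x y =
          (ratCode (B ⟨x, hx⟩ ⟨y, hy⟩).1, ratCode (B ⟨x, hx⟩ ⟨y, hy⟩).2) :=
        (congrArg (fun r => List.getD r y _) (getD_ofFn _ ⟨x, hx⟩ _)).trans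
          (getD_ofFn _ (⟨y, hy⟩ : Fin (2 ^ n)) _)
      simp only [near, e]
      have hden := den_entryFrac_pos l K n x y
      rw [Frac.near_iff hKpos hden.1 (den_ratCode_pos _),
        Frac.near_iff hKpos hden.2 (den_ratCode_pos _), val_toFrac_ratCode, val_toFrac_ratCode]
      have h₁ := hl ⟨x, hx⟩ ⟨y, hy⟩
      have h₂ := hBρ ⟨x, hx⟩ ⟨y, hy⟩
      have h₃ := abs_sub_entryFrac_le l K n ⟨x, hx⟩ ⟨y, hy⟩
      simp only at h₃
      have h₄ : (1 : ℝ) / 2 ^ K ≤ 1 / K := one_div_le_one_div_of_le hK0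
        (by exact_mod_cast (Nat.lt_two_pow_self (n := K)).le)
      have h₅ : (3 : ℝ) / K = 1 / K + 1 / K + 1 / K := by ring
      have hre := (Complex.abs_re_le_norm _).trans h₁.le
      have him := (Complex.abs_im_le_norm _).trans h₁.le
      rw [Complex.sub_re] at hre
      rw [Complex.sub_im] at him
      obtain ⟨h₂, h₂'⟩ := h₂
      obtain ⟨h₃, h₃'⟩ := h₃
      rw [h₅]
      clear h₁ hl hBρ
      simp only [abs_le] at *
      refine ⟨⟨?_, ?_⟩, ?_, ?_⟩ <;> linarith
  obtain ⟨⟨⟨p', k'⟩, ⟨t, K, m⟩, rows, l⟩, ⟨hz, hPc, hlen, hKle, hclose⟩, hTo⟩ := hT _ ex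
  obtain ⟨rfl, hk'⟩ := strPair_injective hz
  obtain rfl := natToStr_injective hk'
  simp only at hPc hlen hKle hclose hTo
  rw [strToNat_natToStr] at hTo
  have hKpos : 1 ≤ K := le_trans (Nat.succ_le_of_lt (by positivity)) hKle
  have hK0 : (0 : ℝ) < K := by exact_mod_cast hKpos
  have hk0 : (0 : ℝ) < k := by exact_mod_cast hk
  obtain ⟨B, hB, hBρ⟩ := hprog K hKpos
  -- The array in the witness is the output of `V` on `(p, K)`, and this is unique.
  have hrowsB := rowsToStr_injective
    ((((hV _ _).2 ⟨t, hPc⟩).unique hB).trans (rowsToStr_ofFn B).symm)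
  subst hrowsB
  rw [List.length_ofFn] at hlen
  obtain rfl : n = m := Nat.pow_right_injective le_rfl hlen
  refine ⟨[], _, hTo, ?_⟩
  -- Rounding, tolerance and array contribute `1 / K`, `3 / K` and `1 / K` to each of the real and
  -- the imaginary part.
  have hent : ∀ x y, ‖(quantumRun l (QTape.ofState QState.empty, 0)).1.reduced n x y -
      ρ.mat x y‖ ≤ 10 / K := by
    intro x y
    have e : entry (List.ofFn fun i => List.ofFn fun j =>
        (ratCode (B i j).1, ratCode (B i j).2)) x y = (ratCode (B x y).1, ratCode (B x y).2) :=
      (congrArg (fun r => List.getD r y _) (getD_ofFn _ x _)).trans (getD_ofFn _ y _)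
    have hc := hclose x x.2 y y.2
    simp only [near, e] at hc
    have hden := den_entryFrac_pos l K n x y
    have h₁ := hc.1.abs_sub_le hKpos hden.1
    have h₁' := hc.2.abs_sub_le hKpos hden.2
    obtain ⟨h₂, h₂'⟩ := hBρ x y
    obtain ⟨h₃, h₃'⟩ := abs_sub_entryFrac_le l K n x y
    have h₄ : (1 : ℝ) / 2 ^ K ≤ 1 / K := one_div_le_one_div_of_le hK0
      (by exact_mod_cast (Nat.lt_two_pow_self (n := K)).le)
    have h₅ : (3 : ℝ) / K = 1 / K + 1 / K + 1 / K := by ring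
    have h₆ : (10 : ℝ) / K = 5 * (1 / K) + 5 * (1 / K) := by ring
    rw [h₅] at h₁ h₁'
    refine (Complex.norm_le_abs_re_add_abs_im _).trans ?_
    rw [h₆, Complex.sub_re, Complex.sub_im]
    clear hc hclose hBρ hprog
    rw [abs_le] at h₁ h₁' h₂ h₂' h₃ h₃'
    refine add_le_add (abs_le.2 ⟨?_, ?_⟩) (abs_le.2 ⟨?_, ?_⟩) <;> linarith
  -- The bound is `4ⁿ * (10 / K) / 2`, which explains the requirement `5 k 4ⁿ ≤ K`.
  refine (traceDist_le_of_entries (by positivity) hent).trans ?_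
  have hKle' : (5 * k * 4 ^ n : ℝ) ≤ K := by exact_mod_cast hKle
  have e : (((2 ^ n : ℕ) : ℝ)) ^ 2 = 4 ^ n := by
    push_cast
    rw [← pow_mul, mul_comm, pow_mul]
    norm_num
  rw [e, mul_div_assoc', div_div, div_le_div_iff₀ (by positivity) hk0]
  linarith

/-! ## The comparison of the complexities -/

/-- With `t` a program for the simulating machine, `s t p` is a program for the array whenever `p`
is one for the state. The constant depends only on `t`, hence neither on `n` nor on `ρ`, and an
infinite right side needs no special care. -/
theorem arrayComplexity_le_stateComplexity (U : DcqTM) {V : ClassicalTM} (hV : V.IsUniversal) :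
    ∃ c : ℕ, ∀ (n : ℕ) (ρ : QState n), V.arrayComplexity ρ.mat ≤ U.stateComplexity ρ + c := by
  obtain ⟨T, hT⟩ := ClassicalTM.exists_of_dcq U
  obtain ⟨huniv, s, _, hlen, hs⟩ := hV
  obtain ⟨t, ht⟩ := huniv T
  obtain ⟨c, hc⟩ := hlen t
  refine ⟨c, fun n ρ => tsub_le_iff_right.1 (le_iInf₂ fun p hp => tsub_le_iff_right.2 ?_)⟩
  refine iInf₂_le_of_le (s t p) (fun k hk => ?_) (by exact_mod_cast hc p)
  obtain ⟨B, hB, hBρ⟩ := hT n ρ p hp k hk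
  exact ⟨B, (hs _ _ _ _).2 ((ht _ _).2 hB), hBρ⟩

theorem stateComplexity_le_arrayComplexity {U : DcqTM} (hU : U.IsUniversal) (V : ClassicalTM) :
    ∃ c : ℕ, ∀ (n : ℕ) (ρ : QState n), U.stateComplexity ρ ≤ V.arrayComplexity ρ.mat + c := by
  obtain ⟨T, hT⟩ := DcqTM.exists_of_classical V
  obtain ⟨huniv, s, _, hlen, hs⟩ := hU
  obtain ⟨t, ht⟩ := huniv T
  obtain ⟨c, hc⟩ := hlen t
  refine ⟨c, fun n ρ => tsub_le_iff_right.1 (le_iInf₂ fun p hp => tsub_le_iff_right.2 ?_)⟩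
  refine iInf₂_le_of_le (s t p) (fun k hk => ?_) (by exact_mod_cast hc p)
  obtain ⟨y, σ, hσ, hd⟩ := hT n ρ p hp k hk
  exact ⟨y, σ, (hs _ _ _ _ _ _ _ _).2 ((ht _ _ _ _ _ _).2 hσ), hd⟩

theorem theorem2 (U : DcqTM) (hU : U.IsUniversal) (V : ClassicalTM) (hV : V.IsUniversal) :
    ∃ c : ℕ, ∀ (n : ℕ) (ρ : QState n),
      V.arrayComplexity ρ.mat ≤ U.stateComplexity ρ + c ∧
      U.stateComplexity ρ ≤ V.arrayComplexity ρ.mat + c := by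
  obtain ⟨c, hc⟩ := arrayComplexity_le_stateComplexity U hV
  obtain ⟨c', hc'⟩ := stateComplexity_le_arrayComplexity hU V
  refine ⟨max c c', fun n ρ => ⟨(hc n ρ).trans ?_, (hc' n ρ).trans ?_⟩⟩ <;> gcongr <;> simp
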